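/- Let $\Bbbk$ be an algebraically closed field of characteristic zero, let $0<a<r$ be coprime integers, and let $X$ be the minimal resolution of the quotient singularity $\mathbb{A}^2_\Bbbk/G$ of type $\frac1r(1,a)$. It is the smooth toric surface whose fan has the rays $\Sigma(1)=\{\tau_0,\dots,\tau_{\ell+1}\}$, where $\tau_i$ is generated by $\frac1r(\beta_i,\alpha_i)\in N=\mathbb{Z}^2+\mathbb{Z}\frac1r(1,a)$, with $(\beta_{\ell+1},\alpha_{\ell+1})=(0,r)$, $(\beta_\ell,\alpha_\ell)=(1,a)$, $(\beta_{i-1},\alpha_{i-1})=\lceil \alpha_{i+1}/\alpha_i\rceil(\beta_i,\alpha_i)-(\beta_{i+1},\alpha_{i+1})$, ending with $(\beta_0,\alpha_0)=(r,0)$. Then $\operatorname{Pic}(X)=\mathbb{Z}^{\Sigma(1)}/M$ with $M=\operatorname{Hom}(N,\mathbb{Z})$, and the torus-invariant sections of a line bundle $L$ are identified, up to scalars, with the divisors $D\in\mathbb{N}^{\Sigma(1)}$ of class $L$. Let $\underline{\mathscr{E}}=(\mathscr{E}_0,\dots,\mathscr{E}_m)$ be distinct effective line bundles on $X$ with $\mathscr{E}_0=\mathscr{O}_X$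 and $m>0$. Its quiver of sections $Q$ has vertex set $Q_0=\{0,\dots,m\}$, and its arrows from $i$ to $j$ are the irreducible torus-invariant sections of $\mathscr{E}_j\otimes\mathscr{E}_i^{-1}$, i.e. those that are not constant and are not a composition $\mathscr{E}_i\to\mathscr{E}_k\to\mathscr{E}_j$ of two nonconstant torus-invariant sections, for any $k\in Q_0$. Let $\operatorname{Wt}(Q)=\{\theta\in\mathbb{Z}^{Q_0}:\sum_i\theta_i=0\}$, grade $\Bbbk[y_e:e\in Q_1]$ by giving $y_e$ the degree $\chi_{\mathrm{h}(e)}-\chi_{\mathrm{t}(e)}\in\operatorname{Wt}(Q)$, and let the torus $T_Q=\operatorname{Spec}\Bbbk[\operatorname{Wt}(Q)]=\operatorname{Hom}(\operatorname{Wt}(Q),\Bbbk^\times)$ act on $\mathbb{A}^{Q_1}_\Bbbk=\operatorname{Spec}\Bbbk[y_e:e\in Q_1]$ by $(t\cdot w)_e=t_{\mathrm{h}(e)}w_et_{\mathrm{t}(e)}^{-1}$. Put $\vartheta=(-m,1,\dots,1)\in\operatorname{Wt}(Q)$, and let $$|\underline{\mathscr{E}}|:=\mathbb{A}^{Q_1}_\Bbbk/\!\!/_{\vartheta}T_Q=\operatorname{Proj}\bigoplus_{j\ge0}\Bbbk[y_e:e\in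 Q_1]_{j\vartheta}$$ be the multigraded linear series of $\underline{\mathscr{E}}$, and $\mathbb{A}^{Q_1}_\Bbbk/T_Q:=\operatorname{Spec}\Bbbk[y_e:e\in Q_1]_0$. Then: 1. $|\underline{\mathscr{E}}|$ is the fine moduli space $\mathcal{M}_\vartheta(Q)$ of isomorphism classes of $\vartheta$-stable representations of $Q$ of dimension vector $(1,\dots,1)$. That is, call a family over a $\Bbbk$-scheme $S$ a collection of line bundles $W_i$ on $S$ $(i\in Q_0)$ with $W_0\cong\mathscr{O}_S$ and homomorphisms $W_{\mathrm{t}(e)}\to W_{\mathrm{h}(e)}$ $(e\in Q_1)$ such that for each $s\in S$ the fibre $W(s)$ is $\vartheta$-stable, i.e. every proper nonzero subrepresentation $W'\subset W(s)$ has $\sum_{i:W'_i\ne0}\vartheta_i>0$; then $|\underline{\mathscr{E}}|$ carries a family such that every family over every $\Bbbk$-scheme $S$ is isomorphic to its pullback along a unique $\Bbbk$-morphism $S\to|\underline{\mathscr{E}}|$. 2. $|\underline{\mathscr{E}}|$ is smooth over $\Bbbk$ and is a toric variety, i.e. an integral separated $\Bbbk$-scheme of finite type that contains a torus as an open subscheme,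 the multiplication of which extends to an action on the whole of $|\underline{\mathscr{E}}|$. 3. The canonical morphism $|\underline{\mathscr{E}}|\to\mathbb{A}^{Q_1}_\Bbbk/T_Q$ given by variation of GIT quotient $\vartheta\mapsto0$ is projective. 4. Let $B_Q=\big(\prod_{e\in T}y_e : T\text{ a spanning tree of }Q\text{ with root at }0\big)$, where a set of arrows $T$ is a spanning tree with root at $0$ if every vertex is reached from $0$ by exactly one directed path in $T$. The action of $T_Q$ restricts to $\mathbb{A}^{Q_1}_\Bbbk\setminus\mathbb{V}(B_Q)$, and there is a morphism $\varphi:\mathbb{A}^{Q_1}_\Bbbk\setminus\mathbb{V}(B_Q)\to|\underline{\mathscr{E}}|$ over $\mathbb{A}^{Q_1}_\Bbbk/T_Q$ that is a geometric quotient by $T_Q$: $\varphi$ is $T_Q$-invariant, surjective and submersive, its fibres are orbits (i.e. with $U=\mathbb{A}^{Q_1}_\Bbbk\setminus\mathbb{V}(B_Q)$ the map $T_Q\times U\to U\times_{|\underline{\mathscr{E}}|}U$ is surjective), and the functions on each open subset of $|\underline{\mathscr{E}}|$ are the $T_Q$-invariant functions on its preimage. -/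

import Mathlib

open CategoryTheory AlgebraicGeometry
open CategoryTheory.MonoidalCategory CategoryTheory.CartesianMonoidalCategory
open scoped TensorProduct

universe u

noncomputable section

namespace MLS

/-! ### The minimal resolution of the quotient singularity of type `1/r (1, a)` -/

/-- The sequence of pairs `(β, α)` with `(0, r)`, `(1, a)` as first two terms and with
`(β, α)ₙ₊₂ = c (β, α)ₙ₊₁ - (β, α)ₙ`, where `c = ⌈αₙ / αₙ₊₁⌉` is the next coefficient of the
Jung-Hirzebruch continued fraction of `r / a`. -/
def hjSeq (r a : ℕ) : ℕ → ℤ × ℤ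
  | 0 => (0, r)
  | 1 => (1, a)
  | n + 2 => ⌈((hjSeq r a n).2 : ℚ) / ((hjSeq r a (n + 1)).2 : ℚ)⌉ • hjSeq r a (n + 1) - hjSeq r a n

/-- The rays `Σ(1)` of the fan of the minimal resolution. The ray `n` is generated by
`(1 / r) (β, α)ₙ` in the lattice `N = ℤ² + ℤ (1 / r) (1, a)`; the sequence starts with `(0, r)`
and stops at `(r, 0)`, the first term with `α = 0`. -/
def Ray (r a : ℕ) : Type := {n : ℕ // ∀ j < n, 0 < (hjSeq r a j).2}

/-- Principal torus-invariant divisors: the image in `ℤ^Σ(1)` of the lattice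
`M = Hom(N, ℤ) = {(u, v) ∈ ℤ² : r ∣ u + a v}` of invariant Laurent monomials `x^u y^v`, whose
order along the ray `n` is the pairing `(βₙ u + αₙ v) / r`. -/
def principalDivisors (r a : ℕ) : AddSubgroup (Ray r a → ℤ) where
  carrier := {D | ∃ u v : ℤ, (r : ℤ) ∣ u + a * v ∧
    ∀ ρ : Ray r a, r * D ρ = (hjSeq r a ρ.1).1 * u + (hjSeq r a ρ.1).2 * v}
  zero_mem' := ⟨0, 0, by simp, by simp⟩
  add_mem' := by
    rintro D D' ⟨u, v, h, hD⟩ ⟨u', v', h', hD'⟩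
    refine ⟨u + u', v + v', ?_, fun ρ => ?_⟩
    · have := dvd_add h h'
      have e : u + u' + a * (v + v') = u + a * v + (u' + a * v') := by ring
      rwa [e]
    · simp only [Pi.add_apply, mul_add, hD, hD']
      ring
  neg_mem' := by
    rintro D ⟨u, v, h, hD⟩
    refine ⟨-u, -v, ?_, fun ρ => ?_⟩
    · have this : (r : ℤ) ∣ u + a * v → (r : ℤ) ∣ -(u + a * v) := (dvd_neg).2
      have e : -u + a * -v = -(u + a * v) := by ring
      rw [e]
      exact this h
    · simp only [Pi.neg_apply, mul_neg, hD]
      ring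

/-- The Picard group of the minimal resolution, the cokernel of `M → ℤ^Σ(1)`. -/
abbrev Pic (r a : ℕ) : Type := (Ray r a → ℤ) ⧸ principalDivisors r a

/-- The class of the line bundle `O(D)` of an effective torus-invariant divisor `D`. -/
def divisorClass {r a : ℕ} (D : Ray r a → ℕ) : Pic r a :=
  QuotientAddGroup.mk fun ρ => (D ρ : ℤ)

/-- A line bundle is effective if it is isomorphic to `O(D)` for an effective divisor. -/
def IsEffective {r a : ℕ} (L : Pic r a) : Prop := ∃ D : Ray r a → ℕ, divisorClass D = L

/-- The arrows from `i` to `j` in the quiver of sections of `E`: the irreducible torus-invariant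
sections of `E_j ⊗ E_i⁻¹`. An invariant section is identified, up to scalars, with its divisor of
zeroes `D`. It is irreducible if it is not constant and is not a composition
`E_i → E_k → E_j` of two nonconstant torus-invariant sections. -/
def IsArrow {r a m : ℕ} (E : Fin (m + 1) → Pic r a) (i j : Fin (m + 1)) (D : Ray r a → ℕ) : Prop :=
  divisorClass D = E j - E i ∧ D ≠ 0 ∧
    ∀ (k : Fin (m + 1)) (D₁ D₂ : Ray r a → ℕ), divisorClass D₁ = E k - E i →
      divisorClass D₂ = E j - E k → D = D₁ + D₂ → D₁ = 0 ∨ D₂ = 0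

/-- The vertices of the quiver of sections of `E = (E_0, ..., E_m)`. -/
def QuiverOfSections {r a m : ℕ} (_E : Fin (m + 1) → Pic r a) : Type := Fin (m + 1)

namespace QuiverOfSections

variable {r a m : ℕ} (E : Fin (m + 1) → Pic r a)

instance : Quiver.{0} (QuiverOfSections E) where
  Hom i j := {D : Ray r a → ℕ // IsArrow E i j D}

instance : Fintype (QuiverOfSections E) := inferInstanceAs (Fintype (Fin (m + 1)))

instance : DecidableEq (QuiverOfSections E) := inferInstanceAs (DecidableEq (Fin (m + 1)))

/-- The distinguished vertex, corresponding to `E_0`. -/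
def root : QuiverOfSections E := (0 : Fin (m + 1))

end QuiverOfSections

/-! ### Weights, the torus `T_Q` and its action on the representation space -/

section Weights

variable (V : Type) [Quiver.{0} V] [Fintype V] [DecidableEq V]

/-- The lattice `Wt(Q)` of integral functions on the vertices with sum zero. -/
def Wt : AddSubgroup (V → ℤ) where
  carrier := {θ | ∑ i, θ i = 0}
  zero_mem' := by simp
  add_mem' := by
    intro θ θ' h h'
    simp only [Set.mem_ofPred_eq] at h h' ⊢
    simp [Finset.sum_add_distrib, h, h']
  neg_mem' := by
    intro θ h
    simp only [Set.mem_ofPred_eq] at h ⊢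
    simp [h]

variable {V}

/-- The incidence map on the basis: `inc(χ_e) = χ_{h(e)} - χ_{t(e)}`. -/
def inc (e : Quiver.Total V) : Wt V :=
  ⟨Pi.single e.right 1 - Pi.single e.left 1, by simp [Wt]⟩

/-- The weight `ϑ = (-m, 1, ..., 1)`, where `m + 1` is the number of vertices and the entry `-m` is
at the vertex `o`. -/
def specialWeight (o : V) : Wt V :=
  ⟨fun i => if i = o then 1 - (Fintype.card V : ℤ) else 1, by
    have h : ∀ i : V, (if i = o then 1 - (Fintype.card V : ℤ) else 1) =
        1 - (if i = o then (Fintype.card V : ℤ) else 0) := by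
      intro i
      split_ifs <;> simp
    simp [Wt, h]⟩

end Weights

section Algebra

variable (k : Type u) [Field k]

/-- The coordinate ring of the space `𝔸^{Q_1}` of representations of dimension vector
`(1, ..., 1)`. -/
abbrev CoordRing (V : Type) [Quiver.{0} V] : Type u := MvPolynomial (Quiver.Total V) k

section GIT

variable {σ M : Type} [AddCommGroup M] (w : σ → M) (θ : M)

/-- The ring `⨁_{j ≥ 0} k[y]_{jθ}`, where `k[y]` is graded by giving the weight `w s` to the
variable `y_s`; it is realised as the ring of polynomials in an auxiliary variable whose `j`-th
coefficient is in `k[y]_{jθ}`. -/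
def semiInvariants : Subring (Polynomial (MvPolynomial σ k)) where
  carrier := {p | ∀ j, (p.coeff j).IsWeightedHomogeneous w (j • θ)}
  zero_mem' := fun j => by
    rw [Polynomial.coeff_zero]
    exact MvPolynomial.isWeightedHomogeneous_zero k w _
  one_mem' := fun j => by
    rw [Polynomial.coeff_one]
    split_ifs with h
    · subst h
      rw [zero_smul]
      exact MvPolynomial.isWeightedHomogeneous_one k w
    · exact MvPolynomial.isWeightedHomogeneous_zero k w _
  add_mem' := fun {p q} hp hq j => by
    rw [Polynomial.coeff_add]
    exact (hp j).add (hq j)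
  mul_mem' := fun {p q} hp hq j => by
    rw [Polynomial.coeff_mul, ← MvPolynomial.mem_weightedHomogeneousSubmodule]
    refine Submodule.sum_mem _ fun x hx => ?_
    rw [MvPolynomial.mem_weightedHomogeneousSubmodule, ← Finset.HasAntidiagonal.mem_antidiagonal.1 hx, add_smul]
    exact (hp _).mul (hq _)
  neg_mem' := fun {p} hp j => by
    rw [Polynomial.coeff_neg]
    exact Submodule.neg_mem (MvPolynomial.weightedHomogeneousSubmodule k w (j • θ)) (hp j)

/-- The summand `k[y]_{jθ}` of degree `j` in `⨁_{j ≥ 0} k[y]_{jθ}`. -/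
def semiInvariantsGrading (j : ℕ) : AddSubgroup (semiInvariants k w θ) where
  carrier := {p | ∀ i, i ≠ j → (p : Polynomial (MvPolynomial σ k)).coeff i = 0}
  zero_mem' := fun i _ => by simp
  add_mem' := fun {p q} hp hq i hi => by
    have h₁ := hp i hi
    have h₂ := hq i hi
    simp [h₁, h₂]
  neg_mem' := fun {p} hp i hi => by
    have h₁ := hp i hi
    simp [h₁]

instance : SetLike.GradedMonoid (semiInvariantsGrading k w θ) where
  one_mem := fun i hi => by
    simp [Polynomial.coeff_one, hi]
  mul_mem := fun i j p q hp hq n hn => by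
    rw [MulMemClass.coe_mul, Polynomial.coeff_mul]
    refine Finset.sum_eq_zero fun x hx => ?_
    by_cases h₁ : x.1 = i
    · by_cases h₂ : x.2 = j
      · exact absurd (by rw [← Finset.HasAntidiagonal.mem_antidiagonal.1 hx, h₁, h₂]) hn
      · rw [hq _ h₂, mul_zero]
    · rw [hp _ h₁, zero_mul]

/-- The homogeneous component of degree `j`. -/
def semiInvariantsComponent (p : semiInvariants k w θ) (j : ℕ) : semiInvariantsGrading k w θ j :=
  ⟨⟨Polynomial.monomial j ((p : Polynomial (MvPolynomial σ k)).coeff j), fun i => by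
    rw [Polynomial.coeff_monomial]
    split_ifs with h
    · subst h
      exact p.2 _
    · exact MvPolynomial.isWeightedHomogeneous_zero k w _⟩, fun i hi => by
    rw [Polynomial.coeff_monomial, if_neg (Ne.symm hi)]⟩

theorem semiInvariantsComponent_self (j : ℕ) (p : semiInvariantsGrading k w θ j) :
    semiInvariantsComponent k w θ p j = p := by
  apply Subtype.ext
  apply Subtype.ext
  ext1 i
  change (Polynomial.monomial j _).coeff i = _
  rw [Polynomial.coeff_monomial]
  split_ifs with h
  · subst h
    rfl
  · exact (p.2 i (Ne.symm h)).symm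

theorem semiInvariantsComponent_ne (i j : ℕ) (h : i ≠ j) (p : semiInvariantsGrading k w θ j) :
    semiInvariantsComponent k w θ p i = 0 := by
  apply Subtype.ext
  apply Subtype.ext
  change Polynomial.monomial i _ = 0
  rw [p.2 i h, map_zero]

theorem semiInvariantsComponent_add (p q : semiInvariants k w θ) (j : ℕ) :
    semiInvariantsComponent k w θ (p + q) j =
      semiInvariantsComponent k w θ p j + semiInvariantsComponent k w θ q j := by
  apply Subtype.ext
  apply Subtype.ext
  change Polynomial.monomial j ((p + q : Polynomial (MvPolynomial σ k)).coeff j) =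
    Polynomial.monomial j _ + Polynomial.monomial j _
  rw [Polynomial.coeff_add, map_add]

theorem semiInvariantsComponent_coe (x : DirectSum ℕ fun j => semiInvariantsGrading k w θ j)
    (j : ℕ) : semiInvariantsComponent k w θ
      (DirectSum.coeAddMonoidHom (semiInvariantsGrading k w θ) x) j = x j := by
  induction x using DirectSum.induction_on with
  | zero =>
    apply Subtype.ext
    apply Subtype.ext
    change Polynomial.monomial j _ = 0
    simp
  | of i p =>
    rw [DirectSum.coeAddMonoidHom_of]
    by_cases h : j = i
    · subst h
      rw [semiInvariantsComponent_self, DirectSum.of_eq_same]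
    · rw [semiInvariantsComponent_ne k w θ _ _ h, DirectSum.of_eq_of_ne _ _ _ h]
  | add x y hx hy => rw [map_add, semiInvariantsComponent_add, hx, hy, DirectSum.add_apply]

instance : GradedRing (semiInvariantsGrading k w θ) where
  decompose' p := ∑ j ∈ (p : Polynomial (MvPolynomial σ k)).support,
    DirectSum.of (fun j => semiInvariantsGrading k w θ j) j (semiInvariantsComponent k w θ p j)
  left_inv p := by
    apply Subtype.ext
    rw [map_sum]
    simp only [DirectSum.coeAddMonoidHom_of]
    rw [AddSubmonoidClass.coe_finsetSum]
    exact (p : Polynomial (MvPolynomial σ k)).as_sum_support.symm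
  right_inv x := by
    refine DFinsupp.ext fun j => ?_
    rw [← semiInvariantsComponent_coe k w θ x j, DFinsupp.finsetSum_apply]
    set p := DirectSum.coeAddMonoidHom (semiInvariantsGrading k w θ) x
    by_cases hj : j ∈ (p : Polynomial (MvPolynomial σ k)).support
    · rw [Finset.sum_eq_single_of_mem j hj fun i _ hi => DirectSum.of_eq_of_ne _ _ _ hi.symm]
      exact DirectSum.of_eq_same _ _
    · rw [Finset.sum_eq_zero fun i hi => DirectSum.of_eq_of_ne _ _ _
        (ne_of_mem_of_not_mem hi hj).symm]
      apply Subtype.ext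
      apply Subtype.ext
      change 0 = Polynomial.monomial j _
      rw [Polynomial.notMem_support_iff.1 hj, map_zero]

/-- The GIT quotient `Proj ⨁_{j ≥ 0} k[y]_{jθ}`. -/
abbrev gitQuotient : Scheme.{u} := Proj (semiInvariantsGrading k w θ)

attribute [local instance] MvPolynomial.WeightedHomogeneousSubmodule.gradedMonoid in
/-- The ring of invariants `k[y]_0`. -/
abbrev invariants : Subalgebra k (MvPolynomial σ k) :=
  SetLike.GradeZero.subalgebra (MvPolynomial.weightedHomogeneousSubmodule k w)

/-- The affine quotient `Spec k[y]_0`. -/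
abbrev affineQuotient : Scheme.{u} := Spec (.of (invariants k w))

/-- The quotient map from the affine space `Spec k[y]` to `Spec k[y]_0`. -/
def toAffineQuotient : Spec (.of (MvPolynomial σ k)) ⟶ affineQuotient k w :=
  Spec.map (CommRingCat.ofHom (invariants k w).val.toRingHom)

/-- The identification of `k[y]_0` with the degree zero part of `⨁_{j ≥ 0} k[y]_{jθ}`. -/
def invariantsToZero : invariants k w →+* semiInvariantsGrading k w θ 0 where
  toFun f := ⟨⟨Polynomial.C f, fun j => by
    rw [Polynomial.coeff_C]
    split_ifs with h
    · subst h
      rw [zero_smul]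
      exact f.2
    · exact MvPolynomial.isWeightedHomogeneous_zero k w _⟩, fun i hi => by
    rw [Polynomial.coeff_C, if_neg hi]⟩
  map_one' := rfl
  map_zero' := by
    apply Subtype.ext
    apply Subtype.ext
    exact Polynomial.C_0
  map_add' f g := by
    apply Subtype.ext
    apply Subtype.ext
    exact Polynomial.C_add
  map_mul' f g := by
    apply Subtype.ext
    apply Subtype.ext
    exact Polynomial.C_mul

/-- The morphism from the GIT quotient to the affine quotient obtained by variation of GIT quotient
`θ ↦ 0`. -/
def gitToAffine : gitQuotient k w θ ⟶ affineQuotient k w :=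
  Proj.toSpecZero (semiInvariantsGrading k w θ) ≫
    Spec.map (CommRingCat.ofHom (invariantsToZero k w θ))

/-- The structure morphism of the GIT quotient as a `k`-scheme. -/
def gitToBase : gitQuotient k w θ ⟶ Spec (.of k) :=
  gitToAffine k w θ ≫ Spec.map (CommRingCat.ofHom (algebraMap k (invariants k w)))

end GIT

section Torus

variable (V : Type) [Quiver.{0} V] [Fintype V] [DecidableEq V]

/-- The coordinate ring `k[Wt(Q)]` of the torus `T_Q = Hom(Wt(Q), kˣ)`. -/
abbrev TorusRing : Type u := AddMonoidAlgebra k (Wt V)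

/-- The torus `T_Q`. -/
abbrev torus : Scheme.{u} := Spec (.of (TorusRing k V))

/-- The space `𝔸^{Q_1} = Spec k[y_e : e ∈ Q_1]`. -/
abbrev repSpace : Scheme.{u} := Spec (.of (CoordRing k V))

/-- The structure morphism of `T_Q`. -/
abbrev torusToBase : torus k V ⟶ Spec (.of k) :=
  Spec.map (CommRingCat.ofHom (algebraMap k (TorusRing k V)))

/-- The structure morphism of `𝔸^{Q_1}`. -/
abbrev repSpaceToBase : repSpace k V ⟶ Spec (.of k) :=
  Spec.map (CommRingCat.ofHom (algebraMap k (CoordRing k V)))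

/-- The coaction `y_e ↦ χ^{inc(e)} ⊗ y_e`. -/
def coaction : CoordRing k V →ₐ[k] TorusRing k V ⊗[k] CoordRing k V :=
  MvPolynomial.aeval fun e => AddMonoidAlgebra.single (inc e) 1 ⊗ₜ MvPolynomial.X e

/-- The action `T_Q × 𝔸^{Q_1} ⟶ 𝔸^{Q_1}`, given by `(t · w)_e = t_{h(e)} w_e t_{t(e)}⁻¹`. -/
def action : Limits.pullback (torusToBase k V) (repSpaceToBase k V) ⟶ repSpace k V :=
  (pullbackSpecIso k (TorusRing k V) (CoordRing k V)).hom ≫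
    Spec.map (CommRingCat.ofHom (coaction k V).toRingHom)

variable {V}

/-- A finite set of arrows is a spanning tree with root at `o` if every vertex is reached from `o`
by exactly one path along arrows of the set. -/
def IsSpanningTree (o : V) (T : Finset (Quiver.Total V)) : Prop :=
  ∀ i : V, Nonempty (Unique (Quiver.Path
    (V := WideSubquiver.toType V (Quiver.wideSubquiverEquivSetTotal.symm (T : Set _))) o i))

/-- The ideal `B_Q` generated by the monomials of the spanning trees with root at `o`. -/
def treeIdeal (o : V) : Ideal (CoordRing k V) :=
  Ideal.span {f | ∃ T : Finset (Quiver.Total V), IsSpanningTree o T ∧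
    f = ∏ e ∈ T, MvPolynomial.X e}

/-- The open subscheme `𝔸^{Q_1} ∖ 𝕍(B_Q)`. -/
def treeLocus (o : V) : (repSpace k V).Opens :=
  ⟨(PrimeSpectrum.zeroLocus (treeIdeal k o : Set (CoordRing k V)))ᶜ,
    (PrimeSpectrum.isClosed_zeroLocus _).isOpen_compl⟩

/-- The restriction `T_Q × U ⟶ 𝔸^{Q_1}` of the action to an open subscheme `U`. -/
def restrictedAction (U : (repSpace k V).Opens) :
    Limits.pullback (torusToBase k V) (U.ι ≫ repSpaceToBase k V) ⟶ repSpace k V :=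
  Limits.pullback.lift (Limits.pullback.fst _ _) (Limits.pullback.snd _ _ ≫ U.ι)
    (by rw [Category.assoc]; exact Limits.pullback.condition) ≫ action k V

end Torus

end Algebra

/-! ### Geometric quotients, projective morphisms, toric varieties -/

/-- `φ : X ⟶ Y` is a geometric quotient by a group action, given by the action `a : G × X ⟶ X` and
the projection `p : G × X ⟶ X`. -/
structure IsGeometricQuotient {P X Y : Scheme.{u}} (a p : P ⟶ X) (φ : X ⟶ Y) : Prop where
  /-- `φ` is constant on orbits. -/
  comp_eq : a ≫ φ = p ≫ φ
  surjective : Surjective φ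
  /-- The fibres of `φ` are orbits: `G × X` surjects onto `X ×_Y X`. -/
  orbits : Surjective (Limits.pullback.lift a p comp_eq)
  /-- `φ` is submersive. -/
  isQuotientMap : Topology.IsQuotientMap φ
  /-- The functions on an open subset of `Y` are the invariant functions on its preimage. -/
  injective : ∀ U : Y.Opens, Function.Injective (φ.app U)
  invariant : ∀ (U : Y.Opens) (h : p ⁻¹ᵁ φ ⁻¹ᵁ U ≤ a ⁻¹ᵁ φ ⁻¹ᵁ U) (f : Γ(X, φ ⁻¹ᵁ U)),
    a.appLE (φ ⁻¹ᵁ U) (p ⁻¹ᵁ φ ⁻¹ᵁ U) h f = p.app (φ ⁻¹ᵁ U) f ↔ f ∈ Set.range (φ.app U)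

section ProjectiveSpace

attribute [local instance] MvPolynomial.gradedAlgebra

/-- Projective space `ℙⁿ` over a ring `R`. -/
abbrev projectiveSpace (n : ℕ) (R : Type u) [CommRing R] : Scheme.{u} :=
  Proj (MvPolynomial.homogeneousSubmodule (Fin (n + 1)) R)

/-- The structure morphism of projective space over `R`. -/
def projectiveSpaceToBase (n : ℕ) (R : Type u) [CommRing R] :
    projectiveSpace n R ⟶ Spec (.of R) :=
  Proj.toSpecZero _ ≫ Spec.map (CommRingCat.ofHom
    (algebraMap R (MvPolynomial.homogeneousSubmodule (Fin (n + 1)) R 0)))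

end ProjectiveSpace

/-- A morphism to an affine scheme `Spec R` is projective if it factors as a closed immersion
in some `ℙⁿ` over `R`, followed by the structure morphism of `ℙⁿ`. -/
def IsProjective {R : Type u} [CommRing R] {X : Scheme.{u}} (f : X ⟶ Spec (.of R)) : Prop :=
  ∃ (n : ℕ) (ι : X ⟶ projectiveSpace n R),
    IsClosedImmersion ι ∧ ι ≫ projectiveSpaceToBase n R = f

/-- The torus `Spec k[ℤⁿ]`, as a scheme over `k`. -/
abbrev stdTorus (k : Type u) [Field k] (n : ℕ) : Over (Spec (.of k)) :=
  (Spec (.of (AddMonoidAlgebra k (Fin n → ℤ)))).asOver (Spec (.of k))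

/-- A (not necessarily normal) toric variety over `k`: an integral separated scheme of finite type
that contains a torus as a (dense) open subscheme, such that the multiplication of the torus
extends to an action on the variety. -/
def IsToricVariety {k : Type u} [Field k] {Y : Scheme.{u}} (f : Y ⟶ Spec (.of k)) : Prop :=
  IsIntegral Y ∧ IsSeparated f ∧ LocallyOfFiniteType f ∧ QuasiCompact f ∧
    ∃ (n : ℕ) (j : stdTorus k n ⟶ Over.mk f) (act : ModObj (stdTorus k n) (Over.mk f)),
      IsOpenImmersion j.left ∧
        (stdTorus k n ◁ j) ≫ act.smul = MonObj.mul (X := stdTorus k n) ≫ j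

/-! ### Families of stable representations and fine moduli spaces -/

section Moduli

variable {V : Type} [Quiver.{0} V] [Fintype V]

/-- Isomorphism of representations of a quiver in a category: isomorphisms at the vertices
which commute with the maps of the arrows. -/
def RepIso {C : Type*} [Category C] (W W' : V ⥤q C) : Prop :=
  ∃ ψ : ∀ i, W.obj i ≅ W'.obj i,
    ∀ (i j : V) (e : i ⟶ j), W.map e ≫ (ψ j).hom = (ψ i).hom ≫ W'.map e

/-- A representation of dimension vector `(1, ..., 1)` over a field is `θ`-stable if every
proper nonzero subrepresentation `N` satisfies `θ(N) > 0`, where `θ(N)` is the sum of `θ` over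
the support of `N`. -/
def IsStableRep {K : Type u} [Field K] (θ : V → ℤ) (W : V ⥤q ModuleCat.{u} K) : Prop :=
  (∀ i, Module.finrank K (W.obj i) = 1) ∧
    ∀ N : ∀ i, Submodule K (W.obj i),
      (∀ (i j : V) (e : i ⟶ j), (N i).map (W.map e).hom ≤ N j) →
      (∃ i, N i ≠ ⊥) → (∃ i, N i ≠ ⊤) →
      open Classical in 0 < ∑ i with N i ≠ ⊥, θ i

/-- The structure sheaf as a module over itself. -/
abbrev unitModule (X : Scheme.{u}) : X.Modules := SheafOfModules.unit X.ringCatSheaf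

/-- A sheaf of modules is a line bundle if it is locally isomorphic to the structure sheaf. -/
def IsLineBundle {X : Scheme.{u}} (L : X.Modules) : Prop :=
  ∀ x : X, ∃ U : X.Opens, x ∈ U ∧
    Nonempty ((Scheme.Modules.pullback U.ι).obj L ≅ unitModule U)

/-- The pullback of a family of representations of a quiver along a morphism. -/
def pullbackFamily {X Y : Scheme.{u}} (f : X ⟶ Y) (W : V ⥤q Y.Modules) : V ⥤q X.Modules :=
  W ⋙q (Scheme.Modules.pullback f).toPrefunctor

/-- The fibre at a point of a family of representations, a representation over the residue
field. -/
def fibre {X : Scheme.{u}} (W : V ⥤q X.Modules) (x : X) : V ⥤q ModuleCat.{u} (X.residueField x) :=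
  pullbackFamily (X.fromSpecResidueField x) W ⋙q
    (moduleSpecΓFunctor (R := X.residueField x)).toPrefunctor

/-- A (normalised) family over `X` of `θ`-stable representations of dimension vector `(1, ..., 1)`:
line bundles `W_i` at the vertices, with `W_o` trivial, and homomorphisms `W_i ⟶ W_j` at
the arrows `i ⟶ j`, such that all fibres are `θ`-stable. -/
structure IsStableFamily (θ : V → ℤ) (o : V) {X : Scheme.{u}} (W : V ⥤q X.Modules) : Prop where
  lineBundle : ∀ i, IsLineBundle (W.obj i)
  normalised : Nonempty (W.obj o ≅ unitModule X)
  stable : ∀ x : X, IsStableRep θ (fibre W x)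

/-- The `k`-scheme `Y` is the fine moduli space of isomorphism classes of `θ`-stable
representations of dimension vector `(1, ..., 1)`: it carries a universal family, of which
every family over a `k`-scheme is the pullback along a unique morphism, up to isomorphism. -/
def IsFineModuliSpace {k : Type u} [Field k] (θ : V → ℤ) (o : V) {Y : Scheme.{u}}
    (f : Y ⟶ Spec (.of k)) : Prop :=
  ∃ W : V ⥤q Y.Modules, IsStableFamily θ o W ∧
    ∀ (X : Scheme.{u}) (g : X ⟶ Spec (.of k)) (W' : V ⥤q X.Modules), IsStableFamily θ o W' →
      ∃! h : X ⟶ Y, h ≫ f = g ∧ RepIso (pullbackFamily h W) W'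

end Moduli

/-! ### Multigraded linear series -/

section LinearSeries

variable (k : Type u) [Field k] {r a m : ℕ} (E : Fin (m + 1) → Pic r a)

/-- The multigraded linear series `|E| = 𝔸^{Q_1} //_ϑ T_Q = Proj ⨁_{j ≥ 0} k[y_e : e ∈ Q_1]_{jϑ}`,
where `Q` is the quiver of sections of `E` and `ϑ = (-m, 1, ..., 1)`. -/
abbrev linearSeries : Scheme.{u} :=
  gitQuotient k (inc (V := QuiverOfSections E)) (specialWeight (QuiverOfSections.root E))

/-- The canonical morphism from `|E|` to the affine quotient `𝔸^{Q_1} / T_Q`. -/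
abbrev linearSeriesToAffine :
    linearSeries k E ⟶ Spec (.of (invariants k (inc (V := QuiverOfSections E)))) :=
  gitToAffine k (inc (V := QuiverOfSections E)) (specialWeight (QuiverOfSections.root E))

/-- The structure morphism of `|E|` as a `k`-scheme. -/
abbrev linearSeriesToBase : linearSeries k E ⟶ Spec (.of k) :=
  gitToBase k (inc (V := QuiverOfSections E)) (specialWeight (QuiverOfSections.root E))

end LinearSeries

end MLS

end

set_option linter.unusedSectionVars false

noncomputable section

namespace MLS

/-! ### Finiteness and connectedness of the quiver of sections -/

/-! The surface enters only through two facts about the quiver `Q`. There are finitely many arrows,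
because the sections from `i` to `j` that are irreducible form an antichain in `ℕ^Σ(1)`
(`finite_isArrow`). Every vertex is reached from the root, because a section of `E_i` factors into
irreducible ones (`QuiverOfSections.nonempty_path_of_divisorClass`), so a rooted spanning tree
exists. Everything else is proved for a quiver with finitely many vertices and a vertex `o`, with
finitely many arrows or a spanning tree assumed where needed.

Charts. For a spanning tree `T` let `p_i` be the product of the variables along the path of `T` to
`i`. The product of all `p_i` has weight `ϑ`, and the ring of its nonvanishing locus in the Proj is
the polynomial ring in `z_e = y_e p_{t(e)} / p_{h(e)}` for `e` outside `T`, while `z_e = 1` on `T`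
(`RTree.mk_eq_eval₂_coord`, `RTree.polyToChart_injective`). A monomial of weight `(n + 1) ϑ` is a
flow delivering `n + 1` units to each vertex other than the root, so its support contains a spanning
tree (`exists_rTree_of_weight`); hence these affine spaces cover the quotient (`exists_mem_chart`),
which gives smoothness.

Geometric quotient. The morphism `treeQuotient` sends a point of the tree locus to its chart
coordinates. Normalising the coordinates on `T` to `1` gives a section over the chart of `T`, and
two points with the same image, of which one has invertible coordinates on `T`, differ by the torus
element formed from the ratios of their `p_i` (`RTree.exists_torus_point`). Surjectivity,
submersiveness and the description of invariant functions follow from the local sections.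
Integrality follows because functions on the quotient inject into functions on the tree locus, a
nonempty open subset of affine space.

Moduli. The universal line bundle at `i` is the sheaf of functions of weight `χ_i - χ_o` on the tree
locus, and the arrow `e` acts by multiplication with `y_e`. Stability for `ϑ` says that the root
generates the representation, that is, that the coefficients along some spanning tree are nonzero
(`isStableRep_iff`). Local generators of a stable family therefore give points of the tree locus; a
change of generators is a gauge transformation, which the quotient does not see, so the classifying
morphisms glue (`exists_hom_of_isStableFamily`). Conversely an isomorphism of pulled back families
makes the two morphisms locally gauge equivalent (`hom_ext_of_repIso`).

Toric structure and projectivity. Independent scaling of the arrows descends to the quotient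
(`twist`); the torus scaling only the arrows outside one tree embeds as the orbit of the point with
all coordinates `1`. A flow of weight `(d + 1) ϑ` contains one of weight `ϑ`, and there are finitely
many minimal flows of weight `ϑ`, so the graded ring is generated over its degree zero part by
finitely many elements of degree one, which gives a closed immersion in a projective space
(`isProjective_gitToAffine`). -/

theorem hjSeq_snd_succ_lt {r a : ℕ} (har : a < r) (n : ℕ)
    (hn : ∀ j ≤ n, 0 < (hjSeq r a j).2) : (hjSeq r a (n + 1)).2 < (hjSeq r a n).2 := by
  cases n with
  | zero => simpa [hjSeq] using har
  | succ n =>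
    have h : (0 : ℚ) < ((hjSeq r a (n + 1)).2 : ℚ) := by exact_mod_cast hn (n + 1) le_rfl
    have h₁ := Int.ceil_lt_add_one
      (((hjSeq r a n).2 : ℚ) / ((hjSeq r a (n + 1)).2 : ℚ))
    rw [← sub_lt_iff_lt_add, lt_div_iff₀ h] at h₁
    have h₂ : (⌈((hjSeq r a n).2 : ℚ) / ((hjSeq r a (n + 1)).2 : ℚ)⌉ - 1) *
      (hjSeq r a (n + 1)).2 < (hjSeq r a n).2 := by exact_mod_cast h₁
    change ⌈_⌉ • (hjSeq r a (n + 1)).2 - (hjSeq r a n).2 < _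
    rw [smul_eq_mul]
    linarith

/-- The integers `α` start at `r` and drop by at least one at each step while positive, so the index
of a ray is at most `r`. -/
theorem finite_ray {r a : ℕ} (har : a < r) : Finite (Ray r a) := by
  have key : ∀ n : ℕ, (∀ j < n, 0 < (hjSeq r a j).2) → (hjSeq r a n).2 ≤ r - n := by
    intro n
    induction n with
    | zero => intro _; simp [hjSeq]
    | succ n ih =>
      intro h
      have h₁ := ih fun j hj => h j (hj.trans n.lt_succ_self)
      have h₂ := hjSeq_snd_succ_lt har n fun j hj => h j (Nat.lt_succ_of_le hj)
      push_cast
      linarith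
  have hle : ∀ n : Ray r a, n.1 < r + 1 := by
    rintro ⟨n, hn⟩
    cases n with
    | zero => simp
    | succ n =>
      have h₁ := key n fun j hj => hn j (hj.trans n.lt_succ_self)
      have h₂ := hn n n.lt_succ_self
      change n + 1 < r + 1
      omega
  exact Finite.of_injective (fun n : Ray r a => (⟨n.1, hle n⟩ : Fin (r + 1)))
    fun x y h => Subtype.ext (by simpa using h)

theorem divisorClass_add {r a : ℕ} (D D' : Ray r a → ℕ) :
    divisorClass (D + D') = divisorClass D + divisorClass D' := by
  unfold divisorClass
  rw [← QuotientAddGroup.mk_add]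
  congr 1

/-- The difference `D' - D` has trivial class, so `D' = D + (D' - D)` is a composition through the
vertex `j` itself; irreducibility of `D'` leaves only `D' - D = 0`. -/
theorem IsArrow.eq_of_le {r a m : ℕ} {E : Fin (m + 1) → Pic r a} {i j : Fin (m + 1)}
    {D D' : Ray r a → ℕ} (hD : IsArrow E i j D) (hD' : IsArrow E i j D') (h : D ≤ D') :
    D = D' := by
  have e : D' = D + (D' - D) := (add_tsub_cancel_of_le h).symm
  have hc : divisorClass (D' - D) = E j - E j := by
    have := divisorClass_add D (D' - D)
    rw [← e, hD.1, hD'.1, left_eq_add] at this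
    rw [this, sub_self]
  rcases hD'.2.2 j D (D' - D) hD.1 hc e with h0 | h0
  · exact absurd h0 hD.2.1
  · rw [h0, add_zero] at e
    exact e.symm

/-- This is Dickson's lemma: antichains in `ℕ^Σ(1)` are finite once `Σ(1)` is finite. -/
theorem finite_isArrow {r a m : ℕ} (har : a < r) (E : Fin (m + 1) → Pic r a) (i j : Fin (m + 1)) :
    {D | IsArrow E i j D}.Finite := by
  have := finite_ray har
  exact WellQuasiOrderedLE.finite_of_isAntichain fun D hD D' hD' hne hle => hne (hD.eq_of_le hD' hle)

instance QuiverOfSections.finite_hom {r a m : ℕ} (E : Fin (m + 1) → Pic r a) [Fact (a < r)]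
    (i j : QuiverOfSections E) : Finite (i ⟶ j) :=
  (finite_isArrow Fact.out E i j).to_subtype

theorem finite_total {V : Type} [Quiver.{0} V] [Finite V] [∀ i j : V, Finite (i ⟶ j)] :
    Finite (Quiver.Total V) :=
  Finite.of_injective (fun e : Quiver.Total V => (⟨e.left, e.right, e.hom⟩ : Σ i j : V, i ⟶ j))
    fun ⟨_, _, _⟩ ⟨_, _, _⟩ h => by cases h; rfl

/-- Induction on the sum of the multiplicities of `D`: a section that is not an arrow is constant,
and then the vertices agree by injectivity of `E`, or it splits into two nonconstant sections of
smaller total multiplicity. -/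
theorem QuiverOfSections.nonempty_path_of_divisorClass {r a m : ℕ} (har : a < r)
    {E : Fin (m + 1) → Pic r a} (hE : Function.Injective E) (i j : QuiverOfSections E)
    (D : Ray r a → ℕ) (hD : divisorClass D = E j - E i) : Nonempty (Quiver.Path i j) := by
  have := finite_ray har
  have := Fintype.ofFinite (Ray r a)
  induction h : ∑ ρ, D ρ using Nat.strong_induction_on generalizing i j D with
  | _ n ih =>
    subst h
    by_cases h0 : D = 0
    · subst h0
      have h : E j = E i := sub_eq_zero.1 (hD.symm.trans (by
        refine (QuotientAddGroup.eq_zero_iff _).2 ?_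
        convert zero_mem (principalDivisors r a) using 1
        ext ρ
        simp))
      obtain rfl : j = i := hE h
      exact ⟨.nil⟩
    · by_cases ha : IsArrow E i j D
      · exact ⟨Quiver.Hom.toPath (V := QuiverOfSections E) ⟨D, ha⟩⟩
      · simp only [IsArrow, hD, ne_eq, h0, not_false_eq_true, true_and, not_forall] at ha
        obtain ⟨l, D₁, D₂, h₁, h₂, rfl, h⟩ := ha
        rw [not_or] at h
        have pos : ∀ D' : Ray r a → ℕ, D' ≠ 0 → 0 < ∑ ρ, D' ρ := fun D' h' => by
          rw [Nat.pos_iff_ne_zero]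
          intro hs
          exact h' (funext fun ρ => by simpa using (Finset.sum_eq_zero_iff.1 hs) ρ)
        have p₁ := pos _ h.1
        have p₂ := pos _ h.2
        simp only [Pi.add_apply, Finset.sum_add_distrib] at ih
        obtain ⟨q₁⟩ := ih _ (by omega) i l D₁ h₁ rfl
        obtain ⟨q₂⟩ := ih _ (by omega) l j D₂ h₂ rfl
        exact ⟨q₁.comp q₂⟩

/-! ### Paths and rooted spanning trees -/

section Paths

variable {V : Type} [Quiver.{0} V]

/-- The product of the values of a function on the arrows along a path. -/
def pathProd {A : Type*} [CommMonoid A] (w : Quiver.Total V → A) {i : V} :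
    ∀ {j : V}, Quiver.Path i j → A
  | _, .nil => 1
  | _, .cons p e => pathProd w p * w ⟨_, _, e⟩

/-- All arrows of a path are in the set `S`. -/
def PathIn (S : Set (Quiver.Total V)) {i : V} : ∀ {j : V}, Quiver.Path i j → Prop
  | _, .nil => True
  | _, .cons p e => PathIn S p ∧ ⟨_, _, e⟩ ∈ S

section

variable {A B : Type*} [CommMonoid A] [CommMonoid B]

@[simp] theorem pathProd_nil (w : Quiver.Total V → A) (i : V) :
    pathProd w (Quiver.Path.nil : Quiver.Path i i) = 1 := rfl

@[simp] theorem pathProd_cons (w : Quiver.Total V → A) {i j l : V} (p : Quiver.Path i j)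
    (e : j ⟶ l) : pathProd w (p.cons e) = pathProd w p * w ⟨_, _, e⟩ := rfl

theorem map_pathProd {F : Type*} [FunLike F A B] [MonoidHomClass F A B] (f : F)
    (w : Quiver.Total V → A) {i j : V} (p : Quiver.Path i j) :
    f (pathProd w p) = pathProd (fun e => f (w e)) p := by
  induction p with
  | nil => simp
  | cons p e ih => simp [ih]

theorem pathIn_univ {i j : V} (p : Quiver.Path i j) : PathIn Set.univ p := by
  induction p with
  | nil => trivial
  | cons p e ih => exact ⟨ih, trivial⟩

theorem PathIn.isUnit {w : Quiver.Total V → A} {S : Set (Quiver.Total V)}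
    (hw : ∀ e ∈ S, IsUnit (w e)) {i j : V} {p : Quiver.Path i j} (hp : PathIn S p) :
    IsUnit (pathProd w p) := by
  induction p with
  | nil => exact isUnit_one
  | cons p e ih => exact (ih hp.1).mul (hw _ hp.2)

theorem PathIn.pathProd_eq_one {w : Quiver.Total V → A} {S : Set (Quiver.Total V)}
    (hw : ∀ e ∈ S, w e = 1) {i j : V} {p : Quiver.Path i j} (hp : PathIn S p) :
    pathProd w p = 1 := by
  induction p with
  | nil => rfl
  | cons p e ih => rw [pathProd_cons, ih hp.1, hw _ hp.2, one_mul]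

/-- The factors at the intermediate vertices telescope. The relation is free of denominators, so no
invertibility of `t` is needed. -/
theorem pathProd_gauge {w w' : Quiver.Total V → A} {t : V → A}
    (h : ∀ e, w' e * t e.left = w e * t e.right) {i j : V} (p : Quiver.Path i j) :
    pathProd w' p * t i = pathProd w p * t j := by
  induction p with
  | nil => simp
  | @cons b c p e ih =>
    have := h ⟨b, c, e⟩
    simp only at this
    rw [pathProd_cons, pathProd_cons, mul_right_comm, ih, mul_assoc, mul_comm (t b), this,
      mul_assoc]

end

/-- A spanning tree with root at `o`, with the paths from the root to the vertices. -/
structure RTree (o : V) where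
  /-- the arrows of the tree -/
  arrows : Finset (Quiver.Total V)
  /-- the paths from the root -/
  path : ∀ i, Quiver.Path o i
  path_root : path o = .nil
  path_head : ∀ e ∈ arrows, path e.right = (path e.left).cons e.hom
  path_mem : ∀ i, PathIn (arrows : Set (Quiver.Total V)) (path i)

section Subquiver

variable (T : Finset (Quiver.Total V))

/-- The wide subquiver with a given set of arrows. -/
abbrev Sub : Type := WideSubquiver.toType V
  (Quiver.wideSubquiverEquivSetTotal.symm (T : Set (Quiver.Total V)))

variable {T}

/-- A path of a wide subquiver as a path of the quiver. -/
def Sub.toPath {i : Sub T} : ∀ {j : Sub T}, Quiver.Path i j → Quiver.Path (V := V) i j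
  | _, .nil => .nil
  | _, .cons p e => (Sub.toPath p).cons e.1

theorem Sub.pathIn {i j : Sub T} (p : Quiver.Path i j) :
    PathIn (T : Set (Quiver.Total V)) (Sub.toPath p) := by
  induction p with
  | nil => trivial
  | cons p e ih => exact ⟨ih, e.2⟩

theorem Sub.toPath_injective {i j : Sub T} (p q : Quiver.Path i j)
    (h : Sub.toPath p = Sub.toPath q) : p = q := by
  induction p with
  | nil =>
    cases q with
    | nil => rfl
    | cons q e => simp [Sub.toPath] at h
  | cons p e ih =>
    cases q with
    | nil => simp [Sub.toPath] at h
    | cons q f =>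
      simp only [Sub.toPath] at h
      obtain rfl := Quiver.Path.obj_eq_of_cons_eq_cons h
      have h₁ := Quiver.Path.heq_of_cons_eq_cons h
      have h₂ := Quiver.Path.hom_heq_of_cons_eq_cons h
      rw [ih q (eq_of_heq h₁), Subtype.ext (eq_of_heq h₂)]

/-- Together with `Sub.toPath_injective` this identifies the paths of the subquiver with the paths
of `Q` satisfying `PathIn`. -/
theorem Sub.exists_toPath {i j : V} (p : Quiver.Path i j)
    (hp : PathIn (T : Set (Quiver.Total V)) p) :
    ∃ q : Quiver.Path (V := Sub T) i j, Sub.toPath q = p := by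
  induction p with
  | nil => exact ⟨.nil, rfl⟩
  | cons p e ih =>
    obtain ⟨q, hq⟩ := ih hp.1
    exact ⟨Quiver.Path.cons (V := Sub T) q ⟨e, hp.2⟩, by simp [Sub.toPath, hq]⟩

end Subquiver

variable {o : V}

/-- By `path_head`, induction on the last arrow shows that any path from the root inside the tree is
the chosen one; this gives uniqueness, and `path_mem` gives existence. -/
theorem RTree.isSpanningTree (T : RTree o) : IsSpanningTree o T.arrows := by
  have key : ∀ {i : Sub T.arrows} (p : Quiver.Path (V := Sub T.arrows) o i),
      Sub.toPath p = T.path i := by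
    intro i p
    induction p with
    | nil => exact T.path_root.symm
    | @cons b c p e ih =>
      exact (congrArg (fun q => Quiver.Path.cons (V := V) q e.1) ih).trans
        (T.path_head ⟨b, c, e.1⟩ e.2).symm
  intro i
  obtain ⟨q, hq⟩ := Sub.exists_toPath _ (T.path_mem i)
  exact ⟨{ default := q, uniq := fun p => Sub.toPath_injective _ _ ((key p).trans (key q).symm) }⟩

theorem IsSpanningTree.exists_rTree {T : Finset (Quiver.Total V)} (hT : IsSpanningTree o T) :
    ∃ T' : RTree o, T'.arrows = T := by
  have hs : ∀ i, Subsingleton (Quiver.Path (V := Sub T) o i) := fun i => by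
    obtain ⟨h⟩ := hT i
    infer_instance
  refine ⟨⟨T, fun i => Sub.toPath (hT i).some.default, ?_, ?_, fun i => Sub.pathIn _⟩, rfl⟩
  · rw [(hs o).elim (hT o).some.default .nil]
    rfl
  · rintro ⟨i, j, e⟩ he
    rw [(hs j).elim (hT j).some.default
      (Quiver.Path.cons (V := Sub T) (hT i).some.default ⟨e, he⟩)]
    rfl

theorem RTree.pathProd_head (T : RTree o) {A : Type*} [CommMonoid A] (w : Quiver.Total V → A)
    {e : Quiver.Total V} (he : e ∈ T.arrows) :
    pathProd w (T.path e.right) = pathProd w (T.path e.left) * w e := by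
  rw [T.path_head e he, pathProd_cons]

@[simp] theorem RTree.pathProd_root (T : RTree o) {A : Type*} [CommMonoid A]
    (w : Quiver.Total V → A) : pathProd w (T.path o) = 1 := by
  rw [T.path_root, pathProd_nil]

/-- In a set of arrows through which every vertex can be reached from the root, there is a
spanning tree. -/
theorem exists_rTree [Finite V] (S : Set (Quiver.Total V))
    (hS : ∀ i, ∃ p : Quiver.Path o i, PathIn S p) :
    ∃ T : RTree o, (T.arrows : Set (Quiver.Total V)) ⊆ S := by
  classical
  have := Fintype.ofFinite V
  -- This is the distance from the root through arrows of `S`.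
  let d : V → ℕ := fun i => sInf {n | ∃ p : Quiver.Path o i, PathIn S p ∧ p.length = n}
  have hd : ∀ i, ∃ p : Quiver.Path o i, PathIn S p ∧ p.length = d i := fun i =>
    Nat.sInf_mem (s := {n | ∃ p : Quiver.Path o i, PathIn S p ∧ p.length = n})
      ⟨_, (hS i).choose, (hS i).choose_spec, rfl⟩
  -- The last arrow of a shortest path starts strictly closer to the root. One such arrow for each
  -- vertex other than the root makes up the tree, and the paths are defined by recursion on the
  -- distance.
  have hpar : ∀ i, i ≠ o → ∃ (j : V) (e : j ⟶ i), (⟨j, i, e⟩ : Quiver.Total V) ∈ S ∧ d j < d i := by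
    intro i hi
    obtain ⟨p, hp, hl⟩ := hd i
    cases p with
    | nil => exact absurd rfl hi
    | @cons j _ p e =>
      refine ⟨j, e, hp.2, lt_of_le_of_lt (Nat.sInf_le ⟨p, hp.1, rfl⟩) ?_⟩
      rw [← hl]
      simp
  choose! par harr using hpar
  choose arr hmem hlt using harr
  obtain ⟨path, hroot, hstep⟩ : ∃ path : ∀ i, Quiver.Path o i, path o = .nil ∧
      ∀ i (h : i ≠ o), path i = (path (par i)).cons (arr i h) := by
    let F : ∀ i, (∀ j, d j < d i → Quiver.Path o j) → Quiver.Path o i := fun i ih =>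
      if h : i = o then h ▸ .nil else (ih (par i) (hlt i h)).cons (arr i h)
    let wf : WellFounded fun i j : V => d i < d j := InvImage.wf d Nat.lt_wfRel.wf
    refine ⟨wf.fix F, ?_, fun i h => ?_⟩
    · rw [wf.fix_eq]
      simp [F]
    · rw [wf.fix_eq]
      simp only [F, dif_neg h]
  refine ⟨⟨Finset.univ.image fun i : {i // i ≠ o} => ⟨par i.1, i.1, arr i.1 i.2⟩, path, hroot,
    ?_, ?_⟩, ?_⟩
  · intro e he
    obtain ⟨i, -, rfl⟩ := Finset.mem_image.1 he
    exact hstep i.1 i.2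
  · have : ∀ n i, d i = n → PathIn ((Finset.univ.image fun i : {i // i ≠ o} =>
        (⟨par i.1, i.1, arr i.1 i.2⟩ : Quiver.Total V) : Finset _) : Set (Quiver.Total V))
          (path i) := by
      intro n
      induction n using Nat.strong_induction_on with
      | _ n ih =>
        intro i hi
        by_cases h : i = o
        · subst h
          rw [hroot]
          trivial
        · rw [hstep i h]
          refine ⟨ih _ (hi ▸ hlt i h) _ rfl, ?_⟩
          rw [Finset.mem_coe]
          exact Finset.mem_image.2 ⟨⟨i, h⟩, Finset.mem_univ _, rfl⟩
    exact fun i => this _ i rfl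
  · intro e he
    obtain ⟨i, -, rfl⟩ := Finset.mem_image.1 (Finset.mem_coe.1 he)
    exact hmem i.1 i.2

end Paths

/-! ### Flows: exponents of monomials of given weight -/

section Flows

variable {V : Type} [Quiver.{0} V] [Fintype V] [DecidableEq V]

theorem Wt.sum_apply {ι : Type*} (s : Finset ι) (f : ι → Wt V) (j : V) :
    (∑ i ∈ s, f i).1 j = ∑ i ∈ s, (f i).1 j := by
  rw [← Finset.sum_apply]
  exact congrFun (AddSubmonoidClass.coe_finsetSum f s) j

/-- The weight `χ_i - χ_o`. -/
def chi (o i : V) : Wt V :=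
  ⟨Pi.single i 1 - Pi.single o 1, by simp [Wt]⟩

@[simp] theorem chi_self (o : V) : chi o o = 0 := by
  ext; simp [chi]

theorem inc_eq_chi_sub (o : V) (e : Quiver.Total V) : inc e = chi o e.right - chi o e.left := by
  ext; simp [chi, inc]

theorem inc_add_chi (o : V) (e : Quiver.Total V) : inc e + chi o e.left = chi o e.right := by
  rw [inc_eq_chi_sub o, sub_add_cancel]

theorem specialWeight_eq_sum_chi (o : V) : specialWeight o = ∑ i, chi o i := by
  ext j
  rw [Wt.sum_apply]
  change (if j = o then 1 - (Fintype.card V : ℤ) else 1) =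
    ∑ i, ((Pi.single i 1 : V → ℤ) j - (Pi.single o 1 : V → ℤ) j)
  rw [Finset.sum_sub_distrib]
  split_ifs with h <;> simp [h, Pi.single_apply]

theorem specialWeight_eq_sum_chi_erase (o : V) :
    specialWeight o = ∑ i ∈ Finset.univ.erase o, chi o i := by
  rw [specialWeight_eq_sum_chi, Finset.sum_erase _ (chi_self o)]

theorem specialWeight_apply_of_ne {o i : V} (h : i ≠ o) : (specialWeight o).1 i = 1 := by
  simp [specialWeight, h]

theorem chi_apply_of_ne {o i j : V} (h : j ≠ o) : (chi o i).1 j = if j = i then 1 else 0 := by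
  simp [chi, h, Pi.single_apply]

theorem weight_inc_apply (v : Quiver.Total V →₀ ℕ) (i : V) :
    (Finsupp.weight inc v : Wt V).1 i =
      v.sum fun e n => (n : ℤ) * ((if i = e.right then 1 else 0) -
        (if i = e.left then 1 else 0)) := by
  rw [Finsupp.weight_apply, Finsupp.sum, Wt.sum_apply]
  refine Finset.sum_congr rfl fun e _ => ?_
  simp [inc, Pi.single_apply]

/-- A vertex at which a flow has positive excess can be reached from the root through arrows of
the support of the flow. -/
theorem exists_path_of_weight_pos {o : V} (v : Quiver.Total V →₀ ℕ)
    (hv : ∀ i, i ≠ o → 0 ≤ (Finsupp.weight inc v : Wt V).1 i) {i : V}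
    (hpos : 0 < (Finsupp.weight inc v : Wt V).1 i) :
    ∃ p : Quiver.Path o i, PathIn {e | v e ≠ 0} p := by
  classical
  by_contra hcon
  -- The vertices that cannot be reached. Their total excess is positive, yet no arrow of the
  -- support enters this set from outside, so each arrow contributes at most zero to that total.
  let C : Finset V := Finset.univ.filter fun j => ¬ ∃ p : Quiver.Path o j, PathIn {e | v e ≠ 0} p
  have hmem : ∀ j, j ∈ C ↔ ¬ ∃ p : Quiver.Path o j, PathIn {e | v e ≠ 0} p := fun j => by simp [C]
  have hoC : o ∉ C := fun h => (hmem o).1 h ⟨.nil, trivial⟩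
  have hlt : 0 < ∑ j ∈ C, (Finsupp.weight inc v : Wt V).1 j :=
    Finset.sum_pos' (fun j hj => hv j fun h => hoC (h ▸ hj)) ⟨i, (hmem i).2 hcon, hpos⟩
  refine absurd hlt (not_lt.2 ?_)
  simp only [weight_inc_apply, Finsupp.sum]
  rw [Finset.sum_comm]
  refine Finset.sum_nonpos fun e he => ?_
  rw [← Finset.mul_sum, Finset.sum_sub_distrib, Finset.sum_ite_eq', Finset.sum_ite_eq']
  refine mul_nonpos_of_nonneg_of_nonpos (by positivity) ?_
  by_cases hr : e.right ∈ C
  · have hl : e.left ∈ C := by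
      rw [hmem] at hr ⊢
      rintro ⟨p, hp⟩
      exact hr ⟨p.cons e.hom, hp, Finsupp.mem_support_iff.1 he⟩
    simp [hr, hl]
  · simp only [hr, if_false]
    split_ifs <;> simp

/-- A vertex which can be reached from the root through arrows of a set is the target of a flow
which uses each arrow of the set at most once. -/
theorem exists_flow_le_one {o : V} (S : Set (Quiver.Total V)) {i : V}
    (hi : ∃ p : Quiver.Path o i, PathIn S p) :
    ∃ u : Quiver.Total V →₀ ℕ, (∀ e, u e ≤ 1) ∧ (∀ e, u e ≠ 0 → e ∈ S) ∧
      Finsupp.weight inc u = chi o i := by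
  classical
  let d : V → ℕ := fun i => sInf {n | ∃ p : Quiver.Path o i, PathIn S p ∧ p.length = n}
  -- The stronger claim keeps the tails of the used arrows at distance less than `n`; the last arrow
  -- of a shortest path then cannot have been used before, which keeps all multiplicities at most
  -- one.
  suffices H : ∀ n i, d i = n → (∃ p : Quiver.Path o i, PathIn S p) →
      ∃ u : Quiver.Total V →₀ ℕ, (∀ e, u e ≤ 1) ∧ (∀ e, u e ≠ 0 → e ∈ S ∧ d e.left < n) ∧
        Finsupp.weight inc u = chi o i by
    obtain ⟨u, h₁, h₂, h₃⟩ := H _ i rfl hi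
    exact ⟨u, h₁, fun e he => (h₂ e he).1, h₃⟩
  intro n
  induction n using Nat.strong_induction_on with
  | _ n ih =>
    intro i hn hi
    obtain ⟨p, hp, hl⟩ : ∃ p : Quiver.Path o i, PathIn S p ∧ p.length = d i :=
      Nat.sInf_mem (s := {n | ∃ p : Quiver.Path o i, PathIn S p ∧ p.length = n})
        ⟨_, hi.choose, hi.choose_spec, rfl⟩
    cases p with
    | nil => exact ⟨0, by simp, by simp, by simp⟩
    | @cons j _ p e =>
      have hlt : d j < n := by
        refine lt_of_le_of_lt (Nat.sInf_le ⟨p, hp.1, rfl⟩) ?_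
        rw [← hn, ← hl]
        simp
      obtain ⟨u, h₁, h₂, h₃⟩ := ih _ hlt j rfl ⟨p, hp.1⟩
      refine ⟨u + Finsupp.single ⟨j, i, e⟩ 1, fun f => ?_, fun f hf => ?_, ?_⟩
      · by_cases hf : f = ⟨j, i, e⟩
        · subst hf
          have : u ⟨j, i, e⟩ = 0 := by
            by_contra h0
            exact lt_irrefl _ (h₂ _ h0).2
          simp [this]
        · rw [Finsupp.add_apply, Finsupp.single_eq_of_ne hf, add_zero]
          exact h₁ f
      · by_cases hf' : f = ⟨j, i, e⟩
        · subst hf'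
          exact ⟨hp.2, hlt⟩
        · rw [Finsupp.add_apply, Finsupp.single_eq_of_ne hf', add_zero] at hf
          exact ⟨(h₂ f hf).1, (h₂ f hf).2.trans hlt⟩
      · rw [map_add, h₃, Finsupp.weight_single, one_smul, add_comm]
        exact inc_add_chi o ⟨j, i, e⟩

/-- Flow decomposition: one unit of flow from the root to a vertex of `s` is removed at a time. It
fits under `v` because it is supported in the support of `v` with multiplicities at most one, and
what remains still has the excess required at the other vertices. -/
theorem exists_le_weight_eq_sum_chi {o : V} (s : Finset V) (hs : o ∉ s)
    (v : Quiver.Total V →₀ ℕ)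
    (hv : ∀ i, i ≠ o → (if i ∈ s then 1 else 0) ≤ (Finsupp.weight inc v : Wt V).1 i) :
    ∃ u ≤ v, Finsupp.weight inc u = ∑ i ∈ s, chi o i := by
  induction s using Finset.induction_on generalizing v with
  | empty => exact ⟨0, zero_le, by simp⟩
  | insert a s ha ih =>
    have hao : a ≠ o := fun h => hs (h ▸ Finset.mem_insert_self a s)
    have hnn : ∀ i, i ≠ o → 0 ≤ (Finsupp.weight inc v : Wt V).1 i := fun i hi =>
      le_trans (by split_ifs <;> simp) (hv i hi)
    have hpos : 0 < (Finsupp.weight inc v : Wt V).1 a :=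
      lt_of_lt_of_le (by simp) (hv a hao)
    obtain ⟨u, h₁, h₂, h₃⟩ := exists_flow_le_one _ (exists_path_of_weight_pos v hnn hpos)
    have huv : u ≤ v := fun e => by
      by_cases h0 : u e = 0
      · simp [h0]
      · exact (h₁ e).trans (Nat.one_le_iff_ne_zero.2 (h₂ e h0))
    have hsub : Finsupp.weight inc v = chi o a + Finsupp.weight inc (v - u) := by
      rw [← h₃, ← map_add, add_tsub_cancel_of_le huv]
    obtain ⟨u', hu', hw⟩ := ih (fun h => hs (Finset.mem_insert_of_mem h)) (v - u) fun i hi => by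
      have := hv i hi
      rw [hsub, AddSubgroup.coe_add, Pi.add_apply, chi_apply_of_ne hi] at this
      by_cases hia : i = a
      · subst hia
        simp only [Finset.mem_insert_self, if_true, ha, if_false] at this ⊢
        linarith
      · simpa [Finset.mem_insert, hia] using this
    refine ⟨u + u', ?_, by rw [map_add, h₃, hw, Finset.sum_insert ha]⟩
    calc u + u' ≤ u + (v - u) := by gcongr
      _ = v := add_tsub_cancel_of_le huv

/-- In terms of monomials, this is generation of the ring of semi-invariants in degree one over its
degree zero part. -/
theorem exists_le_weight_eq_specialWeight {o : V} (v : Quiver.Total V →₀ ℕ) (n : ℕ)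
    (hv : Finsupp.weight inc v = (n + 1) • specialWeight o) :
    ∃ u ≤ v, Finsupp.weight inc u = specialWeight o := by
  rw [specialWeight_eq_sum_chi_erase]
  refine exists_le_weight_eq_sum_chi _ (Finset.notMem_erase _ _) v fun i hi => ?_
  rw [hv, AddSubgroup.coe_nsmul, Pi.smul_apply, specialWeight_apply_of_ne hi]
  split_ifs
  · simp
  · positivity

/-- The excess is positive at every vertex other than the root, so all vertices are reached through
the support. This is what makes the charts of the spanning trees cover the quotient. -/
theorem exists_rTree_of_weight {o : V} (v : Quiver.Total V →₀ ℕ) (n : ℕ)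
    (hv : Finsupp.weight inc v = (n + 1) • specialWeight o) :
    ∃ T : RTree o, ∀ e ∈ T.arrows, v e ≠ 0 := by
  have h1 : ∀ i, i ≠ o → (Finsupp.weight inc v : Wt V).1 i = n + 1 := fun i hi => by
    rw [hv, AddSubgroup.coe_nsmul, Pi.smul_apply, specialWeight_apply_of_ne hi]
    simp
  obtain ⟨T, hT⟩ := exists_rTree (o := o) {e | v e ≠ 0} fun i => by
    by_cases hi : i = o
    · subst hi
      exact ⟨.nil, trivial⟩
    · exact exists_path_of_weight_pos v (fun j hj => by rw [h1 j hj]; positivity)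
        (by rw [h1 i hi]; positivity)
  exact ⟨T, fun e he => hT he⟩

end Flows

/-! ### Evaluation of semi-invariants -/

section SemiInvariants

variable {k : Type u} [Field k] {σ M : Type} [AddCommGroup M] {w : σ → M} {θ : M}

/-- The semi-invariant `f t ^ n`, for a polynomial `f` of weight `n θ`. -/
def siMon (n : ℕ) (f : MvPolynomial σ k) (hf : f.IsWeightedHomogeneous w (n • θ)) :
    semiInvariants k w θ :=
  ⟨Polynomial.monomial n f, fun i => by
    rw [Polynomial.coeff_monomial]
    split_ifs with h
    · subst h
      exact hf
    · exact MvPolynomial.isWeightedHomogeneous_zero k w _⟩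

theorem siMon_mem (n : ℕ) (f : MvPolynomial σ k) (hf : f.IsWeightedHomogeneous w (n • θ)) :
    siMon n f hf ∈ semiInvariantsGrading k w θ n := fun i hi => by
  change (Polynomial.monomial n f).coeff i = 0
  rw [Polynomial.coeff_monomial, if_neg (Ne.symm hi)]

theorem eq_siMon_of_mem {n : ℕ} {x : semiInvariants k w θ}
    (hx : x ∈ semiInvariantsGrading k w θ n) :
    x = siMon n ((x : Polynomial (MvPolynomial σ k)).coeff n) (x.2 n) := by
  apply Subtype.ext
  ext1 i
  change _ = (Polynomial.monomial n _).coeff i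
  rw [Polynomial.coeff_monomial]
  split_ifs with h
  · rw [h]
  · exact hx i (Ne.symm h)

theorem siMon_mul {n m : ℕ} {f g : MvPolynomial σ k} (hf : f.IsWeightedHomogeneous w (n • θ))
    (hg : g.IsWeightedHomogeneous w (m • θ)) (hfg : (f * g).IsWeightedHomogeneous w ((n + m) • θ)) :
    siMon n f hf * siMon m g hg = siMon (n + m) (f * g) hfg :=
  Subtype.ext (Polynomial.monomial_mul_monomial n m f g)

theorem siMon_congr {n m : ℕ} {f g : MvPolynomial σ k} {hf : f.IsWeightedHomogeneous w (n • θ)}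
    {hg : g.IsWeightedHomogeneous w (m • θ)} (h : n = m) (h' : f = g) :
    siMon n f hf = siMon m g hg := by
  subst h h'
  rfl

variable {A : Type*} [CommRing A]

/-- Evaluation of semi-invariants at a point of the affine space and at `t = 1`. -/
def evalSI (w : σ → M) (θ : M) (g : k →+* A) (x : σ → A) : semiInvariants k w θ →+* A :=
  (Polynomial.eval₂RingHom (MvPolynomial.eval₂Hom g x) 1).comp (semiInvariants k w θ).subtype

@[simp] theorem evalSI_siMon (g : k →+* A) (x : σ → A) (n : ℕ) (f : MvPolynomial σ k)
    (hf : f.IsWeightedHomogeneous w (n • θ)) :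
    evalSI w θ g x (siMon n f hf) = MvPolynomial.eval₂ g x f := by
  change Polynomial.eval₂ (MvPolynomial.eval₂Hom g x) 1 (Polynomial.monomial n f) = _
  simp

/-- Rescaling each variable by the character of its weight multiplies each monomial of weight `m` by
the same factor `χ(m)`. -/
theorem eval₂_char_mul {f : MvPolynomial σ k} {m : M}
    (hf : f.IsWeightedHomogeneous w m) (g : k →+* A) (x : σ → A)
    (χ : Multiplicative M →* A) :
    MvPolynomial.eval₂ g (fun s => χ (.ofAdd (w s)) * x s) f =
      χ (.ofAdd m) * MvPolynomial.eval₂ g x f := by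
  rw [MvPolynomial.eval₂_eq, MvPolynomial.eval₂_eq, Finset.mul_sum]
  refine Finset.sum_congr rfl fun d hd => ?_
  have h : χ (.ofAdd m) = ∏ i ∈ d.support, χ (.ofAdd (w i)) ^ d i := by
    rw [← hf (MvPolynomial.mem_support_iff.1 hd), Finsupp.weight_apply, Finsupp.sum, ofAdd_sum,
      map_prod]
    simp only [ofAdd_nsmul, map_pow]
  rw [h]
  simp only [mul_pow, Finset.prod_mul_distrib]
  ring

/-- The ring homomorphism from the degree zero part of a localization given by a point at which
the denominator is a unit. -/
def evalAway (g : k →+* A) (x : σ → A) (r : semiInvariants k w θ)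
    (hr : IsUnit (evalSI w θ g x r)) :
    HomogeneousLocalization.Away (semiInvariantsGrading k w θ) r →+* A :=
  (IsLocalization.Away.lift (S := Localization.Away r) r hr).comp
    (algebraMap (HomogeneousLocalization.Away (semiInvariantsGrading k w θ) r) _)

/-- The value of a fraction is pinned down with the denominator cleared, because `evalSI w θ g x r`
is a unit. -/
theorem evalAway_mk_mul (g : k →+* A) (x : σ → A) {r : semiInvariants k w θ}
    (hr : IsUnit (evalSI w θ g x r)) {d : ℕ} (hd : r ∈ semiInvariantsGrading k w θ d) (n : ℕ)
    (a : semiInvariants k w θ) (ha : a ∈ semiInvariantsGrading k w θ (n • d)) :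
    evalAway g x r hr (.mk _ hd n a ha) * evalSI w θ g x r ^ n = evalSI w θ g x a := by
  have h := congrArg (IsLocalization.Away.lift (S := Localization.Away r) r hr)
    (IsLocalization.mk'_spec (Localization.Away r) a (⟨r ^ n, n, rfl⟩ : Submonoid.powers r))
  rw [map_mul, IsLocalization.Away.lift_eq, IsLocalization.Away.lift_eq, map_pow] at h
  rw [← h]
  unfold evalAway
  rw [RingHom.comp_apply, HomogeneousLocalization.algebraMap_apply,
    HomogeneousLocalization.Away.val_mk, Localization.mk_eq_mk']

variable (k w θ) in
/-- The scalars in the degree zero part of a localization. -/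
def scalarAway (r : semiInvariants k w θ) :
    k →+* HomogeneousLocalization.Away (semiInvariantsGrading k w θ) r :=
  (HomogeneousLocalization.fromZeroRingHom (semiInvariantsGrading k w θ) _).comp
    ((invariantsToZero k w θ).comp (algebraMap k (invariants k w)))

theorem evalAway_fromZero (g : k →+* A) (x : σ → A) {r : semiInvariants k w θ}
    (hr : IsUnit (evalSI w θ g x r)) (c : invariants k w) :
    evalAway g x r hr (HomogeneousLocalization.fromZeroRingHom (semiInvariantsGrading k w θ) _
      (invariantsToZero k w θ c)) = MvPolynomial.eval₂ g x c.1 := by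
  have h : (HomogeneousLocalization.fromZeroRingHom (semiInvariantsGrading k w θ)
      (Submonoid.powers r) (invariantsToZero k w θ c)).val =
      algebraMap _ (Localization.Away r) (invariantsToZero k w θ c).1 := by
    rfl
  unfold evalAway
  rw [RingHom.comp_apply, HomogeneousLocalization.algebraMap_apply, h,
    IsLocalization.Away.lift_eq]
  change Polynomial.eval₂ (MvPolynomial.eval₂Hom g x) 1 (Polynomial.C c.1) = _
  simp

theorem evalAway_scalarAway (g : k →+* A) (x : σ → A) {r : semiInvariants k w θ}
    (hr : IsUnit (evalSI w θ g x r)) (c : k) :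
    evalAway g x r hr (scalarAway k w θ r c) = g c := by
  unfold scalarAway
  rw [RingHom.comp_apply, RingHom.comp_apply, evalAway_fromZero]
  change MvPolynomial.eval₂ g x (MvPolynomial.C c) = g c
  simp

end SemiInvariants

/-! ### The charts of the spanning trees -/

section Charts

variable {V : Type} [Quiver.{0} V] [Fintype V] [DecidableEq V]

theorem isWeightedHomogeneous_pathProd (k : Type u) [Field k] {o i : V} (p : Quiver.Path o i) :
    (pathProd MvPolynomial.X p : CoordRing k V).IsWeightedHomogeneous inc (chi o i) := by
  induction p with
  | nil =>
    rw [chi_self]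
    exact MvPolynomial.isWeightedHomogeneous_one k _
  | @cons j l p e ih =>
    have := ih.mul (MvPolynomial.isWeightedHomogeneous_X k inc ⟨j, l, e⟩)
    rw [add_comm, inc_add_chi o] at this
    exact this

/-- The product along all paths of the tree. -/
def RTree.total {o : V} (T : RTree o) {A : Type*} [CommMonoid A] (x : Quiver.Total V → A) : A :=
  ∏ i, pathProd x (T.path i)

/-- The product along all paths of the tree but the one to the vertex `j`. -/
def RTree.totalErase {o : V} (T : RTree o) {A : Type*} [CommMonoid A] (x : Quiver.Total V → A)
    (j : V) : A :=
  ∏ i ∈ Finset.univ.erase j, pathProd x (T.path i)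

theorem RTree.totalErase_mul {o : V} (T : RTree o) {A : Type*} [CommMonoid A]
    (x : Quiver.Total V → A) (j : V) :
    T.totalErase x j * pathProd x (T.path j) = T.total x :=
  Finset.prod_erase_mul _ _ (Finset.mem_univ j)

theorem RTree.map_total {o : V} (T : RTree o) {A B F : Type*} [CommMonoid A] [CommMonoid B]
    [FunLike F A B] [MonoidHomClass F A B] (f : F) (x : Quiver.Total V → A) :
    f (T.total x) = T.total fun e => f (x e) := by
  simp only [RTree.total, map_prod, map_pathProd]

theorem RTree.map_totalErase {o : V} (T : RTree o) {A B F : Type*} [CommMonoid A] [CommMonoid B]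
    [FunLike F A B] [MonoidHomClass F A B] (f : F) (x : Quiver.Total V → A) (j : V) :
    f (T.totalErase x j) = T.totalErase (fun e => f (x e)) j := by
  simp only [RTree.totalErase, map_prod, map_pathProd]

theorem RTree.isUnit_pathProd {o : V} (T : RTree o) {A : Type*} [CommMonoid A]
    {x : Quiver.Total V → A} (h : ∀ e ∈ T.arrows, IsUnit (x e)) (i : V) :
    IsUnit (pathProd x (T.path i)) :=
  (T.path_mem i).isUnit h

/-- Each arrow of the tree is the last arrow of the path to its head, hence a factor of the total
product; conversely only arrows of the tree occur in that product. -/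
theorem RTree.isUnit_total_iff {o : V} (T : RTree o) {A : Type*} [CommMonoid A]
    {x : Quiver.Total V → A} : IsUnit (T.total x) ↔ ∀ e ∈ T.arrows, IsUnit (x e) := by
  constructor
  · intro h e he
    rw [← T.totalErase_mul x e.right, T.pathProd_head x he, IsUnit.mul_iff, IsUnit.mul_iff] at h
    exact h.2.2
  · intro h
    exact (Finset.prod_induction _ IsUnit (fun _ _ => IsUnit.mul) isUnit_one
      fun i _ => T.isUnit_pathProd h i)

theorem RTree.pathProd_eq_one {o : V} (T : RTree o) {A : Type*} [CommMonoid A]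
    {x : Quiver.Total V → A} (h : ∀ e ∈ T.arrows, x e = 1) (i : V) :
    pathProd x (T.path i) = 1 :=
  (T.path_mem i).pathProd_eq_one h

theorem RTree.total_eq_one {o : V} (T : RTree o) {A : Type*} [CommMonoid A]
    {x : Quiver.Total V → A} (h : ∀ e ∈ T.arrows, x e = 1) : T.total x = 1 :=
  Finset.prod_eq_one fun i _ => T.pathProd_eq_one h i

variable (k : Type u) [Field k] (o : V)

/-- The ring of semi-invariants for the special weight. -/
abbrev SI : Type u := semiInvariants k (inc (V := V)) (specialWeight o)

/-- The grading of the ring of semi-invariants for the special weight. -/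
abbrev SIG : ℕ → AddSubgroup (SI k o) :=
  semiInvariantsGrading k (inc (V := V)) (specialWeight o)

/-- The GIT quotient for the special weight. -/
abbrev GQ : Scheme.{u} := gitQuotient k (inc (V := V)) (specialWeight o)

variable {o}

theorem isWeightedHomogeneous_prod_pathProd (T : RTree o) (s : Finset V) :
    (∏ i ∈ s, pathProd MvPolynomial.X (T.path i) : CoordRing k V).IsWeightedHomogeneous inc
      (∑ i ∈ s, chi o i) :=
  MvPolynomial.IsWeightedHomogeneous.prod s _ _
    fun i _ => isWeightedHomogeneous_pathProd k (T.path i)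

/-- The semi-invariant whose nonvanishing locus is the chart of a spanning tree. -/
def RTree.denom (T : RTree o) : SI k o :=
  siMon 1 (T.total MvPolynomial.X) (by
    rw [one_smul, specialWeight_eq_sum_chi]
    exact isWeightedHomogeneous_prod_pathProd k T _)

/-- The numerator of the coordinate `z_e` of the chart of a spanning tree. -/
def RTree.numer (T : RTree o) (e : Quiver.Total V) : SI k o :=
  siMon 1 (MvPolynomial.X e * pathProd MvPolynomial.X (T.path e.left) *
    T.totalErase MvPolynomial.X e.right) (by
    rw [one_smul, specialWeight_eq_sum_chi, ← Finset.add_sum_erase _ _ (Finset.mem_univ e.right),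
      ← inc_add_chi o]
    exact ((MvPolynomial.isWeightedHomogeneous_X k inc e).mul
      (isWeightedHomogeneous_pathProd k (T.path e.left))).mul
        (isWeightedHomogeneous_prod_pathProd k T _))

theorem RTree.denom_mem (T : RTree o) : T.denom k ∈ SIG k o 1 := siMon_mem _ _ _

theorem RTree.numer_mem (T : RTree o) (e : Quiver.Total V) : T.numer k e ∈ SIG k o 1 :=
  siMon_mem _ _ _

variable {k}

@[simp] theorem RTree.evalSI_denom (T : RTree o) {A : Type*} [CommRing A] (g : k →+* A)
    (x : Quiver.Total V → A) : evalSI inc (specialWeight o) g x (T.denom k) = T.total x := by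
  rw [RTree.denom, evalSI_siMon, ← MvPolynomial.coe_eval₂Hom, T.map_total]
  simp

@[simp] theorem RTree.evalSI_numer (T : RTree o) {A : Type*} [CommRing A] (g : k →+* A)
    (x : Quiver.Total V → A) (e : Quiver.Total V) :
    evalSI inc (specialWeight o) g x (T.numer k e) =
      x e * pathProd x (T.path e.left) * T.totalErase x e.right := by
  rw [RTree.numer, evalSI_siMon, ← MvPolynomial.coe_eval₂Hom, map_mul, map_mul, T.map_totalErase,
    map_pathProd]
  simp

/-- The ring of functions on the chart of a spanning tree. -/
abbrev RTree.ChartRing (k : Type u) [Field k] (T : RTree o) : Type u :=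
  HomogeneousLocalization.Away (SIG k o) (T.denom k)

variable (k) in
/-- The coordinate `z_e` of the chart of a spanning tree. -/
def RTree.coord (T : RTree o) (e : Quiver.Total V) : T.ChartRing k :=
  .mk _ (T.denom_mem k) 1 (T.numer k e) (by simpa using T.numer_mem k e)

/-- Evaluation of functions on the chart at a point. -/
def RTree.evalChart (T : RTree o) {A : Type*} [CommRing A] (g : k →+* A)
    (x : Quiver.Total V → A) (hx : ∀ e ∈ T.arrows, IsUnit (x e)) : T.ChartRing k →+* A :=
  evalAway g x (T.denom k) (by rw [T.evalSI_denom]; exact T.isUnit_total_iff.2 hx)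

theorem RTree.evalChart_mk_mul (T : RTree o) {A : Type*} [CommRing A] (g : k →+* A)
    (x : Quiver.Total V → A) (hx : ∀ e ∈ T.arrows, IsUnit (x e)) (n : ℕ) (a : SI k o)
    (ha : a ∈ SIG k o (n • 1)) :
    T.evalChart g x hx (.mk _ (T.denom_mem k) n a ha) * T.total x ^ n =
      evalSI inc (specialWeight o) g x a :=
  (congrArg (fun y => T.evalChart g x hx (.mk _ (T.denom_mem k) n a ha) * y ^ n)
    (T.evalSI_denom g x).symm).trans (evalAway_mk_mul g x _ (T.denom_mem k) n a ha)

/-- The defining formula `z_e = x_e p_{t(e)} / p_{h(e)}` without denominators, where `p_i` is the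
product of `x` along the path of the tree to `i`. Later comparisons of points in a chart reduce to
it. -/
theorem RTree.evalChart_coord_mul (T : RTree o) {A : Type*} [CommRing A] (g : k →+* A)
    (x : Quiver.Total V → A) (hx : ∀ e ∈ T.arrows, IsUnit (x e)) (e : Quiver.Total V) :
    T.evalChart g x hx (T.coord k e) * pathProd x (T.path e.right) =
      x e * pathProd x (T.path e.left) := by
  have h : IsUnit (T.total x) := T.isUnit_total_iff.2 hx
  rw [← T.totalErase_mul x e.right] at h
  have := T.evalChart_mk_mul g x hx 1 (T.numer k e) (by simpa using T.numer_mem k e)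
  rw [T.evalSI_numer, pow_one, ← T.totalErase_mul x e.right, mul_left_comm,
    mul_comm] at this
  exact (isUnit_of_mul_isUnit_left h).mul_right_cancel this

theorem RTree.evalChart_scalarAway (T : RTree o) {A : Type*} [CommRing A] (g : k →+* A)
    (x : Quiver.Total V → A) (hx : ∀ e ∈ T.arrows, IsUnit (x e)) (c : k) :
    T.evalChart g x hx (scalarAway k inc (specialWeight o) (T.denom k) c) = g c :=
  evalAway_scalarAway g x _ c

/-- The character of the weight lattice with values `t_i` at `χ_i - χ_o`, up to a factor. -/
def charOfUnits {A : Type*} [CommRing A] (t : V → Aˣ) : Multiplicative (Wt V) →* A :=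
  (Units.coeHom A).comp
    { toFun := fun m => ∏ i, t i ^ (Multiplicative.toAdd m).1 i
      map_one' := by simp
      map_mul' := fun m m' => by simp [zpow_add, Finset.prod_mul_distrib] }

theorem prod_zpow_single {A : Type*} [CommRing A] (t : V → Aˣ) (i : V) :
    ∏ j, t j ^ (Pi.single i 1 : V → ℤ) j = t i := by
  rw [Finset.prod_eq_single i (fun j _ hj => by simp [hj]) (by simp)]
  simp

theorem charOfUnits_chi_mul {A : Type*} [CommRing A] (t : V → Aˣ) (i : V) :
    charOfUnits t (.ofAdd (chi o i)) * t o = t i := by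
  change ((∏ j, t j ^ (Pi.single i 1 - Pi.single o 1 : V → ℤ) j : Aˣ) : A) * t o = t i
  rw [← Units.val_mul]
  congr 1
  simp only [Pi.sub_apply, zpow_sub, Finset.prod_mul_distrib, Finset.prod_inv_distrib,
    prod_zpow_single, inv_mul_cancel_right]

theorem charOfUnits_inc_mul {A : Type*} [CommRing A] (t : V → Aˣ) (e : Quiver.Total V) :
    charOfUnits t (.ofAdd (inc e)) * t e.left = t e.right := by
  change ((∏ j, t j ^ (Pi.single e.right 1 - Pi.single e.left 1 : V → ℤ) j : Aˣ) : A) *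
    t e.left = t e.right
  rw [← Units.val_mul]
  congr 1
  simp only [Pi.sub_apply, zpow_sub, Finset.prod_mul_distrib, Finset.prod_inv_distrib,
    prod_zpow_single, inv_mul_cancel_right]

/-- The chart ring embeds in the fraction field of `k[y]` by evaluation at the generic point, so
identities between functions on the chart may be checked there. -/
theorem RTree.evalChart_injective (T : RTree o) :
    ∃ hx : ∀ e ∈ T.arrows, IsUnit (algebraMap (CoordRing k V) (FractionRing (CoordRing k V))
        (MvPolynomial.X e)),
      Function.Injective (T.evalChart
        ((algebraMap (CoordRing k V) (FractionRing (CoordRing k V))).comp MvPolynomial.C)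
        (fun e => algebraMap _ _ (MvPolynomial.X e)) hx) := by
  have hx : ∀ e : Quiver.Total V, IsUnit (algebraMap (CoordRing k V)
      (FractionRing (CoordRing k V)) (MvPolynomial.X e)) := fun e => by
    rw [isUnit_iff_ne_zero, ne_eq, FaithfulSMul.algebraMap_eq_zero_iff]
    exact MvPolynomial.X_ne_zero e
  refine ⟨fun e _ => hx e, (injective_iff_map_eq_zero _).2 fun a ha => ?_⟩
  obtain ⟨n, a, hn, rfl⟩ := HomogeneousLocalization.Away.mk_surjective _ (T.denom_mem k) a
  have h := T.evalChart_mk_mul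
    ((algebraMap (CoordRing k V) (FractionRing (CoordRing k V))).comp MvPolynomial.C)
    (fun e => algebraMap _ _ (MvPolynomial.X e)) (fun e _ => hx e) n a hn
  rw [ha, zero_mul] at h
  have hn' : a ∈ SIG k o n := by simpa using hn
  have h0 : a = 0 := by
    rw [eq_siMon_of_mem hn', evalSI_siMon] at h
    have h' : algebraMap (CoordRing k V) (FractionRing (CoordRing k V))
        ((a : Polynomial (CoordRing k V)).coeff n) = 0 := by
      rw [h, ← MvPolynomial.coe_eval₂Hom]
      generalize (a : Polynomial (CoordRing k V)).coeff n = f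
      change _ = MvPolynomial.eval₂Hom _ _ f
      rw [← RingHom.congr_fun (MvPolynomial.ringHom_ext (f := algebraMap _ _) (g :=
        MvPolynomial.eval₂Hom ((algebraMap (CoordRing k V)
          (FractionRing (CoordRing k V))).comp MvPolynomial.C)
          fun e => algebraMap _ _ (MvPolynomial.X e)) (by simp) (by simp)) f]
    rw [FaithfulSMul.algebraMap_eq_zero_iff] at h'
    rw [eq_siMon_of_mem hn']
    exact Subtype.ext (by change Polynomial.monomial n _ = 0; rw [h', map_zero])
  subst h0
  apply HomogeneousLocalization.val_injective
  rw [HomogeneousLocalization.Away.val_mk, HomogeneousLocalization.val_zero, Localization.mk_zero]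

/-- For an arrow of the tree the path to the head is the path to the tail followed by the arrow, so
numerator and denominator of `z_e` agree. -/
theorem RTree.coord_eq_one (T : RTree o) {e : Quiver.Total V} (he : e ∈ T.arrows) :
    T.coord k e = 1 := by
  obtain ⟨hx, hinj⟩ := T.evalChart_injective (k := k)
  apply hinj
  have h := T.evalChart_coord_mul
    ((algebraMap (CoordRing k V) (FractionRing (CoordRing k V))).comp MvPolynomial.C)
    (fun e => algebraMap _ _ (MvPolynomial.X e)) hx e
  rw [T.pathProd_head _ he, mul_comm (pathProd _ _)] at h
  rw [map_one]
  exact ((hx e he).mul (T.isUnit_pathProd hx e.left)).mul_right_cancel (by rw [h, one_mul])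

/-- A function on the chart, of the form `f / Π ^ n`, is the polynomial `f` in the coordinates of
the chart. -/
theorem RTree.mk_eq_eval₂_coord (T : RTree o) (n : ℕ) (f : CoordRing k V)
    (hf : f.IsWeightedHomogeneous inc (n • specialWeight o)) :
    (.mk _ (T.denom_mem k) n (siMon n f hf) (by simpa using siMon_mem n f hf) : T.ChartRing k) =
      MvPolynomial.eval₂ (scalarAway k inc (specialWeight o) (T.denom k)) (T.coord k) f := by
  obtain ⟨hx, hinj⟩ := T.evalChart_injective (k := k)
  apply hinj
  set ι := algebraMap (CoordRing k V) (FractionRing (CoordRing k V)) with hι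
  set x : Quiver.Total V → FractionRing (CoordRing k V) := fun e => ι (MvPolynomial.X e) with hxdef
  have hp := T.isUnit_pathProd hx
  -- The gauge transformation with `t_i = 1 / p_i` carries the generic point to the point with
  -- coordinates `z_e`. A polynomial of weight `n ϑ` is multiplied by the corresponding character,
  -- which is the inverse of the `n`-th power of the product of all `p_i`.
  let t : V → (FractionRing (CoordRing k V))ˣ := fun i => (hp i).unit⁻¹
  have ht : ∀ i, (t i : FractionRing (CoordRing k V)) * pathProd x (T.path i) = 1 := fun i =>
    (hp i).val_inv_mul
  have ht0 : t o = 1 := by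
    ext
    have := ht o
    rwa [T.pathProd_root, mul_one] at this
  have hz : ∀ e, T.evalChart (ι.comp MvPolynomial.C) x hx (T.coord k e) =
      charOfUnits t (.ofAdd (inc e)) * x e := fun e => by
    refine (hp e.right).mul_right_cancel ?_
    rw [T.evalChart_coord_mul]
    have h1 := charOfUnits_inc_mul t e
    calc x e * pathProd x (T.path e.left)
        = (t e.right * pathProd x (T.path e.right)) * (x e * pathProd x (T.path e.left)) := by
          rw [ht, one_mul]
      _ = charOfUnits t (.ofAdd (inc e)) * x e * pathProd x (T.path e.right) *
            (t e.left * pathProd x (T.path e.left)) := by rw [← h1]; ring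
      _ = _ := by rw [ht, mul_one]
  have hs : charOfUnits t (.ofAdd (n • specialWeight o)) * T.total x ^ n = 1 := by
    rw [ofAdd_nsmul, map_pow, ← mul_pow, specialWeight_eq_sum_chi, ofAdd_sum, map_prod, RTree.total,
      ← Finset.prod_mul_distrib, Finset.prod_eq_one, one_pow]
    intro i _
    have := charOfUnits_chi_mul (o := o) t i
    rw [ht0, Units.val_one, mul_one] at this
    rw [this, ht]
  have hU : IsUnit (T.total x ^ n) := (T.isUnit_total_iff.2 hx).pow n
  refine hU.mul_right_cancel ?_
  rw [T.evalChart_mk_mul, evalSI_siMon]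
  rw [← MvPolynomial.coe_eval₂Hom (scalarAway k inc (specialWeight o) (T.denom k))]
  rw [← RingHom.comp_apply, MvPolynomial.comp_eval₂Hom, MvPolynomial.coe_eval₂Hom]
  have hsc : (T.evalChart (ι.comp MvPolynomial.C) x hx).comp
      (scalarAway k inc (specialWeight o) (T.denom k)) = ι.comp MvPolynomial.C :=
    RingHom.ext fun c => T.evalChart_scalarAway (ι.comp MvPolynomial.C) x hx c
  rw [hsc]
  refine Eq.trans ?_ (congrArg (fun y => MvPolynomial.eval₂ (ι.comp MvPolynomial.C) y f *
    T.total x ^ n) (funext hz)).symm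
  rw [eval₂_char_mul hf, mul_right_comm, hs, one_mul]

variable (k) in
/-- The comparison of polynomials in the coordinates `z_e` for arrows `e` outside of a spanning tree
with the functions on its chart. -/
def RTree.polyToChart (T : RTree o) :
    MvPolynomial {e // e ∉ T.arrows} k →+* T.ChartRing k :=
  MvPolynomial.eval₂Hom (scalarAway k inc (specialWeight o) (T.denom k)) fun e => T.coord k e

/-- A fraction `f / Π ^ n` is `f` evaluated at the `z_e`, and `z_e = 1` on the tree, so substituting
`1` for the tree variables in `f` gives a preimage. -/
theorem RTree.polyToChart_surjective (T : RTree o) : Function.Surjective (T.polyToChart k) := by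
  classical
  intro a
  obtain ⟨n, a, hn, rfl⟩ := HomogeneousLocalization.Away.mk_surjective _ (T.denom_mem k) a
  have hn' : a ∈ SIG k o n := by simpa using hn
  obtain ⟨f, hf, rfl⟩ : ∃ (f : CoordRing k V) (hf : _), a = siMon n f hf :=
    ⟨_, _, eq_siMon_of_mem hn'⟩
  rw [T.mk_eq_eval₂_coord]
  refine ⟨MvPolynomial.eval₂ MvPolynomial.C
    (fun e => if h : e ∈ T.arrows then 1 else MvPolynomial.X ⟨e, h⟩) f, ?_⟩
  rw [← MvPolynomial.coe_eval₂Hom, ← RingHom.comp_apply, MvPolynomial.comp_eval₂Hom,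
    MvPolynomial.coe_eval₂Hom]
  congr 1
  · ext c
    simp [RTree.polyToChart]
  · funext e
    split_ifs with h
    · rw [map_one, T.coord_eq_one h]
    · simp [RTree.polyToChart]

/-- Evaluation of chart functions at the point with `x_e = 1` on the tree and `x_e` the variable `e`
off the tree is a left inverse. -/
theorem RTree.polyToChart_injective (T : RTree o) : Function.Injective (T.polyToChart k) := by
  classical
  let x : Quiver.Total V → MvPolynomial {e // e ∉ T.arrows} k :=
    fun e => if h : e ∈ T.arrows then 1 else MvPolynomial.X ⟨e, h⟩
  have h1 : ∀ e ∈ T.arrows, x e = 1 := fun e he => dif_pos he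
  let q := T.evalChart (MvPolynomial.C : k →+* _) x fun e he => by rw [h1 e he]; exact isUnit_one
  refine Function.LeftInverse.injective (g := q) fun f => ?_
  have : q.comp (T.polyToChart k) = RingHom.id _ := by
    refine MvPolynomial.ringHom_ext (fun c => ?_) fun e => ?_
    · simp [RTree.polyToChart, q, T.evalChart_scalarAway]
    · have h := T.evalChart_coord_mul (MvPolynomial.C : k →+* _) x
        (fun e he => by rw [h1 e he]; exact isUnit_one) e.1
      rw [T.pathProd_eq_one h1, T.pathProd_eq_one h1, mul_one, mul_one] at h
      simp only [RTree.polyToChart, RingHom.comp_apply, MvPolynomial.coe_eval₂Hom,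
        MvPolynomial.eval₂_X, RingHom.id_apply]
      exact h.trans (dif_neg e.2)
  exact RingHom.congr_fun this f

/-- Homomorphisms from the ring of functions on a chart are determined by the scalars and the
coordinates. -/
theorem RTree.chartRing_hom_ext (T : RTree o) {A : Type*} [CommRing A] {q q' : T.ChartRing k →+* A}
    (h : ∀ c, q (scalarAway k inc (specialWeight o) (T.denom k) c) =
      q' (scalarAway k inc (specialWeight o) (T.denom k) c))
    (h' : ∀ e, q (T.coord k e) = q' (T.coord k e)) : q = q' := by
  rw [← RingHom.cancel_right T.polyToChart_surjective]
  refine MvPolynomial.ringHom_ext (fun c => ?_) fun e => ?_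
  · simpa [RTree.polyToChart] using h c
  · simpa [RTree.polyToChart] using h' e

end Charts

/-! ### Generalities on morphisms of schemes -/

section Schemes

theorem hom_ext_opens {X Y : Scheme.{u}} {f g : X ⟶ Y}
    (h : ∀ x : X, ∃ U : X.Opens, x ∈ U ∧ U.ι ≫ f = U.ι ≫ g) : f = g := by
  choose U hU h using h
  refine (X.openCoverOfIsOpenCover U ?_).hom_ext _ _ h
  rw [TopologicalSpace.IsOpenCover, eq_top_iff]
  intro x _
  exact TopologicalSpace.Opens.mem_iSup.2 ⟨x, hU x⟩

/-- Compatibility is asked on every test scheme mapping to two members of the cover, so that it can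
be verified by comparing coordinates of points. -/
theorem exists_glue_opens {X Y : Scheme.{u}} {ι : Type*} (U : ι → X.Opens) (hU : ∀ x, ∃ i, x ∈ U i)
    (f : ∀ i, (U i).toScheme ⟶ Y)
    (h : ∀ i j (W : Scheme.{u}) (a : W ⟶ (U i).toScheme) (b : W ⟶ (U j).toScheme),
      a ≫ (U i).ι = b ≫ (U j).ι → a ≫ f i = b ≫ f j) :
    ∃ F : X ⟶ Y, ∀ i, (U i).ι ≫ F = f i := by
  have hc : TopologicalSpace.IsOpenCover U := by
    rw [TopologicalSpace.IsOpenCover, eq_top_iff]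
    intro x _
    exact TopologicalSpace.Opens.mem_iSup.2 (hU x)
  let 𝒰 := X.openCoverOfIsOpenCover U hc
  exact ⟨𝒰.glueMorphisms f fun i j => h i j _ _ _ Limits.pullback.condition,
    fun i => 𝒰.ι_glueMorphisms f _ i⟩

theorem isUnit_of_basicOpen_eq {X : Scheme.{u}} {U : X.Opens} {f : Γ(X, U)}
    (h : X.basicOpen f = U) : IsUnit f := by
  refine X.toRingedSpace.isUnit_of_isUnit_germ U f fun x hx => ?_
  rw [← h] at hx
  exact (X.mem_basicOpen f x (X.basicOpen_le f hx)).1 hx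

theorem isUnit_appTop_iff {W X : Scheme.{u}} (q : W ⟶ X) (f : Γ(X, ⊤)) :
    IsUnit (q.appTop f) ↔ ∀ p, q p ∈ X.basicOpen f := by
  constructor
  · intro h p
    have := Scheme.basicOpen_of_isUnit _ h
    rw [← Scheme.preimage_basicOpen_top] at this
    exact (this.symm ▸ trivial : p ∈ q ⁻¹ᵁ X.basicOpen f)
  · intro h
    apply isUnit_of_basicOpen_eq
    rw [← Scheme.preimage_basicOpen_top, eq_top_iff]
    exact fun p _ => h p

theorem isUnit_appTop_ι {X : Scheme.{u}} {U : X.Opens} {f : Γ(X, ⊤)} (h : U ≤ X.basicOpen f) :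
    IsUnit (U.ι.appTop f) :=
  (isUnit_appTop_iff _ _).2 fun p => h p.2

/-- The morphism to an affine scheme given by a ring homomorphism. -/
def toSpec {X : Scheme.{u}} {R : Type u} [CommRing R] (q : R →+* Γ(X, ⊤)) : X ⟶ Spec (.of R) :=
  X.toSpecΓ ≫ Spec.map (CommRingCat.ofHom q)

theorem comp_toSpec {W X : Scheme.{u}} (f : W ⟶ X) {R : Type u} [CommRing R] (q : R →+* Γ(X, ⊤)) :
    f ≫ toSpec q = toSpec (f.appTop.hom.comp q) := by
  rw [toSpec, ← Category.assoc, Scheme.toSpecΓ_naturality, toSpec, Category.assoc, ← Spec.map_comp,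
    CommRingCat.ofHom_comp]
  rfl

theorem toSpec_comp {X : Scheme.{u}} {R S : Type u} [CommRing R] [CommRing S] (q : R →+* Γ(X, ⊤))
    (p : S →+* R) : toSpec q ≫ Spec.map (CommRingCat.ofHom p) = toSpec (q.comp p) := by
  rw [toSpec, Category.assoc, ← Spec.map_comp, ← CommRingCat.ofHom_comp]
  rfl

/-- The ring homomorphism given by a morphism to an affine scheme. -/
def ofSpec {X : Scheme.{u}} {R : Type u} [CommRing R] (m : X ⟶ Spec (.of R)) : R →+* Γ(X, ⊤) :=
  ((Scheme.ΓSpecIso (.of R)).inv ≫ m.appTop).hom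

@[simp] theorem toSpec_ofSpec {X : Scheme.{u}} {R : Type u} [CommRing R] (m : X ⟶ Spec (.of R)) :
    toSpec (ofSpec m) = m := by
  rw [toSpec, ofSpec, CommRingCat.ofHom_hom, Spec.map_comp, ← Category.assoc,
    ← Scheme.toSpecΓ_naturality, Category.assoc, ← SpecMap_ΓSpecIso_hom, ← Spec.map_comp,
    Iso.inv_hom_id, Spec.map_id, Category.comp_id]

@[simp] theorem ofSpec_toSpec {X : Scheme.{u}} {R : Type u} [CommRing R] (q : R →+* Γ(X, ⊤)) :
    ofSpec (toSpec q) = q := by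
  rw [ofSpec, toSpec, Scheme.Hom.comp_appTop, ← Category.assoc, ← Scheme.ΓSpecIso_inv_naturality,
    Category.assoc, Scheme.toSpecΓ_appTop, Iso.inv_hom_id, Category.comp_id, CommRingCat.hom_ofHom]

theorem ofSpec_comp {W X : Scheme.{u}} (f : W ⟶ X) {R : Type u} [CommRing R] (m : X ⟶ Spec (.of R)) :
    ofSpec (f ≫ m) = f.appTop.hom.comp (ofSpec m) := by
  rw [← ofSpec_toSpec (f.appTop.hom.comp (ofSpec m)), ← comp_toSpec, toSpec_ofSpec]

theorem ofSpec_comp_map {X : Scheme.{u}} {R S : Type u} [CommRing R] [CommRing S]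
    (m : X ⟶ Spec (.of R)) (p : S →+* R) :
    ofSpec (m ≫ Spec.map (CommRingCat.ofHom p)) = (ofSpec m).comp p := by
  rw [← ofSpec_toSpec ((ofSpec m).comp p), ← toSpec_comp, toSpec_ofSpec]

theorem toSpec_preimage_basicOpen {X : Scheme.{u}} {R : Type u} [CommRing R] (q : R →+* Γ(X, ⊤))
    (a : R) : toSpec q ⁻¹ᵁ PrimeSpectrum.basicOpen a = X.basicOpen (q a) :=
  X.toSpecΓ_preimage_basicOpen (q a)

end Schemes

/-! ### Morphisms to the GIT quotient given by tuples of functions. -/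

section EvalAway

variable {k : Type u} [Field k] {σ M : Type} [AddCommGroup M] {w : σ → M} {θ : M}
  {A : Type*} [CommRing A]

theorem evalAway_awayMap (g : k →+* A) (x : σ → A) {r r' s : semiInvariants k w θ} {d d' : ℕ}
    (hd : r ∈ semiInvariantsGrading k w θ d) (hd' : r' ∈ semiInvariantsGrading k w θ d')
    (hs : s = r * r') (hr : IsUnit (evalSI w θ g x r)) (hss : IsUnit (evalSI w θ g x s)) :
    (evalAway g x s hss).comp
      (HomogeneousLocalization.awayMap (semiInvariantsGrading k w θ) hd' hs) =
        evalAway g x r hr := by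
  refine RingHom.ext fun z => ?_
  obtain ⟨n, a, ha, rfl⟩ := HomogeneousLocalization.Away.mk_surjective _ hd z
  refine (hss.pow n).mul_right_cancel ?_
  rw [RingHom.comp_apply, HomogeneousLocalization.awayMap_mk, evalAway_mk_mul, hs, map_mul, map_mul,
    map_pow, mul_pow, ← mul_assoc, evalAway_mk_mul]

end EvalAway

section Proj

variable {σ : Type*} {A : Type u} [CommRing A] [SetLike σ A] [AddSubgroupClass σ A] (𝒜 : ℕ → σ)
  [GradedRing 𝒜]

theorem awayι_congr {f : A} {d d' : ℕ} (h : d = d') (hf : f ∈ 𝒜 d) (hf' : f ∈ 𝒜 d') (hd : 0 < d)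
    (hd' : 0 < d') : Proj.awayι 𝒜 f hf hd = Proj.awayι 𝒜 f hf' hd' := by
  subst h
  rfl

theorem map_awayMap_awayι_comm {f f' : A} {d d' : ℕ} (hf : f ∈ 𝒜 d) (hf' : f' ∈ 𝒜 d') (hd : 0 < d)
    (hd' : 0 < d') :
    Spec.map (CommRingCat.ofHom (HomogeneousLocalization.awayMap 𝒜 hf' (rfl : f * f' = _))) ≫
        Proj.awayι 𝒜 f hf hd =
      Spec.map (CommRingCat.ofHom (HomogeneousLocalization.awayMap 𝒜 hf (mul_comm f f'))) ≫
        Proj.awayι 𝒜 f' hf' hd' := by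
  rw [Proj.SpecMap_awayMap_awayι, Proj.SpecMap_awayMap_awayι]
  exact awayι_congr 𝒜 (add_comm d d') _ _ _ _

end Proj

section AwayPoint

variable {k : Type u} [Field k] {σ M : Type} [AddCommGroup M] {w : σ → M} {θ : M} {X : Scheme.{u}}

/-- The morphism to the GIT quotient given by a tuple of functions at which the semi-invariant `r`
is invertible. -/
def awayPoint (g : k →+* Γ(X, ⊤)) (x : σ → Γ(X, ⊤)) {r : semiInvariants k w θ}
    (hr : IsUnit (evalSI w θ g x r)) {d : ℕ} (h : r ∈ semiInvariantsGrading k w θ d) (hd : 0 < d) :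
    X ⟶ gitQuotient k w θ :=
  toSpec (evalAway g x r hr) ≫ Proj.awayι (semiInvariantsGrading k w θ) r h hd

/-- Both morphisms factor through the locus where `r * r'` does not vanish, where they are given by
the same evaluation. -/
theorem awayPoint_eq (g : k →+* Γ(X, ⊤)) (x : σ → Γ(X, ⊤)) {r r' : semiInvariants k w θ}
    (hr : IsUnit (evalSI w θ g x r)) (hr' : IsUnit (evalSI w θ g x r')) {d d' : ℕ}
    (h : r ∈ semiInvariantsGrading k w θ d) (hd : 0 < d)
    (h' : r' ∈ semiInvariantsGrading k w θ d') (hd' : 0 < d') :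
    awayPoint g x hr h hd = awayPoint g x hr' h' hd' := by
  have h3 : IsUnit (evalSI w θ g x (r * r')) := by
    rw [map_mul]; exact hr.mul hr'
  rw [awayPoint, awayPoint, ← evalAway_awayMap g x h h' rfl hr h3,
    ← evalAway_awayMap g x h' h (mul_comm _ _) hr' h3, ← toSpec_comp, ← toSpec_comp, Category.assoc,
    Category.assoc, map_awayMap_awayι_comm (semiInvariantsGrading k w θ) h h' hd hd']

theorem awayPoint_preimage_basicOpen (g : k →+* Γ(X, ⊤)) (x : σ → Γ(X, ⊤))
    {r r' : semiInvariants k w θ} (hr : IsUnit (evalSI w θ g x r)) {d d' : ℕ}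
    (h : r ∈ semiInvariantsGrading k w θ d) (hd : 0 < d)
    (h' : r' ∈ semiInvariantsGrading k w θ d') (hd' : 0 < d') :
    awayPoint g x hr h hd ⁻¹ᵁ Proj.basicOpen (semiInvariantsGrading k w θ) r' =
      X.basicOpen (evalSI w θ g x r') := by
  -- On the locus of `r`, the function cutting out the vanishing of `r'` is the degree zero fraction
  -- `r' ^ d / r ^ d'`.
  have e : r' ^ d ∈ semiInvariantsGrading k w θ (d' • d) := by
    have := SetLike.pow_mem_graded d h'
    rwa [smul_eq_mul, mul_comm] at this
  have e2 := evalAway_mk_mul g x hr h d' (r' ^ d) e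
  rw [awayPoint, Scheme.Hom.comp_preimage,
    Proj.awayι_preimage_basicOpen (semiInvariantsGrading k w θ) h hd h' hd',
    toSpec_preimage_basicOpen, ← X.basicOpen_pow (evalSI w θ g x r') hd, ← map_pow, ← e2,
    Scheme.basicOpen_mul, Scheme.basicOpen_of_isUnit _ (hr.pow _), inf_top_eq]

theorem awayPoint_toAffine (g : k →+* Γ(X, ⊤)) (x : σ → Γ(X, ⊤)) {r : semiInvariants k w θ}
    (hr : IsUnit (evalSI w θ g x r)) {d : ℕ} (h : r ∈ semiInvariantsGrading k w θ d) (hd : 0 < d) :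
    awayPoint g x hr h hd ≫ gitToAffine k w θ =
      toSpec ((MvPolynomial.eval₂Hom g x).comp (invariants k w).val.toRingHom) := by
  rw [awayPoint, gitToAffine, Category.assoc, Proj.awayι_toSpecZero_assoc, ← Spec.map_comp,
    ← CommRingCat.ofHom_comp, toSpec_comp]
  congr 1
  exact RingHom.ext fun c => evalAway_fromZero g x hr c

end AwayPoint

/-! ### Points of the quotient in the chart of a spanning tree. -/

section Point

variable {V : Type} [Quiver.{0} V] [Fintype V] [DecidableEq V] {k : Type u} [Field k] {o : V}

/-- The open immersion of the chart of a spanning tree. -/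
def RTree.chartι (k : Type u) [Field k] (T : RTree o) : Spec (.of (T.ChartRing k)) ⟶ GQ k o :=
  Proj.awayι (SIG k o) (T.denom k) (T.denom_mem k) one_pos

instance (T : RTree o) : IsOpenImmersion (T.chartι k) := by
  unfold RTree.chartι; infer_instance

/-- The chart of a spanning tree. -/
def RTree.chart (k : Type u) [Field k] (T : RTree o) : (GQ k o).Opens :=
  Proj.basicOpen (SIG k o) (T.denom k)

theorem RTree.opensRange_chartι (T : RTree o) : (T.chartι k).opensRange = T.chart k :=
  Proj.opensRange_awayι _ _ _ _

variable {X : Scheme.{u}}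

/-- The morphism to the GIT quotient given by a tuple of functions, the functions at the arrows of
the tree `T` being invertible. -/
def RTree.point (T : RTree o) (g : k →+* Γ(X, ⊤)) (x : Quiver.Total V → Γ(X, ⊤))
    (hx : ∀ e ∈ T.arrows, IsUnit (x e)) : X ⟶ GQ k o :=
  toSpec (T.evalChart g x hx) ≫ T.chartι k

theorem RTree.comp_point (T : RTree o) (g : k →+* Γ(X, ⊤)) (x : Quiver.Total V → Γ(X, ⊤))
    (hx : ∀ e ∈ T.arrows, IsUnit (x e)) {W : Scheme.{u}} (q : W ⟶ X) :
    q ≫ T.point g x hx = T.point (q.appTop.hom.comp g) (fun e => q.appTop (x e))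
      (fun e he => (hx e he).map q.appTop.hom) := by
  rw [RTree.point, ← Category.assoc, comp_toSpec, RTree.point]
  congr 2
  refine T.chartRing_hom_ext (fun c => ?_) fun e => ?_
  · rw [RingHom.comp_apply, T.evalChart_scalarAway, T.evalChart_scalarAway, RingHom.comp_apply]
  · have hx' : ∀ e ∈ T.arrows, IsUnit (q.appTop (x e)) := fun e he => (hx e he).map q.appTop.hom
    refine (T.isUnit_pathProd hx' e.right).mul_right_cancel ?_
    rw [T.evalChart_coord_mul, RingHom.comp_apply]
    have h := congrArg q.appTop.hom (T.evalChart_coord_mul g x hx e)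
    rw [map_mul, map_mul, map_pathProd, map_pathProd] at h
    exact h

theorem RTree.isUnit_evalSI_denom (T : RTree o) {A : Type*} [CommRing A] (g : k →+* A)
    {x : Quiver.Total V → A} (hx : ∀ e ∈ T.arrows, IsUnit (x e)) :
    IsUnit (evalSI inc (specialWeight o) g x (T.denom k)) := by
  rw [T.evalSI_denom]; exact T.isUnit_total_iff.2 hx

theorem RTree.point_eq_awayPoint (T : RTree o) (g : k →+* Γ(X, ⊤)) (x : Quiver.Total V → Γ(X, ⊤))
    (hx : ∀ e ∈ T.arrows, IsUnit (x e)) :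
    T.point g x hx = awayPoint g x (T.isUnit_evalSI_denom g hx) (T.denom_mem k) one_pos := rfl

/-- The point does not depend on the tree used to describe it; this is what glues the quotient
morphism. -/
theorem RTree.point_eq_point (T T' : RTree o) (g : k →+* Γ(X, ⊤)) (x : Quiver.Total V → Γ(X, ⊤))
    (hx : ∀ e ∈ T.arrows, IsUnit (x e)) (hx' : ∀ e ∈ T'.arrows, IsUnit (x e)) :
    T.point g x hx = T'.point g x hx' := by
  rw [T.point_eq_awayPoint, T'.point_eq_awayPoint]
  exact awayPoint_eq _ _ _ _ _ _ _ _

theorem RTree.point_eq_iff (T : RTree o) {g g' : k →+* Γ(X, ⊤)} {x x' : Quiver.Total V → Γ(X, ⊤)}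
    {hx : ∀ e ∈ T.arrows, IsUnit (x e)} {hx' : ∀ e ∈ T.arrows, IsUnit (x' e)} :
    T.point g x hx = T.point g' x' hx' ↔ T.evalChart g x hx = T.evalChart g' x' hx' := by
  rw [RTree.point, RTree.point, cancel_mono]
  refine ⟨fun h => ?_, fun h => by rw [h]⟩
  rw [← ofSpec_toSpec (T.evalChart g x hx), h, ofSpec_toSpec]

/-- The gauge factors cancel in `z_e = x_e p_{t(e)} / p_{h(e)}`: the arrow contributes the factors
of its two ends, and the two path products contribute their inverses together with a common factor
from the root. -/
theorem RTree.point_eq_of_gauge (T : RTree o) (g : k →+* Γ(X, ⊤)) {x x' : Quiver.Total V → Γ(X, ⊤)}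
    (hx : ∀ e ∈ T.arrows, IsUnit (x e)) (hx' : ∀ e ∈ T.arrows, IsUnit (x' e)) {t : V → Γ(X, ⊤)}
    (ht : ∀ i, IsUnit (t i)) (h : ∀ e, x' e * t e.left = x e * t e.right) :
    T.point g x hx = T.point g x' hx' := by
  rw [RTree.point_eq_iff]
  refine T.chartRing_hom_ext (fun c => ?_) fun e => ?_
  · rw [T.evalChart_scalarAway, T.evalChart_scalarAway]
  · have e1 := T.evalChart_coord_mul g x hx e
    have e2 := T.evalChart_coord_mul g x' hx' e
    have e3 := pathProd_gauge h (T.path e.left)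
    have e4 := pathProd_gauge h (T.path e.right)
    refine ((T.isUnit_pathProd hx e.right).mul
      ((T.isUnit_pathProd hx' e.right).mul ((ht o).mul (ht e.left)))).mul_right_cancel ?_
    calc T.evalChart g x hx (T.coord k e) * (pathProd x (T.path e.right) *
          (pathProd x' (T.path e.right) * (t o * t e.left)))
        = x e * pathProd x (T.path e.left) * (pathProd x' (T.path e.right) * t o * t e.left) := by
          rw [← e1]; ring
      _ = (x e * t e.right) * (pathProd x (T.path e.left) * t e.left) *
            pathProd x (T.path e.right) := by rw [e4]; ring
      _ = x' e * pathProd x' (T.path e.left) *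
            (pathProd x (T.path e.right) * (t o * t e.left)) := by rw [← h, ← e3]; ring
      _ = _ := by rw [← e2]; ring

theorem RTree.point_preimage_chart (T T' : RTree o) (g : k →+* Γ(X, ⊤))
    (x : Quiver.Total V → Γ(X, ⊤)) (hx : ∀ e ∈ T.arrows, IsUnit (x e)) :
    T.point g x hx ⁻¹ᵁ T'.chart k = X.basicOpen (T'.total x) := by
  rw [T.point_eq_awayPoint, RTree.chart,
    awayPoint_preimage_basicOpen _ _ _ _ _ (T'.denom_mem k) one_pos, T'.evalSI_denom]

/-- A morphism into the chart is a homomorphism from the chart ring; the values of the coordinates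
`z_e` under it serve as the tuple of functions, and they are `1` on the tree. -/
theorem RTree.exists_eq_point (T : RTree o) (h : X ⟶ GQ k o) (hh : ∀ p, h p ∈ T.chart k) :
    ∃ (g : k →+* Γ(X, ⊤)) (x : Quiver.Total V → Γ(X, ⊤)) (hx : ∀ e ∈ T.arrows, x e = 1),
      h = T.point g x fun e he => (hx e he).symm ▸ isUnit_one := by
  have hr : Set.range h ⊆ Set.range (T.chartι k) := by
    have : Set.range (T.chartι k) = ((T.chartι k).opensRange : Set _) := rfl
    rw [this, RTree.opensRange_chartι]
    rintro _ ⟨x, rfl⟩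
    exact hh x
  let m := IsOpenImmersion.lift _ h hr
  have hm : m ≫ T.chartι k = h := IsOpenImmersion.lift_fac _ h hr
  refine ⟨(ofSpec m).comp (scalarAway k inc (specialWeight o) (T.denom k)),
    fun e => ofSpec m (T.coord k e), fun e he => (congrArg _ (T.coord_eq_one he)).trans (map_one _), ?_⟩
  rw [RTree.point, ← hm]
  congr 1
  rw [← toSpec_ofSpec m]
  congr 1
  rw [ofSpec_toSpec]
  refine T.chartRing_hom_ext (fun c => ?_) fun e => ?_
  · rw [T.evalChart_scalarAway]; rfl
  · have := T.evalChart_coord_mul ((ofSpec m).comp (scalarAway k inc (specialWeight o) (T.denom k)))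
      (fun e => ofSpec m (T.coord k e))
      (fun e he => by
        rw [T.coord_eq_one he, map_one]; exact isUnit_one) e
    have h1 : ∀ i, pathProd (fun e => ofSpec m (T.coord k e)) (T.path i) = 1 := fun i =>
      T.pathProd_eq_one (fun e he => (congrArg _ (T.coord_eq_one he)).trans (map_one _)) i
    rw [h1, h1, mul_one, mul_one] at this
    exact this.symm

theorem RTree.point_toAffine (T : RTree o) (g : k →+* Γ(X, ⊤)) (x : Quiver.Total V → Γ(X, ⊤))
    (hx : ∀ e ∈ T.arrows, IsUnit (x e)) :
    T.point g x hx ≫ gitToAffine k inc (specialWeight o) =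
      toSpec ((MvPolynomial.eval₂Hom g x).comp (invariants k (inc (V := V))).val.toRingHom) := by
  rw [T.point_eq_awayPoint]
  exact awayPoint_toAffine _ _ _ _ _

end Point

/-! ### The charts of the spanning trees cover the quotient. -/

section Charts

variable {V : Type} [Quiver.{0} V] [Fintype V] [DecidableEq V] {k : Type u} [Field k] {o : V}

theorem PathIn.exists_monomial {S : Set (Quiver.Total V)} {i j : V} {p : Quiver.Path i j}
    (hp : PathIn S p) : ∃ u : Quiver.Total V →₀ ℕ, (∀ e, u e ≠ 0 → e ∈ S) ∧
      (pathProd MvPolynomial.X p : CoordRing k V) = MvPolynomial.monomial u 1 := by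
  classical
  induction p with
  | nil => exact ⟨0, fun e he => absurd rfl he, rfl⟩
  | cons p e ih =>
    obtain ⟨u, hu, hu'⟩ := ih hp.1
    refine ⟨u + Finsupp.single ⟨_, _, e⟩ 1, fun e' he' => ?_, ?_⟩
    · by_cases h : e' = ⟨_, _, e⟩
      · exact h ▸ hp.2
      · refine hu _ ?_
        rwa [Finsupp.add_apply, Finsupp.single_eq_of_ne h, add_zero] at he'
    · rw [pathProd_cons, hu', MvPolynomial.X, MvPolynomial.monomial_mul, one_mul]

theorem RTree.exists_total_eq_monomial (T : RTree o) : ∃ u : Quiver.Total V →₀ ℕ,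
    (∀ e, u e ≠ 0 → e ∈ T.arrows) ∧
      (T.total MvPolynomial.X : CoordRing k V) = MvPolynomial.monomial u 1 := by
  choose u hu hu' using fun i => (T.path_mem i).exists_monomial (k := k)
  refine ⟨∑ i, u i, fun e he => ?_, ?_⟩
  · rw [Finsupp.finsetSum_apply] at he
    obtain ⟨i, -, hi⟩ := Finset.exists_ne_zero_of_sum_ne_zero he
    exact hu i e hi
  · rw [RTree.total, MvPolynomial.monomial_sum_one]
    exact Finset.prod_congr rfl fun i _ => hu' i

/-- The exponent vector of the denominator of the chart is supported on the tree, where `v` is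
positive, so it lies below a multiple of `v`. -/
theorem siMon_monomial_pow_eq (T : RTree o) (v : Quiver.Total V →₀ ℕ) (n : ℕ)
    (hv : Finsupp.weight inc v = (n + 1) • specialWeight o) (hT : ∀ e ∈ T.arrows, v e ≠ 0)
    (h : (MvPolynomial.monomial v (1 : k)).IsWeightedHomogeneous inc ((n + 1) • specialWeight o)) :
    ∃ N, T.denom k ∣ siMon (n + 1) (MvPolynomial.monomial v 1) h ^ N := by
  obtain ⟨u, hu, hu'⟩ := T.exists_total_eq_monomial (k := k)
  -- Already `u.degree` dominates the exponents of `u`; the extra one keeps `N` positive, so that `N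
  -- * (n + 1) - 1`, the degree of the cofactor, is a natural number.
  let N := u.degree + 1
  have hle : u ≤ N • v := fun e => by
    by_cases he : u e = 0
    · rw [he]; exact Nat.zero_le _
    · have h1 := Nat.pos_of_ne_zero (hT e (hu e he))
      have h2 : u e ≤ u.degree := Finsupp.le_degree e u
      calc u e ≤ N * 1 := by omega
        _ ≤ N * v e := Nat.mul_le_mul_left _ h1
        _ = _ := by simp
  have hwu : Finsupp.weight inc u = specialWeight o := by
    have h1 : (T.total MvPolynomial.X : CoordRing k V).IsWeightedHomogeneous inc _ :=
      isWeightedHomogeneous_prod_pathProd k T Finset.univ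
    rw [hu', ← specialWeight_eq_sum_chi] at h1
    exact h1 (by classical rw [MvPolynomial.coeff_monomial, if_pos rfl]; exact one_ne_zero)
  obtain ⟨c, hc⟩ := exists_add_of_le hle
  have hN : N * (n + 1) = 1 + (u.degree * (n + 1) + n) := by simp only [N]; ring
  have hwc : Finsupp.weight inc c = (u.degree * (n + 1) + n) • specialWeight o := by
    have := congrArg (Finsupp.weight (inc (V := V))) hc
    rw [map_nsmul, map_add, hv, hwu, ← mul_smul, hN, add_smul, one_smul] at this
    exact (add_left_cancel this).symm
  refine ⟨N, siMon _ (MvPolynomial.monomial c 1)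
    (MvPolynomial.isWeightedHomogeneous_monomial _ _ _ hwc), ?_⟩
  have hpow : ∀ N : ℕ, siMon (n + 1) (MvPolynomial.monomial v (1 : k)) h ^ N =
      siMon (N * (n + 1)) (MvPolynomial.monomial (N • v) 1)
        (MvPolynomial.isWeightedHomogeneous_monomial _ _ _ (by rw [map_nsmul, hv, mul_smul])) := by
    intro N
    apply Subtype.ext
    change (Polynomial.monomial (n + 1) (MvPolynomial.monomial v (1 : k))) ^ N =
      Polynomial.monomial _ _
    rw [Polynomial.monomial_pow, MvPolynomial.monomial_pow, one_pow, mul_comm]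
  rw [hpow, RTree.denom, siMon_mul]
  · refine siMon_congr hN ?_
    rw [hu', MvPolynomial.monomial_mul, one_mul, hc]
  · rw [hu', MvPolynomial.monomial_mul, one_mul, ← hc]
    exact MvPolynomial.isWeightedHomogeneous_monomial _ _ _ (by
      rw [map_nsmul, hv, ← mul_smul, hN])

/-- If `p` were in no chart, it would contain every tree denominator, hence every monomial of
positive degree because a power of it is divisible by such a denominator, hence the irrelevant
ideal. -/
theorem exists_mem_chart (p : GQ k o) : ∃ T : RTree o, p ∈ T.chart k := by
  classical
  have hp := p.not_irrelevant_le
  by_contra! hT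
  refine hp fun f hf => ?_
  have hf0 : GradedRing.proj (SIG k o) 0 f = 0 := hf
  rw [← DirectSum.sum_support_decompose (SIG k o) f]
  refine Ideal.sum_mem _ fun n hn => ?_
  have hn0 : n ≠ 0 := by
    rintro rfl
    exact (DFinsupp.mem_support_toFun _ _).1 hn (Subtype.ext hf0)
  obtain ⟨n, rfl⟩ := Nat.exists_eq_succ_of_ne_zero hn0
  generalize DirectSum.decompose (SIG k o) f (n + 1) = a
  obtain ⟨a, ha⟩ := a
  change a ∈ p.asHomogeneousIdeal.toIdeal
  rw [eq_siMon_of_mem ha]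
  set P := (a : Polynomial (CoordRing k V)).coeff (n + 1) with hP
  have hw := a.2 (n + 1)
  rw [← hP] at hw
  have hmon : ∀ v ∈ P.support, Finsupp.weight inc v = (n + 1) • specialWeight o := fun v hv =>
    hw (MvPolynomial.mem_support_iff.1 hv)
  have hsum : siMon (n + 1) P hw = ∑ v ∈ P.support.attach,
      siMon (n + 1) (MvPolynomial.monomial v.1 (P.coeff v.1))
        (MvPolynomial.isWeightedHomogeneous_monomial _ _ _ (hmon v.1 v.2)) := by
    apply Subtype.ext
    rw [AddSubmonoidClass.coe_finsetSum]
    change Polynomial.monomial (n + 1) P = ∑ v ∈ P.support.attach, Polynomial.monomial (n + 1)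
      (MvPolynomial.monomial v.1 (P.coeff v.1))
    rw [← map_sum, Finset.sum_attach P.support fun v => MvPolynomial.monomial v (P.coeff v),
      MvPolynomial.support_sum_monomial_coeff]
  rw [hsum]
  refine Ideal.sum_mem _ fun v _ => ?_
  have hv := hmon v.1 v.2
  obtain ⟨T, hTv⟩ := exists_rTree_of_weight v.1 n hv
  have h1 : (MvPolynomial.monomial v.1 (1 : k)).IsWeightedHomogeneous inc
      ((n + 1) • specialWeight o) := MvPolynomial.isWeightedHomogeneous_monomial _ _ _ hv
  have h0 : (MvPolynomial.C (P.coeff v.1)).IsWeightedHomogeneous (inc (V := V))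
      (0 • specialWeight o) := by
    rw [zero_smul]; exact MvPolynomial.isWeightedHomogeneous_C _ _
  have e : siMon (n + 1) (MvPolynomial.monomial v.1 (P.coeff v.1))
      (MvPolynomial.isWeightedHomogeneous_monomial _ _ _ hv) =
      siMon 0 (MvPolynomial.C (P.coeff v.1)) h0 * siMon (n + 1) (MvPolynomial.monomial v.1 1) h1 := by
    apply Subtype.ext
    change Polynomial.monomial (n + 1) _ = Polynomial.monomial 0 _ * Polynomial.monomial (n + 1) _
    rw [Polynomial.monomial_mul_monomial, zero_add, MvPolynomial.C_mul_monomial, mul_one]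
  rw [e]
  refine Ideal.mul_mem_left _ _ ?_
  obtain ⟨N, hN⟩ := siMon_monomial_pow_eq T v.1 n hv hTv h1
  refine p.isPrime.mem_of_pow_mem N (Ideal.mem_of_dvd _ hN ?_)
  by_contra hd
  exact hT T ((Proj.mem_basicOpen _ _ _).2 hd)

end Charts

/-! ### The quotient morphism from the tree locus, described on points. -/

section Quotient

variable {V : Type} [Quiver.{0} V] [Fintype V] [DecidableEq V] {k : Type u} [Field k] {o : V}
  {X : Scheme.{u}}

theorem RTree.mem_basicOpen_total_iff (T : RTree o) (x : Quiver.Total V → Γ(X, ⊤)) (p : X) :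
    p ∈ X.basicOpen (T.total x) ↔ ∀ e ∈ T.arrows, p ∈ X.basicOpen (x e) := by
  rw [X.mem_basicOpen _ p (TopologicalSpace.Opens.mem_top p)]
  change IsUnit ((X.presheaf.germ ⊤ p _).hom _) ↔ _
  rw [T.map_total, T.isUnit_total_iff]
  exact forall₂_congr fun e _ => (X.mem_basicOpen _ p (TopologicalSpace.Opens.mem_top p)).symm

/-- The generator of the tree ideal is the product of the arrows of a tree, each taken once, while
`RTree.total` takes some with higher multiplicity; both are invertible at a point exactly when all
arrows of the tree are. -/
theorem toSpec_mem_treeLocus_iff (q : CoordRing k V →+* Γ(X, ⊤)) (p : X) :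
    toSpec q p ∈ treeLocus k o ↔ ∃ T : RTree o, p ∈ X.basicOpen (T.total fun e => q (.X e)) := by
  have h1 : toSpec q p ∈ treeLocus k o ↔ ∃ T : RTree o,
      toSpec q p ∈ PrimeSpectrum.basicOpen (∏ e ∈ T.arrows, .X e : CoordRing k V) := by
    change ¬ ((treeIdeal k o : Set (CoordRing k V)) ⊆
      (PrimeSpectrum.asIdeal (toSpec q p) : Set (CoordRing k V))) ↔ _
    rw [treeIdeal, SetLike.coe_subset_coe, Ideal.span_le, Set.not_subset]
    constructor
    · rintro ⟨_, ⟨T, hT, rfl⟩, h⟩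
      obtain ⟨T, rfl⟩ := hT.exists_rTree
      exact ⟨T, h⟩
    · rintro ⟨T, h⟩
      exact ⟨_, ⟨T.arrows, T.isSpanningTree, rfl⟩, h⟩
  rw [h1]
  refine exists_congr fun T => ?_
  rw [T.mem_basicOpen_total_iff]
  change p ∈ toSpec q ⁻¹ᵁ PrimeSpectrum.basicOpen _ ↔ _
  rw [toSpec_preimage_basicOpen, map_prod, X.mem_basicOpen _ p (TopologicalSpace.Opens.mem_top p)]
  change IsUnit ((X.presheaf.germ ⊤ p _).hom _) ↔ _
  rw [map_prod, IsUnit.prod_iff]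
  exact forall₂_congr fun e _ => (X.mem_basicOpen _ p (TopologicalSpace.Opens.mem_top p)).symm

/-- The coordinates of a point of the complement of the locus of the tree ideal. -/
def coordOf (m : X ⟶ (treeLocus k o).toScheme) (e : Quiver.Total V) : Γ(X, ⊤) :=
  ofSpec (m ≫ (treeLocus k o).ι) (.X e)

/-- The restriction to scalars of a point of the complement of the locus of the tree ideal. -/
def baseOf (m : X ⟶ (treeLocus k o).toScheme) : k →+* Γ(X, ⊤) :=
  (ofSpec (m ≫ (treeLocus k o).ι)).comp MvPolynomial.C

theorem coordOf_comp {W : Scheme.{u}} (q : W ⟶ X) (m : X ⟶ (treeLocus k o).toScheme)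
    (e : Quiver.Total V) : coordOf (q ≫ m) e = q.appTop (coordOf m e) := by
  rw [coordOf, Category.assoc, ofSpec_comp]; rfl

theorem baseOf_comp {W : Scheme.{u}} (q : W ⟶ X) (m : X ⟶ (treeLocus k o).toScheme) :
    baseOf (q ≫ m) = q.appTop.hom.comp (baseOf m) := by
  rw [baseOf, Category.assoc, ofSpec_comp]; rfl

theorem treeLocus_hom_ext {m m' : X ⟶ (treeLocus k o).toScheme} (h : baseOf m = baseOf m')
    (h' : ∀ e, coordOf m e = coordOf m' e) : m = m' := by
  rw [← cancel_mono (treeLocus k o).ι, ← toSpec_ofSpec (m ≫ _), ← toSpec_ofSpec (m' ≫ _)]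
  congr 1
  exact MvPolynomial.ringHom_ext (fun c => RingHom.congr_fun h c) h'

theorem exists_mem_basicOpen_total (m : X ⟶ (treeLocus k o).toScheme) (p : X) :
    ∃ T : RTree o, p ∈ X.basicOpen (T.total (coordOf m)) := by
  refine (toSpec_mem_treeLocus_iff _ p).1 ?_
  rw [toSpec_ofSpec]
  exact (m p).2

/-- The point of the complement of the locus of the tree ideal with given coordinates. -/
theorem exists_hom_treeLocus (g : k →+* Γ(X, ⊤)) (x : Quiver.Total V → Γ(X, ⊤))
    (h : ∀ p, ∃ T : RTree o, p ∈ X.basicOpen (T.total x)) :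
    ∃ m : X ⟶ (treeLocus k o).toScheme, baseOf m = g ∧ coordOf m = x := by
  let f : X ⟶ repSpace k V := toSpec (MvPolynomial.eval₂Hom g x)
  have hr : Set.range f ⊆ Set.range (treeLocus k o).ι := by
    rw [Scheme.Opens.range_ι]
    rintro _ ⟨p, rfl⟩
    refine (toSpec_mem_treeLocus_iff _ p).2 ?_
    simpa using h p
  refine ⟨IsOpenImmersion.lift _ f hr, ?_, ?_⟩
  · rw [baseOf, IsOpenImmersion.lift_fac, ofSpec_toSpec]
    exact RingHom.ext fun c => MvPolynomial.eval₂_C _ _ _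
  · funext e
    rw [coordOf, IsOpenImmersion.lift_fac, ofSpec_toSpec]
    exact MvPolynomial.eval₂_X _ _ _

/-- The morphism is glued from the open sets where the coordinates along a fixed tree are
invertible; independence of the tree gives compatibility. Stating the formula for all test schemes
makes it the only property of the quotient morphism used afterwards. -/
theorem exists_treeQuotient (k : Type u) [Field k] (o : V) :
    ∃ φ : (treeLocus k o).toScheme ⟶ GQ k o, ∀ (X : Scheme.{u}) (m : X ⟶ (treeLocus k o).toScheme)
      (T : RTree o) (hx : ∀ e ∈ T.arrows, IsUnit (coordOf m e)),
      m ≫ φ = T.point (baseOf m) (coordOf m) hx := by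
  let Y := (treeLocus k o).toScheme
  let U : RTree o → Y.Opens := fun T => Y.basicOpen (T.total (coordOf (𝟙 Y)))
  have hU : ∀ T, ∀ e ∈ T.arrows, IsUnit (coordOf (U T).ι e) := fun T e he => by
    rw [← Category.comp_id (U T).ι, coordOf_comp]
    exact isUnit_appTop_ι fun p hp => (T.mem_basicOpen_total_iff _ p).1 hp e he
  have key : ∀ (T T' : RTree o) (W : Scheme.{u}) (a : W ⟶ (U T).toScheme) (m : W ⟶ Y)
      (hm : a ≫ (U T).ι = m) (h : ∀ e ∈ T'.arrows, IsUnit (coordOf m e)),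
      a ≫ T.point (baseOf (U T).ι) (coordOf (U T).ι) (hU T) =
        T'.point (baseOf m) (coordOf m) h := by
    rintro T T' W a m rfl h
    have h' : ∀ e ∈ T.arrows, IsUnit (coordOf (a ≫ (U T).ι) e) := fun e he => by
      rw [coordOf_comp]
      exact (hU T e he).map a.appTop.hom
    rw [← T.point_eq_point T' _ _ h', T.comp_point]
    congr 1
  obtain ⟨φ, hφ⟩ := exists_glue_opens U (fun x => exists_mem_basicOpen_total (𝟙 Y) x)
    (fun T => T.point (baseOf (U T).ι) (coordOf (U T).ι) (hU T)) fun T T' W a b hab => by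
      have h' : ∀ e ∈ T'.arrows, IsUnit (coordOf (b ≫ (U T').ι) e) := fun e he => by
        rw [coordOf_comp]
        exact (hU T' e he).map b.appTop.hom
      rw [key T T' W a _ hab h', key T' T' W b _ rfl h']
  refine ⟨φ, fun X m T hx => hom_ext_opens fun x => ?_⟩
  obtain ⟨T', hT'⟩ := exists_mem_basicOpen_total (𝟙 Y) (m x)
  refine ⟨m ⁻¹ᵁ U T', hT', ?_⟩
  have e1 : (m ⁻¹ᵁ U T').ι ≫ m = m ∣_ U T' ≫ (U T').ι := (morphismRestrict_ι m (U T')).symm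
  have h' : ∀ e ∈ T.arrows, IsUnit (coordOf ((m ⁻¹ᵁ U T').ι ≫ m) e) := fun e he => by
    rw [coordOf_comp]
    exact (hx e he).map (m ⁻¹ᵁ U T').ι.appTop.hom
  rw [← Category.assoc, e1, Category.assoc, hφ, key T' T _ _ _ e1.symm h', T.comp_point]
  congr 1

/-- The quotient morphism to the GIT quotient. -/
def treeQuotient (k : Type u) [Field k] (o : V) : (treeLocus k o).toScheme ⟶ GQ k o :=
  (exists_treeQuotient k o).choose

theorem RTree.comp_treeQuotient (T : RTree o) (m : X ⟶ (treeLocus k o).toScheme)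
    (hx : ∀ e ∈ T.arrows, IsUnit (coordOf m e)) :
    m ≫ treeQuotient k o = T.point (baseOf m) (coordOf m) hx :=
  (exists_treeQuotient k o).choose_spec X m T hx

/-- To check an equality of morphisms from a scheme with a point of the tree locus, one may assume
that the coordinates along a spanning tree are invertible. -/
theorem hom_ext_of_isUnit {Y : Scheme.{u}} (m : X ⟶ (treeLocus k o).toScheme) {f f' : X ⟶ Y}
    (h : ∀ (U : X.Opens) (T : RTree o), (∀ e ∈ T.arrows, IsUnit (coordOf (U.ι ≫ m) e)) →
      U.ι ≫ f = U.ι ≫ f') : f = f' := by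
  refine hom_ext_opens fun p => ?_
  obtain ⟨T, hT⟩ := exists_mem_basicOpen_total m p
  refine ⟨_, hT, h _ T fun e he => ?_⟩
  rw [coordOf_comp]
  exact isUnit_appTop_ι fun p hp => (T.mem_basicOpen_total_iff _ p).1 hp e he

/-- Locally one tree has invertible coordinates for `m`, hence also for `m'`, and the comparison
takes place in a single chart. -/
theorem comp_treeQuotient_eq_of_gauge {m m' : X ⟶ (treeLocus k o).toScheme}
    (h : baseOf m = baseOf m') {t : V → Γ(X, ⊤)} (ht : ∀ i, IsUnit (t i))
    (h' : ∀ e, coordOf m' e * t e.left = coordOf m e * t e.right) :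
    m ≫ treeQuotient k o = m' ≫ treeQuotient k o := by
  refine hom_ext_of_isUnit m fun U T hT => ?_
  have ht' : ∀ i, IsUnit (U.ι.appTop (t i)) := fun i => (ht i).map U.ι.appTop.hom
  have hg : ∀ e, coordOf (U.ι ≫ m') e * U.ι.appTop (t e.left) =
      coordOf (U.ι ≫ m) e * U.ι.appTop (t e.right) := fun e => by
    have := congrArg U.ι.appTop.hom (h' e)
    rw [map_mul, map_mul] at this
    rw [coordOf_comp, coordOf_comp]
    exact this
  have hT' : ∀ e ∈ T.arrows, IsUnit (coordOf (U.ι ≫ m') e) := fun e he => by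
    have := (hT e he).mul (ht' e.right)
    rw [← hg] at this
    exact isUnit_of_mul_isUnit_left this
  rw [← Category.assoc, ← Category.assoc, T.comp_treeQuotient _ hT, T.comp_treeQuotient _ hT']
  have hb : baseOf (U.ι ≫ m') = baseOf (U.ι ≫ m) := by rw [baseOf_comp, baseOf_comp, h]
  rw [T.point_eq_of_gauge _ hT hT' (t := fun i => U.ι.appTop (t i)) ht' hg]
  congr 1
  exact hb.symm

/-- Near each point the morphism is described by some tree `T'`, for which the preimage of the chart
of `T` is known. -/
theorem RTree.comp_treeQuotient_preimage_chart (T : RTree o) (m : X ⟶ (treeLocus k o).toScheme) :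
    (m ≫ treeQuotient k o) ⁻¹ᵁ T.chart k = X.basicOpen (T.total (coordOf m)) := by
  ext p
  obtain ⟨T', hT'⟩ := exists_mem_basicOpen_total m p
  set U := X.basicOpen (T'.total (coordOf m)) with hU
  have hu : ∀ e ∈ T'.arrows, IsUnit (coordOf (U.ι ≫ m) e) := fun e he => by
    rw [coordOf_comp]
    exact isUnit_appTop_ι fun p hp => (T'.mem_basicOpen_total_iff _ p).1 hp e he
  have h1 := T'.point_preimage_chart T (baseOf (U.ι ≫ m)) _ hu
  rw [← T'.comp_treeQuotient] at h1
  have h2 : (T.total (coordOf (U.ι ≫ m))) = U.ι.appTop (T.total (coordOf m)) := by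
    change _ = U.ι.appTop.hom _
    rw [T.map_total]
    congr 1
  rw [h2, ← Scheme.preimage_basicOpen_top] at h1
  exact iff_of_eq (congrArg (fun O : U.toScheme.Opens => (⟨p, hT'⟩ : U) ∈ O) h1)

/-- Every point of a chart lifts to the tree locus with coordinates normalised to `1` on the tree.
Applied to the inclusion of the chart, this provides the local sections of the quotient. -/
theorem RTree.exists_eq_comp_treeQuotient (T : RTree o) (h : X ⟶ GQ k o)
    (hh : ∀ p, h p ∈ T.chart k) :
    ∃ m : X ⟶ (treeLocus k o).toScheme, (∀ e ∈ T.arrows, coordOf m e = 1) ∧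
      h = m ≫ treeQuotient k o := by
  obtain ⟨g, x, hx, rfl⟩ := T.exists_eq_point h hh
  obtain ⟨m, rfl, rfl⟩ := exists_hom_treeLocus (o := o) g x fun p => ⟨T, by
    rw [T.total_eq_one hx, Scheme.basicOpen_of_isUnit _ isUnit_one]; trivial⟩
  exact ⟨m, hx, (T.comp_treeQuotient m _).symm⟩

theorem comp_treeQuotient_toAffine (m : X ⟶ (treeLocus k o).toScheme) :
    (m ≫ treeQuotient k o) ≫ gitToAffine k inc (specialWeight o) =
      m ≫ (treeLocus k o).ι ≫ toAffineQuotient k inc := by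
  refine hom_ext_of_isUnit m fun U T hT => ?_
  rw [← Category.assoc, ← Category.assoc, T.comp_treeQuotient _ hT, T.point_toAffine,
    toAffineQuotient, ← Category.assoc, ← Category.assoc, ← toSpec_ofSpec ((U.ι ≫ m) ≫ _),
    toSpec_comp]
  congr 2
  exact MvPolynomial.ringHom_ext (fun c => by simp [baseOf]) fun e => by simp [coordOf]

theorem comp_treeQuotient_toBase (m : X ⟶ (treeLocus k o).toScheme) :
    (m ≫ treeQuotient k o) ≫ gitToBase k inc (specialWeight o) = toSpec (baseOf m) := by
  rw [gitToBase, ← Category.assoc, comp_treeQuotient_toAffine, toAffineQuotient, ← Category.assoc,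
    ← toSpec_ofSpec (m ≫ _), Category.assoc, ← Spec.map_comp, ← CommRingCat.ofHom_comp, toSpec_comp]
  rfl

end Quotient

/-! ### Pulling back functions -/

section Pull

variable {W W' X Y : Scheme.{u}}

/-- Pulling back functions on an open subset along a morphism that factors through it. -/
def pull (q : W ⟶ X) (U : X.Opens) (h : ∀ p, q p ∈ U) : Γ(X, U) →+* Γ(W, ⊤) :=
  (q.appLE U ⊤ fun p _ => h p).hom

theorem pull_comp (r : W' ⟶ W) (q : W ⟶ X) (U : X.Opens) (h : ∀ p, q p ∈ U) (h' : ∀ p, (r ≫ q) p ∈ U)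
    (f : Γ(X, U)) : pull (r ≫ q) U h' f = r.appTop (pull q U h f) := by
  have := Scheme.Hom.appLE_comp_appLE r q U ⊤ ⊤ (fun p _ => h p) le_rfl
  rw [show r.appLE ⊤ ⊤ le_rfl = r.appTop from Scheme.Hom.appLE_eq_app r] at this
  exact (congr($this f)).symm

theorem pull_appLE (r : W ⟶ X) (q : X ⟶ Y) (U : Y.Opens) (V : X.Opens) (e : V ≤ q ⁻¹ᵁ U)
    (h : ∀ p, r p ∈ V) (h' : ∀ p, (r ≫ q) p ∈ U) (f : Γ(Y, U)) :
    pull r V h (q.appLE U V e f) = pull (r ≫ q) U h' f :=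
  congr($(Scheme.Hom.appLE_comp_appLE r q U V ⊤ e (fun p _ => h p)) f)

theorem pull_app (r : W ⟶ X) (q : X ⟶ Y) (U : Y.Opens) (h : ∀ p, r p ∈ q ⁻¹ᵁ U)
    (h' : ∀ p, (r ≫ q) p ∈ U) (f : Γ(Y, U)) :
    pull r (q ⁻¹ᵁ U) h (q.app U f) = pull (r ≫ q) U h' f := by
  rw [← pull_appLE r q U (q ⁻¹ᵁ U) le_rfl h h', Scheme.Hom.appLE_eq_app]

theorem pull_map (q : W ⟶ X) {U V : X.Opens} (i : V ≤ U) (h : ∀ p, q p ∈ V) (f : Γ(X, U)) :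
    pull q V h (X.presheaf.map (homOfLE i).op f) = pull q U (fun p => i (h p)) f :=
  congr($(Scheme.Hom.map_appLE q (fun p _ => h p) (homOfLE i).op) f)

theorem pull_congr {q q' : W ⟶ X} (e : q = q') (U : X.Opens) (h : ∀ p, q p ∈ U)
    (h' : ∀ p, q' p ∈ U) (f : Γ(X, U)) : pull q U h f = pull q' U h' f := by
  subst e; rfl

theorem ι_mem (U : X.Opens) (p : U.toScheme) : U.ι p ∈ U := p.2

theorem pull_ι_bijective (U : X.Opens) : Function.Bijective (pull U.ι U (ι_mem U)) := by
  have h : U.ι.appLE U ⊤ (fun p _ => ι_mem U p) = U.topIso.inv :=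
    (Scheme.Opens.ι_appLE U U ⊤ _).trans rfl
  have h2 := ConcreteCategory.bijective_of_isIso U.topIso.inv
  rw [← h] at h2
  exact h2

theorem section_ext {U : X.Opens} {f g : Γ(X, U)}
    (h : ∀ p ∈ U, ∃ V : X.Opens, p ∈ V ∧ ∃ hV : ∀ p : V.toScheme, V.ι p ∈ U, pull V.ι U hV f = pull V.ι U hV g) :
    f = g := by
  choose! V hp hV h using h
  refine X.sheaf.eq_of_locally_eq' (fun p : U => V p.1) U
    (fun p => homOfLE fun x hx => hV p.1 p.2 ⟨x, hx⟩)
    (fun p hp' => TopologicalSpace.Opens.mem_iSup.2 ⟨⟨p, hp'⟩, hp p hp'⟩) f g fun p => ?_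
  apply (pull_ι_bijective (V p.1)).1
  have := h p.1 p.2
  exact (pull_map _ _ _ _).trans (this.trans (pull_map _ _ _ _).symm)

theorem exists_section_glue {ι : Type*} (V : ι → X.Opens) (U : X.Opens) (hVU : ∀ i, V i ≤ U)
    (hU : ∀ p ∈ U, ∃ i, p ∈ V i) (f : ∀ i, Γ((V i).toScheme, ⊤))
    (h : ∀ i j (W : Scheme.{u}) (a : W ⟶ (V i).toScheme) (b : W ⟶ (V j).toScheme),
      a ≫ (V i).ι = b ≫ (V j).ι → a.appTop (f i) = b.appTop (f j)) :
    ∃ s : Γ(X, U), ∀ i, pull (V i).ι U (fun p => hVU i (ι_mem _ p)) s = f i := by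
  choose g hg using fun i => (pull_ι_bijective (V i)).2 (f i)
  obtain ⟨s, hs, -⟩ := TopCat.Sheaf.existsUnique_gluing' X.sheaf V U (fun i => homOfLE (hVU i))
    (fun p hp => TopologicalSpace.Opens.mem_iSup.2 (hU p hp)) g fun i j => by
      apply (pull_ι_bijective (V i ⊓ V j)).1
      refine (pull_map _ _ _ _).trans (Eq.trans ?_ (pull_map _ _ _ _).symm)
      let a : (V i ⊓ V j).toScheme ⟶ (V i).toScheme := X.homOfLE inf_le_left
      let b : (V i ⊓ V j).toScheme ⟶ (V j).toScheme := X.homOfLE inf_le_right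
      have ha : a ≫ (V i).ι = (V i ⊓ V j).ι := X.homOfLE_ι _
      have hb : b ≫ (V j).ι = (V i ⊓ V j).ι := X.homOfLE_ι _
      have := h i j _ a b (ha.trans hb.symm)
      rw [← hg, ← hg, ← pull_comp a (V i).ι (V i) _ (fun p => ι_mem _ (a p)),
        ← pull_comp b (V j).ι (V j) _ (fun p => ι_mem _ (b p))] at this
      rw [pull_congr ha.symm _ _ (fun p => ι_mem _ (a p)), pull_congr hb.symm _ _ (fun p => ι_mem _ (b p))]
      exact this
  refine ⟨s, fun i => ?_⟩
  rw [← hg, ← hs i]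
  exact (pull_map _ _ _ _).symm

end Pull

/-! ### The torus action on the tree locus. -/

section Action

variable {V : Type} [Quiver.{0} V] [Fintype V] [DecidableEq V] {k : Type u} [Field k] {o : V}
  {X : Scheme.{u}}

/-- The product of the torus and the complement of the locus of the tree ideal. -/
abbrev TorusProd (k : Type u) [Field k] (o : V) : Scheme.{u} :=
  Limits.pullback (torusToBase k V) ((treeLocus k o).ι ≫ repSpaceToBase k V)

/-- The value of a character at a point of the torus. -/
def charAt (t : X ⟶ torus k V) (m : Wt V) : Γ(X, ⊤) := ofSpec t (AddMonoidAlgebra.single m 1)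

theorem charAt_add (t : X ⟶ torus k V) (m m' : Wt V) :
    charAt t (m + m') = charAt t m * charAt t m' := by
  rw [charAt, charAt, charAt, ← map_mul, AddMonoidAlgebra.single_mul_single, one_mul]

theorem isUnit_charAt (t : X ⟶ torus k V) (m : Wt V) : IsUnit (charAt t m) := by
  refine IsUnit.of_mul_eq_one (charAt t (-m)) ?_
  rw [← charAt_add, add_neg_cancel, charAt, ← AddMonoidAlgebra.one_def, map_one]

theorem baseOf_eq (m : X ⟶ (treeLocus k o).toScheme) :
    baseOf m = ofSpec (m ≫ (treeLocus k o).ι ≫ repSpaceToBase k V) := by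
  rw [repSpaceToBase, ← Category.assoc, ofSpec_comp_map]
  rfl

/-- The coaction read on points: the coordinate at `e` is multiplied by the value of the character
`inc e`. -/
theorem ofSpec_restrictedAction (r : X ⟶ TorusProd k o) :
    ofSpec (r ≫ restrictedAction k (treeLocus k o)) =
      MvPolynomial.eval₂Hom (baseOf (r ≫ Limits.pullback.snd _ _)) fun e =>
        charAt (r ≫ Limits.pullback.fst _ _) (inc e) *
          coordOf (r ≫ Limits.pullback.snd _ _) e := by
  have h1 : ∀ (m : X ⟶ Limits.pullback (torusToBase k V) (repSpaceToBase k V))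
      (a : TorusRing k V) (b : CoordRing k V),
      ofSpec (m ≫ (pullbackSpecIso k (TorusRing k V) (CoordRing k V)).hom) (a ⊗ₜ b) =
        ofSpec (m ≫ Limits.pullback.fst _ _) a * ofSpec (m ≫ Limits.pullback.snd _ _) b := by
    intro m a b
    rw [← pullbackSpecIso_hom_fst, ← pullbackSpecIso_hom_snd, ← Category.assoc, ofSpec_comp_map,
      ← Category.assoc, ofSpec_comp_map, RingHom.comp_apply, RingHom.comp_apply, ← map_mul]
    congr 1
    change _ = (a ⊗ₜ[k] (1 : CoordRing k V)) * ((1 : TorusRing k V) ⊗ₜ[k] b)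
    rw [Algebra.TensorProduct.tmul_mul_tmul, one_mul, mul_one]
  rw [restrictedAction, action, ← Category.assoc, ← Category.assoc, ofSpec_comp_map]
  set l : TorusProd k o ⟶ Limits.pullback (torusToBase k V) (repSpaceToBase k V) :=
    Limits.pullback.lift (Limits.pullback.fst _ _) (Limits.pullback.snd _ _ ≫
      (treeLocus k o).ι) _ with hl
  have hl1 : l ≫ Limits.pullback.fst _ _ = Limits.pullback.fst _ _ := Limits.pullback.lift_fst _ _ _
  have hl2 : l ≫ Limits.pullback.snd _ _ = Limits.pullback.snd _ _ ≫ (treeLocus k o).ι :=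
    Limits.pullback.lift_snd _ _ _
  refine MvPolynomial.ringHom_ext (fun c => ?_) fun e => ?_
  · rw [MvPolynomial.coe_eval₂Hom, MvPolynomial.eval₂_C, RingHom.comp_apply]
    have : (coaction k V).toRingHom (MvPolynomial.C c) =
        (1 : TorusRing k V) ⊗ₜ[k] (MvPolynomial.C c : CoordRing k V) := by
      change coaction k V (algebraMap k _ c) = _
      rw [AlgHom.commutes, Algebra.TensorProduct.algebraMap_apply']
      rfl
    rw [this, h1, map_one, one_mul, Category.assoc, hl2]
    rfl
  · rw [MvPolynomial.coe_eval₂Hom, MvPolynomial.eval₂_X, RingHom.comp_apply]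
    have : (coaction k V).toRingHom (MvPolynomial.X e) =
        AddMonoidAlgebra.single (inc e) 1 ⊗ₜ[k] (MvPolynomial.X e : CoordRing k V) :=
      MvPolynomial.aeval_X _ _
    rw [this, h1, Category.assoc, hl1, Category.assoc, hl2]
    rfl

/-- Values of characters are units, so the action does not change which tree products are
invertible, and the tree locus is preserved. -/
theorem exists_treeAction (k : Type u) [Field k] (o : V) :
    ∃ a : TorusProd k o ⟶ (treeLocus k o).toScheme,
      baseOf a = baseOf (Limits.pullback.snd _ _ : TorusProd k o ⟶ _) ∧
      coordOf a = fun e => charAt (Limits.pullback.fst _ _ : TorusProd k o ⟶ _) (inc e) *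
        coordOf (Limits.pullback.snd _ _ : TorusProd k o ⟶ _) e := by
  refine exists_hom_treeLocus _ _ fun p => ?_
  obtain ⟨T, hT⟩ := exists_mem_basicOpen_total (Limits.pullback.snd _ _ : TorusProd k o ⟶ _) p
  refine ⟨T, ?_⟩
  rw [T.mem_basicOpen_total_iff] at hT ⊢
  intro e he
  rw [Scheme.basicOpen_mul, Scheme.basicOpen_of_isUnit _ (isUnit_charAt _ _), top_inf_eq]
  exact hT e he

/-- The action of the torus on the complement of the locus of the tree ideal. -/
def treeAction (k : Type u) [Field k] (o : V) : TorusProd k o ⟶ (treeLocus k o).toScheme :=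
  (exists_treeAction k o).choose

theorem baseOf_comp_treeAction (r : X ⟶ TorusProd k o) :
    baseOf (r ≫ treeAction k o) = baseOf (r ≫ Limits.pullback.snd _ _) := by
  rw [baseOf_comp, baseOf_comp, treeAction, (exists_treeAction k o).choose_spec.1]

theorem coordOf_comp_treeAction (r : X ⟶ TorusProd k o) (e : Quiver.Total V) :
    coordOf (r ≫ treeAction k o) e = charAt (r ≫ Limits.pullback.fst _ _) (inc e) *
      coordOf (r ≫ Limits.pullback.snd _ _) e := by
  rw [coordOf_comp, coordOf_comp, treeAction, (exists_treeAction k o).choose_spec.2, charAt,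
    ofSpec_comp]
  exact map_mul r.appTop.hom _ _

theorem treeAction_ι : treeAction k o ≫ (treeLocus k o).ι =
    restrictedAction k (treeLocus k o) := by
  rw [← toSpec_ofSpec (treeAction k o ≫ _), ← toSpec_ofSpec (restrictedAction k _)]
  congr 1
  have h := ofSpec_restrictedAction (𝟙 (TorusProd k o))
  rw [Category.id_comp] at h
  rw [h]
  refine MvPolynomial.ringHom_ext (fun c => ?_) fun e => ?_
  · rw [MvPolynomial.coe_eval₂Hom, MvPolynomial.eval₂_C, ← baseOf_comp_treeAction,
      Category.id_comp]
    rfl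
  · rw [MvPolynomial.coe_eval₂Hom, MvPolynomial.eval₂_X, ← coordOf_comp_treeAction,
      Category.id_comp]
    rfl

/-- The torus acts by the gauge transformation whose entry at `i` is the character `χ_i - χ_o`. -/
theorem comp_treeAction_treeQuotient :
    treeAction k o ≫ treeQuotient k o = Limits.pullback.snd _ _ ≫ treeQuotient k o := by
  refine (comp_treeQuotient_eq_of_gauge (t := fun i => charAt (Limits.pullback.fst _ _) (chi o i))
    ?_ (fun i => isUnit_charAt _ _) fun e => ?_).symm
  · have := baseOf_comp_treeAction (𝟙 (TorusProd k o))
    rw [Category.id_comp, Category.id_comp] at this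
    exact this.symm
  · have := coordOf_comp_treeAction (𝟙 (TorusProd k o)) e
    rw [Category.id_comp, Category.id_comp, Category.id_comp] at this
    rw [this, mul_right_comm, ← charAt_add, inc_add_chi, mul_comm]

/-- Two points with the same image in the quotient differ by a point of the torus, if the
coordinates along a spanning tree are invertible. -/
theorem RTree.exists_torus_point (T : RTree o) (m m' : X ⟶ (treeLocus k o).toScheme)
    (h : m ≫ treeQuotient k o = m' ≫ treeQuotient k o) (hm : ∀ e ∈ T.arrows, IsUnit (coordOf m e)) :
    ∃ r : X ⟶ TorusProd k o, r ≫ treeAction k o = m ∧ r ≫ Limits.pullback.snd _ _ = m' := by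
  have hm' : ∀ e ∈ T.arrows, IsUnit (coordOf m' e) := by
    rw [← T.isUnit_total_iff]
    apply isUnit_of_basicOpen_eq
    rw [← T.comp_treeQuotient_preimage_chart, ← h, T.comp_treeQuotient_preimage_chart]
    exact Scheme.basicOpen_of_isUnit _ (T.isUnit_total_iff.2 hm)
  have hb : baseOf m = baseOf m' := by
    rw [← ofSpec_toSpec (baseOf m), ← comp_treeQuotient_toBase, h, comp_treeQuotient_toBase,
      ofSpec_toSpec]
  have hc := h
  rw [T.comp_treeQuotient _ hm, T.comp_treeQuotient _ hm', T.point_eq_iff] at hc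
  have hp := T.isUnit_pathProd hm
  have hp' := T.isUnit_pathProd hm'
  -- The ratio at `i` of the products of the coordinates of `m` and of `m'` along the tree. Since
  -- both points have the same chart coordinates, the character built from these ratios carries `m'`
  -- to `m`.
  let t : V → Γ(X, ⊤)ˣ := fun i => (hp i).unit * (hp' i).unit⁻¹
  have ht : ∀ i, (t i : Γ(X, ⊤)) * pathProd (coordOf m') (T.path i) =
      pathProd (coordOf m) (T.path i) := fun i => by
    change ((hp i).unit * (hp' i).unit⁻¹ : Γ(X, ⊤)ˣ).1 * ((hp' i).unit : Γ(X, ⊤)) = (hp i).unit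
    rw [← Units.val_mul, inv_mul_cancel_right]
  let τ : X ⟶ torus k V := toSpec (AddMonoidAlgebra.liftNCRingHom (baseOf m') (charOfUnits t)
    fun _ _ => Commute.all _ _)
  have hτ : ∀ w, charAt τ w = charOfUnits t (.ofAdd w) := fun w => by
    rw [charAt, ofSpec_toSpec]
    refine (AddMonoidAlgebra.liftNC_single _ _ _ _).trans ?_
    simp
  have hτb : ofSpec (τ ≫ torusToBase k V) = baseOf m' := by
    rw [torusToBase, ofSpec_comp_map, ofSpec_toSpec]
    refine RingHom.ext fun c => ?_
    refine (AddMonoidAlgebra.liftNC_single _ _ _ _).trans ?_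
    simp
  let r : X ⟶ TorusProd k o := Limits.pullback.lift τ m' (by
    rw [← toSpec_ofSpec (τ ≫ _), hτb, baseOf_eq, toSpec_ofSpec])
  have hr1 : r ≫ Limits.pullback.fst _ _ = τ := Limits.pullback.lift_fst _ _ _
  have hr2 : r ≫ Limits.pullback.snd _ _ = m' := Limits.pullback.lift_snd _ _ _
  refine ⟨r, treeLocus_hom_ext ?_ fun e => ?_, hr2⟩
  · rw [baseOf_comp_treeAction, hr2, hb]
  · rw [coordOf_comp_treeAction, hr1, hr2, hτ]
    have e1 := T.evalChart_coord_mul (baseOf m) _ hm e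
    have e2 := T.evalChart_coord_mul (baseOf m') _ hm' e
    rw [hc] at e1
    set z := T.evalChart (baseOf m') (coordOf m') hm' (T.coord k e)
    have e3 := charOfUnits_inc_mul t e
    refine ((t e.left).isUnit.mul (hp' e.left)).mul_right_cancel ?_
    calc charOfUnits t (.ofAdd (inc e)) * coordOf m' e * (t e.left * pathProd (coordOf m') (T.path e.left))
        = charOfUnits t (.ofAdd (inc e)) * t e.left * (coordOf m' e * pathProd (coordOf m') (T.path e.left)) := by ring
      _ = z * (t e.right * pathProd (coordOf m') (T.path e.right)) := by rw [e3, ← e2]; ring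
      _ = _ := by rw [ht, ht, e1]

end Action

/-! ### Morphisms with local sections -/

section LocalSections

variable {X Y : Scheme.{u}} (φ : X ⟶ Y) {ι : Type*} (C : ι → Y.Opens)
  (s : ∀ i, (C i).toScheme ⟶ X)

theorem app_injective_of_sections (hC : ∀ p, ∃ i, p ∈ C i) (hs : ∀ i, s i ≫ φ = (C i).ι)
    (U : Y.Opens) : Function.Injective (φ.app U) := by
  intro f g hfg
  refine section_ext fun p hp => ?_
  obtain ⟨i, hi⟩ := hC p
  let j : (U ⊓ C i).toScheme ⟶ (C i).toScheme := Y.homOfLE inf_le_right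
  have hj : (U ⊓ C i).ι = (j ≫ s i) ≫ φ := by rw [Category.assoc, hs, Scheme.homOfLE_ι]
  have h1 : ∀ x, (U ⊓ C i).ι x ∈ U := fun x => (ι_mem _ x).1
  have h2 : ∀ x, ((j ≫ s i) ≫ φ) x ∈ U := hj ▸ h1
  refine ⟨U ⊓ C i, ⟨hp, hi⟩, h1, ?_⟩
  rw [pull_congr hj U h1 h2, pull_congr hj U h1 h2, ← pull_app _ φ U h2 h2, ← pull_app _ φ U h2 h2,
    hfg]

theorem surjective_of_sections (hC : ∀ p, ∃ i, p ∈ C i) (hs : ∀ i, s i ≫ φ = (C i).ι) :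
    Function.Surjective φ := by
  intro p
  obtain ⟨i, hi⟩ := hC p
  let p' : (C i).toScheme := ⟨p, hi⟩
  exact ⟨s i p', (congrArg (fun q : (C i).toScheme ⟶ Y => q p') (hs i)).trans rfl⟩

/-- Over `C i` a subset of `Y` is recovered as the preimage under `s i` of its preimage in `X`, so
openness descends. -/
theorem isQuotientMap_of_sections (hC : ∀ p, ∃ i, p ∈ C i) (hs : ∀ i, s i ≫ φ = (C i).ι) :
    Topology.IsQuotientMap φ := by
  have key : ∀ i (x : (C i).toScheme), φ (s i x) = (C i).ι x := fun i x =>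
    congrArg (fun q : (C i).toScheme ⟶ Y => q x) (hs i)
  rw [Topology.isQuotientMap_iff_isClosed]
  refine ⟨surjective_of_sections φ C s hC hs, fun S => ⟨fun h => h.preimage φ.continuous,
    fun h => ?_⟩⟩
  rw [← isOpen_compl_iff] at h ⊢
  rw [isOpen_iff_forall_mem_open]
  intro p hp
  obtain ⟨i, hi⟩ := hC p
  refine ⟨(C i).ι '' (s i ⁻¹' (φ ⁻¹' S)ᶜ), ?_,
    (C i).ι.isOpenEmbedding.isOpenMap _ (h.preimage (s i).continuous), ⟨p, hi⟩, ?_, rfl⟩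
  · rintro _ ⟨x, hx, rfl⟩
    rw [← key]
    exact hx
  · have h1 : φ (s i ⟨p, hi⟩) = p := key i _
    exact fun h2 => hp (h1 ▸ h2)

/-- The function on `Y` is glued from the pullbacks of `f` along the sections. The hypothesis `key`,
that `f` agrees at a point of a section and any other point of the same fibre, gives both the
compatibility and, comparing `x` with `s i (φ x)`, the fact that the result pulls back to `f`. -/
theorem exists_app_eq_of_sections (hC : ∀ p, ∃ i, p ∈ C i) (hs : ∀ i, s i ≫ φ = (C i).ι)
    (U : Y.Opens) (f : Γ(X, φ ⁻¹ᵁ U))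
    (key : ∀ (W : Scheme.{u}) (i : ι) (a : W ⟶ (C i).toScheme) (b : W ⟶ X)
      (_ : (a ≫ s i) ≫ φ = b ≫ φ) (ha : ∀ p, (a ≫ s i) p ∈ φ ⁻¹ᵁ U)
      (hb : ∀ p, b p ∈ φ ⁻¹ᵁ U), pull (a ≫ s i) _ ha f = pull b _ hb f) :
    ∃ g, φ.app U g = f := by
  let j : ∀ i, (U ⊓ C i).toScheme ⟶ (C i).toScheme := fun i => Y.homOfLE inf_le_right
  have hj : ∀ i, (j i ≫ s i) ≫ φ = (U ⊓ C i).ι := fun i => by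
    rw [Category.assoc, hs, Scheme.homOfLE_ι]
  have hjU : ∀ i p, (j i ≫ s i) p ∈ φ ⁻¹ᵁ U := fun i p => by
    have h1 : (U ⊓ C i).ι p ∈ U := (ι_mem _ p).1
    rw [← hj] at h1
    exact h1
  obtain ⟨g, hg⟩ := exists_section_glue (fun i => U ⊓ C i) U (fun _ => inf_le_left)
    (fun p hp => let ⟨i, hi⟩ := hC p; ⟨i, hp, hi⟩)
    (fun i => pull (j i ≫ s i) _ (hjU i) f) fun i i' W a b hab => by
      have ha : ∀ p, (a ≫ j i ≫ s i) p ∈ φ ⁻¹ᵁ U := fun p => hjU i (a p)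
      have hb : ∀ p, (b ≫ j i' ≫ s i') p ∈ φ ⁻¹ᵁ U := fun p => hjU i' (b p)
      rw [← pull_comp _ _ _ _ ha, ← pull_comp _ _ _ _ hb]
      refine (pull_congr (Category.assoc _ _ _).symm _ ha ha f).trans
        (key W i (a ≫ j i) (b ≫ j i' ≫ s i') ?_ ha hb)
      have e1 := congrArg (a ≫ ·) (hj i)
      have e2 := congrArg (b ≫ ·) (hj i')
      simp only [Category.assoc] at e1 e2 ⊢
      rw [e1, hab, e2]
  refine ⟨g, section_ext fun p hp => ?_⟩
  obtain ⟨i, hi⟩ := hC (φ p)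
  let W := φ ⁻¹ᵁ (U ⊓ C i)
  have hW : ∀ x, (W.ι ≫ φ) x ∈ U := fun x => (ι_mem W x).1
  have hW' : ∀ x, W.ι x ∈ φ ⁻¹ᵁ U := fun x => (ι_mem W x).1
  refine ⟨W, ⟨hp, hi⟩, hW', ?_⟩
  rw [pull_app _ _ _ _ hW]
  let c : W.toScheme ⟶ (U ⊓ C i).toScheme := φ ∣_ (U ⊓ C i)
  have hc : c ≫ (U ⊓ C i).ι = W.ι ≫ φ := morphismRestrict_ι _ _
  have h0 : ∀ x, (U ⊓ C i).ι x ∈ U := fun x => (ι_mem _ x).1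
  have hc' : ∀ x, (c ≫ (U ⊓ C i).ι) x ∈ U := fun x => h0 (c x)
  have hcj : ∀ x, (c ≫ j i ≫ s i) x ∈ φ ⁻¹ᵁ U := fun x => hjU i (c x)
  rw [pull_congr hc.symm _ _ hc', pull_comp c _ _ h0, hg, ← pull_comp _ _ _ _ hcj]
  refine (pull_congr (Category.assoc _ _ _).symm _ hcj hcj f).trans (key _ i (c ≫ j i) _ ?_ _ _)
  have e1 := congrArg (c ≫ ·) (hj i)
  simp only [Category.assoc] at e1 ⊢
  rw [e1, hc]

theorem appLE_app_eq_app_app {P : Scheme.{u}} {a p : P ⟶ X} (h : a ≫ φ = p ≫ φ) (U : Y.Opens)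
    (e : p ⁻¹ᵁ φ ⁻¹ᵁ U ≤ a ⁻¹ᵁ φ ⁻¹ᵁ U) (g : Γ(Y, U)) :
    a.appLE (φ ⁻¹ᵁ U) (p ⁻¹ᵁ φ ⁻¹ᵁ U) e (φ.app U g) = p.app (φ ⁻¹ᵁ U) (φ.app U g) := by
  have h1 : φ.app U ≫ a.appLE (φ ⁻¹ᵁ U) (p ⁻¹ᵁ φ ⁻¹ᵁ U) e =
      φ.app U ≫ p.appLE (φ ⁻¹ᵁ U) (p ⁻¹ᵁ φ ⁻¹ᵁ U) le_rfl := by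
    have h2 := Scheme.Hom.appLE_comp_appLE a φ U (φ ⁻¹ᵁ U) (p ⁻¹ᵁ φ ⁻¹ᵁ U) le_rfl e
    have h3 := Scheme.Hom.appLE_comp_appLE p φ U (φ ⁻¹ᵁ U) (p ⁻¹ᵁ φ ⁻¹ᵁ U) le_rfl le_rfl
    rw [Scheme.Hom.appLE_eq_app] at h2 h3
    rw [h2, h3]
    simp only [h]
  rw [Scheme.Hom.appLE_eq_app] at h1
  exact congr($h1 g)

theorem pull_eq_pull_of_appLE_eq_app {P W : Scheme.{u}} {a p : P ⟶ X} (U : X.Opens)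
    (e : p ⁻¹ᵁ U ≤ a ⁻¹ᵁ U) {f : Γ(X, U)} (h : a.appLE U (p ⁻¹ᵁ U) e f = p.app U f) (r : W ⟶ P)
    (h1 : ∀ x, (r ≫ a) x ∈ U) (h2 : ∀ x, (r ≫ p) x ∈ U) :
    pull (r ≫ a) U h1 f = pull (r ≫ p) U h2 f :=
  (pull_appLE r _ _ _ e h2 h1 f).symm.trans ((congrArg (pull r _ h2) h).trans (pull_app r _ _ h2 h2 f))

end LocalSections

/-! ### The quotient morphism is a geometric quotient. -/

section Geometric

variable {V : Type} [Quiver.{0} V] [Fintype V] [DecidableEq V] {k : Type u} [Field k] {o : V}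
  {X : Scheme.{u}}

/-- The section over a chart of the quotient morphism whose coordinates are `1` on the tree. -/
def RTree.sec (k : Type u) [Field k] (T : RTree o) :
    (T.chart k).toScheme ⟶ (treeLocus k o).toScheme :=
  (T.exists_eq_comp_treeQuotient (T.chart k).ι (ι_mem _)).choose

theorem RTree.coordOf_sec (T : RTree o) {e : Quiver.Total V} (he : e ∈ T.arrows) :
    coordOf (T.sec k) e = 1 :=
  (T.exists_eq_comp_treeQuotient (T.chart k).ι (ι_mem _)).choose_spec.1 e he

theorem RTree.sec_comp (T : RTree o) : T.sec k ≫ treeQuotient k o = (T.chart k).ι :=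
  (T.exists_eq_comp_treeQuotient (T.chart k).ι (ι_mem _)).choose_spec.2.symm

theorem RTree.isUnit_coordOf_comp_sec (T : RTree o) (q : X ⟶ (T.chart k).toScheme)
    {e : Quiver.Total V} (he : e ∈ T.arrows) : IsUnit (coordOf (q ≫ T.sec k) e) := by
  rw [coordOf_comp, T.coordOf_sec he, map_one]
  exact isUnit_one

theorem treeQuotient_app_injective (U : (GQ k o).Opens) :
    Function.Injective ((treeQuotient k o).app U) :=
  app_injective_of_sections _ _ _ exists_mem_chart RTree.sec_comp U

theorem surjective_treeQuotient : Function.Surjective (treeQuotient k o) :=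
  surjective_of_sections _ _ _ exists_mem_chart RTree.sec_comp

/-- A point of a section has invertible coordinates along its tree, so any other point of the same
fibre differs from it by a torus point, and an invariant function takes the same value at both. -/
theorem exists_app_eq_of_invariant (U : (GQ k o).Opens)
    (f : Γ((treeLocus k o).toScheme, treeQuotient k o ⁻¹ᵁ U))
    (hf : ∀ (W : Scheme.{u}) (r : W ⟶ TorusProd k o)
      (h : ∀ p, (r ≫ treeAction k o) p ∈ treeQuotient k o ⁻¹ᵁ U)
      (h' : ∀ p, (r ≫ Limits.pullback.snd _ _) p ∈ treeQuotient k o ⁻¹ᵁ U),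
      pull (r ≫ treeAction k o) _ h f = pull (r ≫ Limits.pullback.snd _ _) _ h' f) :
    ∃ g, (treeQuotient k o).app U g = f := by
  refine exists_app_eq_of_sections _ _ _ exists_mem_chart RTree.sec_comp U f
    fun W T a b h ha hb => ?_
  obtain ⟨r, h1, h2⟩ := T.exists_torus_point _ _ h fun e he => T.isUnit_coordOf_comp_sec a he
  have h1' : ∀ p, (r ≫ treeAction k o) p ∈ treeQuotient k o ⁻¹ᵁ U := by rw [h1]; exact ha
  have h2' : ∀ p, (r ≫ Limits.pullback.snd _ _) p ∈ treeQuotient k o ⁻¹ᵁ U := by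
    rw [h2]; exact hb
  rw [pull_congr h1.symm _ _ h1', pull_congr h2.symm _ _ h2']
  exact hf W r _ _

/-- A point of the fibre product gives two points with the same image over its residue field. Over a
field some tree has invertible coordinates everywhere, so the two differ by a torus point over that
same field. -/
theorem surjective_orbits : Function.Surjective (Limits.pullback.lift (treeAction k o)
    (Limits.pullback.snd _ _) (comp_treeAction_treeQuotient (k := k) (o := o))) := by
  intro z
  let q := (Limits.pullback (treeQuotient k o) (treeQuotient k o)).fromSpecResidueField z
  let K := (Limits.pullback (treeQuotient k o) (treeQuotient k o)).residueField z
  let x : Spec K := (default : PrimeSpectrum K)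
  obtain ⟨T, hT⟩ := exists_mem_basicOpen_total (q ≫ Limits.pullback.fst _ _) x
  have hu : ∀ e ∈ T.arrows, IsUnit (coordOf (q ≫ Limits.pullback.fst _ _) e) := by
    rw [← T.isUnit_total_iff]
    apply isUnit_of_basicOpen_eq
    rw [eq_top_iff]
    intro y _
    have : y = x := Subsingleton.elim (α := PrimeSpectrum K) _ _
    rwa [this]
  obtain ⟨r, h1, h2⟩ := T.exists_torus_point (q ≫ Limits.pullback.fst _ _)
    (q ≫ Limits.pullback.snd _ _) (by simp only [Category.assoc, Limits.pullback.condition]) hu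
  refine ⟨r x, ?_⟩
  rw [← Scheme.Hom.comp_apply]
  have : r ≫ Limits.pullback.lift (treeAction k o)
      (Limits.pullback.snd _ _) (comp_treeAction_treeQuotient (k := k) (o := o)) = q := by
    apply Limits.pullback.hom_ext
    · rw [Category.assoc, Limits.pullback.lift_fst, h1]
    · rw [Category.assoc, Limits.pullback.lift_snd, h2]
  rw [this]
  exact Scheme.fromSpecResidueField_apply _ _

theorem isGeometricQuotient_treeQuotient (k : Type u) [Field k] (o : V) :
    IsGeometricQuotient (treeAction k o) (Limits.pullback.snd _ _) (treeQuotient k o) where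
  comp_eq := comp_treeAction_treeQuotient
  surjective := ⟨surjective_treeQuotient⟩
  orbits := ⟨surjective_orbits⟩
  isQuotientMap := isQuotientMap_of_sections _ _ _ exists_mem_chart RTree.sec_comp
  injective := treeQuotient_app_injective
  invariant := by
    intro U h f
    constructor
    · intro hf
      exact exists_app_eq_of_invariant U f fun W r h1 h2 =>
        pull_eq_pull_of_appLE_eq_app _ h hf r h1 h2
    · rintro ⟨g, rfl⟩
      exact appLE_app_eq_app_app _ comp_treeAction_treeQuotient U h g

end Geometric

/-! ### Smoothness, integrality, separatedness and finite type. -/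

section Properties

variable {V : Type} [Quiver.{0} V] [Fintype V] [DecidableEq V] {k : Type u} [Field k] {o : V}

theorem RTree.chartι_toBase (T : RTree o) : T.chartι k ≫ gitToBase k inc (specialWeight o) =
    Spec.map (CommRingCat.ofHom (scalarAway k inc (specialWeight o) (T.denom k))) := by
  rw [gitToBase, gitToAffine, RTree.chartι]
  simp only [Category.assoc]
  rw [Proj.awayι_toSpecZero_assoc, ← Spec.map_comp, ← Spec.map_comp, ← CommRingCat.ofHom_comp,
    ← CommRingCat.ofHom_comp]
  rfl

/-- The cover of the quotient by the charts. -/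
def chartCover (k : Type u) [Field k] (o : V) : (GQ k o).OpenCover :=
  (GQ k o).openCoverOfIsOpenCover (fun T : RTree o => T.chart k) (by
    rw [TopologicalSpace.IsOpenCover, eq_top_iff]
    intro p _
    exact TopologicalSpace.Opens.mem_iSup.2 (exists_mem_chart p))

theorem RTree.exists_iso_chart (T : RTree o) :
    ∃ e : (T.chart k).toScheme ≅ Spec (.of (T.ChartRing k)), (T.chart k).ι = e.hom ≫ T.chartι k := by
  have h : Set.range (T.chart k).ι = Set.range (T.chartι k) := by
    rw [Scheme.Opens.range_ι, ← T.opensRange_chartι]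
    rfl
  exact ⟨IsOpenImmersion.isoOfRangeEq _ _ h, (IsOpenImmersion.isoOfRangeEq_hom_fac _ _ h).symm⟩

theorem RTree.smooth_chart (T : RTree o) [Finite (Quiver.Total V)] :
    Smooth ((T.chart k).ι ≫ gitToBase k inc (specialWeight o)) := by
  obtain ⟨e, he⟩ := T.exists_iso_chart (k := k)
  rw [he, Category.assoc, T.chartι_toBase]
  have : Smooth (Spec.map (CommRingCat.ofHom (scalarAway k inc (specialWeight o) (T.denom k)))) := by
    rw [HasRingHomProperty.Spec_iff (P := @Smooth), CommRingCat.hom_ofHom]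
    have h : (T.polyToChart k).comp MvPolynomial.C =
        scalarAway k inc (specialWeight o) (T.denom k) :=
      RingHom.ext fun c => MvPolynomial.eval₂_C _ _ _
    rw [← h]
    refine RingHom.Smooth.comp ?_ (RingHom.Smooth.of_bijective
      ⟨T.polyToChart_injective, T.polyToChart_surjective⟩)
    rw [← MvPolynomial.algebraMap_eq, RingHom.smooth_algebraMap]
    exact ⟨inferInstance, inferInstance⟩
  infer_instance

theorem smooth_gitToBase [Finite (Quiver.Total V)] :
    Smooth (gitToBase k inc (specialWeight o)) := by
  have : IsZariskiLocalAtSource @Smooth.{u} := HasRingHomProperty.instIsZariskiLocalAtSource (Q := RingHom.Smooth)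
  rw [IsZariskiLocalAtSource.iff_of_openCover (P := @Smooth) (chartCover k o)]
  exact fun T => RTree.smooth_chart T

instance [Nonempty (RTree o)] : Nonempty (treeLocus k o).toScheme := by
  obtain ⟨T⟩ := ‹Nonempty (RTree o)›
  let X := Spec (.of k)
  obtain ⟨m, -, -⟩ := exists_hom_treeLocus (k := k) (o := o) (X := X)
    -- The point with all coordinates `1` lies in the locus of every spanning tree.
    (Scheme.ΓSpecIso (.of k)).inv.hom (fun _ => 1) fun p => ⟨T, by
      rw [T.total_eq_one fun _ _ => rfl, Scheme.basicOpen_of_isUnit _ isUnit_one]; trivial⟩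
  exact ⟨m (default : PrimeSpectrum k)⟩

instance [Nonempty (RTree o)] : IsIntegral (treeLocus k o).toScheme :=
  isIntegral_of_isOpenImmersion (treeLocus k o).ι

/-- Functions on an open subset inject into the functions on its preimage, a nonempty open subset of
an integral scheme. -/
theorem isIntegral_gitQuotient [Nonempty (RTree o)] : IsIntegral (GQ k o) where
  nonempty := ⟨treeQuotient k o (Classical.arbitrary (treeLocus k o).toScheme)⟩
  component_integral U hU := by
    obtain ⟨p⟩ := hU
    obtain ⟨q, hq⟩ := surjective_treeQuotient p.1
    have : Nonempty (treeQuotient k o ⁻¹ᵁ U) := ⟨⟨q, by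
      change treeQuotient k o q ∈ U
      rw [hq]; exact p.2⟩⟩
    exact (treeQuotient_app_injective U).isDomain ((treeQuotient k o).app U).hom

theorem isSeparated_gitToBase : IsSeparated (gitToBase k inc (specialWeight o)) := by
  unfold gitToBase gitToAffine
  infer_instance

/-- The quotient is the continuous image of an open subset of a Noetherian affine space. -/
theorem quasiCompact_gitToBase [Finite (Quiver.Total V)] :
    QuasiCompact (gitToBase k inc (specialWeight o)) := by
  have : CompactSpace (treeLocus k o).toScheme := isCompact_iff_compactSpace.1
    (TopologicalSpace.NoetherianSpace.isCompact (α := PrimeSpectrum (CoordRing k V)) _)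
  have : CompactSpace (GQ k o) := by
    have := isCompact_range (treeQuotient k o).continuous
    rw [surjective_treeQuotient.range_eq] at this
    exact ⟨this⟩
  exact (quasiCompact_iff_compactSpace _).2 this

theorem locallyOfFiniteType_gitToBase [Finite (Quiver.Total V)] :
    LocallyOfFiniteType (gitToBase k inc (specialWeight o)) := by
  have := smooth_gitToBase (k := k) (o := o)
  infer_instance

end Properties

/-! ### Scaling the arrows independently, and its descent to the quotient. -/

section Twist

variable {V : Type} [Quiver.{0} V] [Fintype V] [DecidableEq V] {k : Type u} [Field k] {o : V}
  {X W : Scheme.{u}}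

/-- To check an equality of morphisms from a scheme over the quotient, one may assume
that the morphism to the quotient lifts. -/
theorem hom_ext_of_lift {Y : Scheme.{u}} (h : X ⟶ GQ k o) {f f' : X ⟶ Y}
    (H : ∀ (U : X.Opens) (m : U.toScheme ⟶ (treeLocus k o).toScheme),
      U.ι ≫ h = m ≫ treeQuotient k o → U.ι ≫ f = U.ι ≫ f') : f = f' := by
  refine hom_ext_opens fun p => ?_
  obtain ⟨T, hT⟩ := exists_mem_chart (h p)
  refine ⟨h ⁻¹ᵁ T.chart k, hT, H _ ((h ∣_ T.chart k) ≫ T.sec k) ?_⟩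
  rw [Category.assoc, T.sec_comp, morphismRestrict_ι]

theorem exists_scale (t : Quiver.Total V → Γ(X, ⊤)) (ht : ∀ e, IsUnit (t e))
    (m : X ⟶ (treeLocus k o).toScheme) :
    ∃ m' : X ⟶ (treeLocus k o).toScheme, baseOf m' = baseOf m ∧
      coordOf m' = fun e => t e * coordOf m e := by
  refine exists_hom_treeLocus _ _ fun p => ?_
  obtain ⟨T, hT⟩ := exists_mem_basicOpen_total m p
  refine ⟨T, ?_⟩
  rw [T.mem_basicOpen_total_iff] at hT ⊢
  intro e he
  rw [Scheme.basicOpen_mul, Scheme.basicOpen_of_isUnit _ (ht e), top_inf_eq]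
  exact hT e he

/-- The multiplication of the coordinates of a point by invertible functions. -/
def scale (t : Quiver.Total V → Γ(X, ⊤)) (ht : ∀ e, IsUnit (t e))
    (m : X ⟶ (treeLocus k o).toScheme) : X ⟶ (treeLocus k o).toScheme :=
  (exists_scale t ht m).choose

@[simp] theorem baseOf_scale (t : Quiver.Total V → Γ(X, ⊤)) (ht : ∀ e, IsUnit (t e))
    (m : X ⟶ (treeLocus k o).toScheme) : baseOf (scale t ht m) = baseOf m :=
  (exists_scale t ht m).choose_spec.1

@[simp] theorem coordOf_scale (t : Quiver.Total V → Γ(X, ⊤)) (ht : ∀ e, IsUnit (t e))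
    (m : X ⟶ (treeLocus k o).toScheme) (e : Quiver.Total V) :
    coordOf (scale t ht m) e = t e * coordOf m e :=
  congrFun (exists_scale t ht m).choose_spec.2 e

theorem comp_scale (t : Quiver.Total V → Γ(X, ⊤)) (ht : ∀ e, IsUnit (t e))
    (m : X ⟶ (treeLocus k o).toScheme) (q : W ⟶ X) :
    q ≫ scale t ht m = scale (fun e => q.appTop (t e)) (fun e => (ht e).map q.appTop.hom) (q ≫ m) :=
  treeLocus_hom_ext (by rw [baseOf_scale, baseOf_comp, baseOf_comp, baseOf_scale]) fun e => by
    rw [coordOf_scale, coordOf_comp, coordOf_comp, coordOf_scale]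
    exact map_mul q.appTop.hom _ _

/-- Scaling commutes with the torus action, and locally two points with the same image differ by
that action. -/
theorem scale_treeQuotient_congr (t : Quiver.Total V → Γ(X, ⊤)) (ht : ∀ e, IsUnit (t e))
    {m m' : X ⟶ (treeLocus k o).toScheme} (h : m ≫ treeQuotient k o = m' ≫ treeQuotient k o) :
    scale t ht m ≫ treeQuotient k o = scale t ht m' ≫ treeQuotient k o := by
  refine hom_ext_of_isUnit m fun U T hT => ?_
  obtain ⟨r, h1, h2⟩ := T.exists_torus_point (U.ι ≫ m) (U.ι ≫ m') (by
    rw [Category.assoc, Category.assoc, h]) hT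
  rw [← Category.assoc, ← Category.assoc, comp_scale, comp_scale, ← h1, ← h2]
  refine (comp_treeQuotient_eq_of_gauge (t := fun i => charAt (r ≫ Limits.pullback.fst _ _)
    (chi o i)) ?_ (fun i => isUnit_charAt _ _) fun e => ?_).symm
  · rw [baseOf_scale, baseOf_scale, baseOf_comp_treeAction]
  · rw [coordOf_scale, coordOf_scale, coordOf_comp_treeAction, ← inc_add_chi, charAt_add]
    ring

/-- The point of the quotient is lifted over each chart, scaled, and mapped back; independence of
the lift makes the results glue, and gives the formula for an arbitrary lift. -/
theorem exists_twist (t : Quiver.Total V → Γ(X, ⊤)) (ht : ∀ e, IsUnit (t e)) (h : X ⟶ GQ k o) :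
    ∃ h' : X ⟶ GQ k o, ∀ (W : Scheme.{u}) (q : W ⟶ X) (m : W ⟶ (treeLocus k o).toScheme),
      q ≫ h = m ≫ treeQuotient k o → q ≫ h' = scale (fun e => q.appTop (t e))
        (fun e => (ht e).map q.appTop.hom) m ≫ treeQuotient k o := by
  let U : RTree o → X.Opens := fun T => h ⁻¹ᵁ T.chart k
  let m : ∀ T, (U T).toScheme ⟶ (treeLocus k o).toScheme := fun T => (h ∣_ T.chart k) ≫ T.sec k
  have hm : ∀ T, (U T).ι ≫ h = m T ≫ treeQuotient k o := fun T => by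
    rw [Category.assoc, T.sec_comp, morphismRestrict_ι]
  let f : ∀ T, (U T).toScheme ⟶ GQ k o := fun T => scale (fun e => (U T).ι.appTop (t e))
    (fun e => (ht e).map (U T).ι.appTop.hom) (m T) ≫ treeQuotient k o
  have key : ∀ (W : Scheme.{u}) (T : RTree o) (a : W ⟶ (U T).toScheme) (q : W ⟶ X)
      (b : W ⟶ (treeLocus k o).toScheme), a ≫ (U T).ι = q → q ≫ h = b ≫ treeQuotient k o →
      a ≫ f T = scale (fun e => q.appTop (t e))
        (fun e => (ht e).map q.appTop.hom) b ≫ treeQuotient k o := by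
    rintro W T a q b rfl hq
    rw [Category.assoc, hm, ← Category.assoc] at hq
    rw [← scale_treeQuotient_congr _ _ hq, ← Category.assoc, comp_scale]
    congr 2
  obtain ⟨h', hh'⟩ := exists_glue_opens U (fun x => exists_mem_chart (h x)) f
    fun T T' W a b hab => by
      have e : (a ≫ (U T).ι) ≫ h = (a ≫ m T) ≫ treeQuotient k o := by
        rw [Category.assoc, Category.assoc, hm]
      rw [key W T a _ _ rfl e, key W T' b _ _ hab.symm e]
  refine ⟨h', fun W q b hq => hom_ext_opens fun p => ?_⟩
  obtain ⟨T, hT⟩ := exists_mem_chart (h (q p))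
  refine ⟨q ⁻¹ᵁ U T, hT, ?_⟩
  have e1 : q ∣_ U T ≫ (U T).ι = (q ⁻¹ᵁ U T).ι ≫ q := morphismRestrict_ι q (U T)
  rw [← Category.assoc, ← e1, Category.assoc, hh', key _ T _ _ ((q ⁻¹ᵁ U T).ι ≫ b) e1 (by
    rw [Category.assoc, hq, Category.assoc]), ← Category.assoc, comp_scale]
  congr 2

/-- The multiplication of a point of the quotient by invertible functions. -/
def twist (t : Quiver.Total V → Γ(X, ⊤)) (ht : ∀ e, IsUnit (t e)) (h : X ⟶ GQ k o) : X ⟶ GQ k o :=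
  (exists_twist t ht h).choose

theorem comp_twist_of_lift (t : Quiver.Total V → Γ(X, ⊤)) (ht : ∀ e, IsUnit (t e)) (h : X ⟶ GQ k o)
    (q : W ⟶ X) (m : W ⟶ (treeLocus k o).toScheme) (hq : q ≫ h = m ≫ treeQuotient k o) :
    q ≫ twist t ht h = scale (fun e => q.appTop (t e))
        (fun e => (ht e).map q.appTop.hom) m ≫ treeQuotient k o :=
  (exists_twist t ht h).choose_spec W q m hq

theorem twist_of_lift (t : Quiver.Total V → Γ(X, ⊤)) (ht : ∀ e, IsUnit (t e))
    (m : X ⟶ (treeLocus k o).toScheme) :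
    twist t ht (m ≫ treeQuotient k o) = scale t ht m ≫ treeQuotient k o := by
  have := comp_twist_of_lift t ht (m ≫ treeQuotient k o) (𝟙 X) m (Category.id_comp _)
  rw [Category.id_comp] at this
  rw [this]
  congr 2

theorem comp_twist (t : Quiver.Total V → Γ(X, ⊤)) (ht : ∀ e, IsUnit (t e)) (h : X ⟶ GQ k o)
    (q : W ⟶ X) : q ≫ twist t ht h =
      twist (fun e => q.appTop (t e)) (fun e => (ht e).map q.appTop.hom) (q ≫ h) := by
  refine hom_ext_of_lift (q ≫ h) fun U m hm => ?_
  rw [comp_twist_of_lift _ _ _ _ m hm, ← Category.assoc, comp_twist_of_lift _ _ h (U.ι ≫ q) m (by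
    rw [← hm, Category.assoc])]
  congr 2

theorem twist_one (h : X ⟶ GQ k o) : twist (fun _ => 1) (fun _ => isUnit_one) h = h := by
  refine hom_ext_of_lift h fun U m hm => ?_
  rw [comp_twist_of_lift _ _ _ _ m hm, hm]
  congr 1
  refine treeLocus_hom_ext (baseOf_scale _ _ _) fun e => ?_
  rw [coordOf_scale, map_one, one_mul]

theorem twist_twist (t t' : Quiver.Total V → Γ(X, ⊤)) (ht : ∀ e, IsUnit (t e))
    (ht' : ∀ e, IsUnit (t' e)) (h : X ⟶ GQ k o) :
    twist t ht (twist t' ht' h) = twist (fun e => t e * t' e) (fun e => (ht e).mul (ht' e)) h := by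
  refine hom_ext_of_lift h fun U m hm => ?_
  rw [comp_twist_of_lift _ _ _ _ _ (comp_twist_of_lift t' ht' h U.ι m hm),
    comp_twist_of_lift _ _ _ _ m hm]
  congr 1
  refine treeLocus_hom_ext (by simp only [baseOf_scale]) fun e => ?_
  rw [coordOf_scale, coordOf_scale, coordOf_scale, ← mul_assoc]
  congr 1
  exact (map_mul U.ι.appTop.hom _ _).symm

theorem twist_toBase (t : Quiver.Total V → Γ(X, ⊤)) (ht : ∀ e, IsUnit (t e)) (h : X ⟶ GQ k o) :
    twist t ht h ≫ gitToBase k inc (specialWeight o) = h ≫ gitToBase k inc (specialWeight o) := by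
  refine hom_ext_of_lift h fun U m hm => ?_
  rw [← Category.assoc, ← Category.assoc, comp_twist_of_lift _ _ _ _ m hm, hm,
    comp_treeQuotient_toBase, comp_treeQuotient_toBase, baseOf_scale]

theorem twist_congr {t t' : Quiver.Total V → Γ(X, ⊤)} (e : t = t') (ht : ∀ e, IsUnit (t e))
    (ht' : ∀ e, IsUnit (t' e)) {h h' : X ⟶ GQ k o} (eh : h = h') :
    twist t ht h = twist t' ht' h' := by
  subst e eh; rfl

end Twist

/-! ### The torus as an open subscheme of affine space. -/

section Laurent

/-- The inclusion of the ring of polynomials in the ring of Laurent polynomials. -/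
def polyToLaurent (k : Type u) [Field k] {σ : Type} {n : ℕ} (ε : σ ≃ Fin n) :
    MvPolynomial σ k →+* AddMonoidAlgebra k (Fin n → ℤ) :=
  MvPolynomial.eval₂Hom (algebraMap k _) fun s => AddMonoidAlgebra.single (Pi.single (ε s) 1) 1

variable {k : Type u} [Field k] {σ : Type} {n : ℕ} (ε : σ ≃ Fin n)

theorem single_nsmul_single (j : Fin n) (N : ℕ) :
    (AddMonoidAlgebra.single (Pi.single j 1) 1 : AddMonoidAlgebra k (Fin n → ℤ)) ^ N =
      AddMonoidAlgebra.single (N • Pi.single j 1) 1 := by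
  rw [AddMonoidAlgebra.single_pow, one_pow]

theorem exists_polyToLaurent_eq (m : Fin n → ℤ) (hm : ∀ i, 0 ≤ m i) (c : k) :
    ∃ a, polyToLaurent k ε a = AddMonoidAlgebra.single m c := by
  refine ⟨.C c * ∏ i, .X (ε.symm i) ^ (m i).toNat, ?_⟩
  rw [map_mul, map_prod]
  have h1 : ∀ i, polyToLaurent k ε (.X (ε.symm i) ^ (m i).toNat) =
      AddMonoidAlgebra.single ((m i).toNat • Pi.single i 1) 1 := fun i => by
    rw [map_pow, polyToLaurent, MvPolynomial.coe_eval₂Hom, MvPolynomial.eval₂_X,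
      Equiv.apply_symm_apply, single_nsmul_single]
  have h2 : ∀ s : Finset (Fin n), ∏ i ∈ s, (AddMonoidAlgebra.single ((m i).toNat • Pi.single i 1) 1 :
      AddMonoidAlgebra k (Fin n → ℤ)) =
        AddMonoidAlgebra.single (∑ i ∈ s, (m i).toNat • Pi.single i 1) 1 := fun s => by
    classical
    induction s using Finset.induction_on with
    | empty => rfl
    | insert a s ha ih =>
      rw [Finset.prod_insert ha, Finset.sum_insert ha, ih, AddMonoidAlgebra.single_mul_single,
        one_mul]
  have h3 : ∑ i, (m i).toNat • (Pi.single i 1 : Fin n → ℤ) = m := by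
    funext j
    rw [Finset.sum_apply, Finset.sum_eq_single j (fun i _ hi => by simp [hi.symm]) (by simp)]
    simp [hm]
  simp only [h1]
  rw [h2, h3, polyToLaurent, MvPolynomial.coe_eval₂Hom, MvPolynomial.eval₂_C,
    ← Algebra.smul_def, AddMonoidAlgebra.smul_single, smul_eq_mul, mul_one]

theorem polyToLaurent_prod [Fintype σ] :
    polyToLaurent k ε (∏ s, .X s) = AddMonoidAlgebra.single 1 1 := by
  classical
  have h2 : ∀ s : Finset σ, polyToLaurent k ε (∏ i ∈ s, .X i) =
        AddMonoidAlgebra.single (∑ i ∈ s, Pi.single (ε i) 1) 1 := fun s => by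
    induction s using Finset.induction_on with
    | empty => rw [Finset.prod_empty, map_one]; rfl
    | insert a s ha ih =>
      rw [Finset.prod_insert ha, Finset.sum_insert ha, map_mul, ih, polyToLaurent,
        MvPolynomial.coe_eval₂Hom, MvPolynomial.eval₂_X, AddMonoidAlgebra.single_mul_single,
        one_mul]
  rw [h2]
  congr 1
  rw [ε.sum_comp (fun j => (Pi.single j 1 : Fin n → ℤ))]
  funext j
  rw [Finset.sum_apply, Finset.sum_eq_single j (fun i _ hi => by simp [hi.symm]) (by simp)]
  simp

/-- Sending Laurent monomials to the corresponding products in the fraction field of the polynomial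
ring gives a homomorphism whose composite with this one is the inclusion in the fraction field. -/
theorem polyToLaurent_injective : Function.Injective (polyToLaurent k ε) := by
  let F := FractionRing (MvPolynomial σ k)
  let x : Fin n → Fˣ := fun i => Units.mk0 (algebraMap (MvPolynomial σ k) F (.X (ε.symm i))) (by
    rw [Ne, FaithfulSMul.algebraMap_eq_zero_iff]
    exact MvPolynomial.X_ne_zero _)
  let χ : Multiplicative (Fin n → ℤ) →* F := (Units.coeHom F).comp
    { toFun := fun m => ∏ i, x i ^ (Multiplicative.toAdd m) i
      map_one' := by simp
      map_mul' := fun m m' => by simp [zpow_add, Finset.prod_mul_distrib] }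
  let q : AddMonoidAlgebra k (Fin n → ℤ) →+* F := AddMonoidAlgebra.liftNCRingHom
    ((algebraMap (MvPolynomial σ k) F).comp MvPolynomial.C) χ fun _ _ => Commute.all _ _
  have h : q.comp (polyToLaurent k ε) = algebraMap _ _ := by
    refine MvPolynomial.ringHom_ext (fun c => ?_) fun s => ?_
    · rw [RingHom.comp_apply, polyToLaurent, MvPolynomial.coe_eval₂Hom, MvPolynomial.eval₂_C]
      refine (AddMonoidAlgebra.liftNC_single _ _ _ _).trans ?_
      simp
    · rw [RingHom.comp_apply, polyToLaurent, MvPolynomial.coe_eval₂Hom, MvPolynomial.eval₂_X]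
      refine (AddMonoidAlgebra.liftNC_single _ _ _ _).trans ?_
      change _ * ((∏ i, x i ^ (Pi.single (ε s) 1 : Fin n → ℤ) i : Fˣ) : F) = _
      rw [Finset.prod_eq_single (ε s) (fun j _ hj => by simp [hj]) (by simp)]
      simp [x]
  have h2 : Function.Injective (q.comp (polyToLaurent k ε)) := by
    rw [h]; exact FaithfulSMul.algebraMap_injective _ _
  exact Function.Injective.of_comp (f := q) h2

/-- The Laurent polynomial ring is the localization of the polynomial ring at the product of the
variables. -/
theorem isOpenImmersion_polyToLaurent :
    IsOpenImmersion (Spec.map (CommRingCat.ofHom (polyToLaurent k ε))) := by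
  have := Fintype.ofEquiv _ ε.symm
  let := (polyToLaurent k ε).toAlgebra
  have hN : ∀ N : ℕ, polyToLaurent k ε (∏ s, .X s) ^ N =
      AddMonoidAlgebra.single (N • 1) 1 := fun N => by
    rw [polyToLaurent_prod, AddMonoidAlgebra.single_pow, one_pow]
  have : IsLocalization.Away (∏ s, .X s : MvPolynomial σ k) (AddMonoidAlgebra k (Fin n → ℤ)) := by
    refine ⟨?_, ?_, ?_⟩
    · rintro ⟨_, N, rfl⟩
      change IsUnit (polyToLaurent k ε (_ ^ N))
      rw [map_pow]
      refine IsUnit.pow _ (IsUnit.of_mul_eq_one (AddMonoidAlgebra.single (-1) 1) ?_)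
      rw [polyToLaurent_prod, AddMonoidAlgebra.single_mul_single, add_neg_cancel, one_mul]
      rfl
    · intro z
      suffices h : ∃ (N : ℕ) (a : MvPolynomial σ k),
          z * polyToLaurent k ε (∏ s, .X s) ^ N = polyToLaurent k ε a by
        obtain ⟨N, a, h⟩ := h
        refine ⟨(a, ⟨_, N, rfl⟩), ?_⟩
        change z * polyToLaurent k ε (_ ^ N) = _
        rw [map_pow, h]
        rfl
      induction z using AddMonoidAlgebra.induction_linear with
      | zero => exact ⟨0, 0, by simp⟩
      | add z z' h h' =>
        obtain ⟨N, a, h⟩ := h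
        obtain ⟨N', a', h'⟩ := h'
        refine ⟨N + N', a * (∏ s, .X s) ^ N' + a' * (∏ s, .X s) ^ N, ?_⟩
        rw [map_add, map_mul, map_mul, ← h, ← h', map_pow, map_pow]
        ring
      | single m c =>
        -- Multiplying by the product of the variables to the power `∑ |m_i|` clears all negative
        -- exponents.
        have hb : ∀ i, 0 ≤ (m + (∑ i, (m i).natAbs) • (1 : Fin n → ℤ)) i := fun i => by
          have h1 : (m i).natAbs ≤ ∑ i, (m i).natAbs :=
            Finset.single_le_sum (f := fun i => (m i).natAbs) (fun _ _ => Nat.zero_le _)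
              (Finset.mem_univ i)
          rw [Pi.add_apply, Pi.smul_apply, Pi.one_apply, nsmul_eq_mul, mul_one]
          omega
        obtain ⟨a, ha⟩ := exists_polyToLaurent_eq (k := k) ε _ hb c
        refine ⟨∑ i, (m i).natAbs, a, ?_⟩
        rw [hN, AddMonoidAlgebra.single_mul_single, ha, mul_one]
    · intro a b hab
      exact ⟨1, by rw [polyToLaurent_injective ε hab]⟩
  exact IsOpenImmersion.of_isLocalization (∏ s, .X s : MvPolynomial σ k)

end Laurent

/-! ### The torus action and the dense orbit of the quotient. -/

section Toric

variable {V : Type} [Quiver.{0} V] [Fintype V] [DecidableEq V] {k : Type u} [Field k] {o : V}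
  {X W : Scheme.{u}}

/-- The functions at the arrows given by a point of the torus with the coordinates at the arrows
outside of a tree. -/
def torusCoord {n : ℕ} (ch : Quiver.Total V → Fin n → ℤ)
    (τ : X ⟶ Spec (.of (AddMonoidAlgebra k (Fin n → ℤ)))) (e : Quiver.Total V) : Γ(X, ⊤) :=
  ofSpec τ (AddMonoidAlgebra.single (ch e) 1)

variable {n : ℕ} (ch : Quiver.Total V → Fin n → ℤ)

theorem isUnit_torusCoord (τ : X ⟶ Spec (.of (AddMonoidAlgebra k (Fin n → ℤ))))
    (e : Quiver.Total V) : IsUnit (torusCoord ch τ e) := by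
  refine IsUnit.of_mul_eq_one (ofSpec τ (AddMonoidAlgebra.single (-ch e) 1)) ?_
  rw [torusCoord, ← map_mul, AddMonoidAlgebra.single_mul_single, add_neg_cancel, one_mul,
    ← AddMonoidAlgebra.one_def, map_one]

theorem torusCoord_comp (τ : X ⟶ Spec (.of (AddMonoidAlgebra k (Fin n → ℤ)))) (q : W ⟶ X) :
    torusCoord ch (q ≫ τ) = fun e => q.appTop (torusCoord ch τ e) := by
  funext e
  rw [torusCoord, ofSpec_comp]
  rfl

/-- Multiplication by a point of the torus. -/
def torusTwist (τ : X ⟶ Spec (.of (AddMonoidAlgebra k (Fin n → ℤ)))) (h : X ⟶ GQ k o) : X ⟶ GQ k o :=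
  twist (torusCoord ch τ) (isUnit_torusCoord ch τ) h

theorem comp_torusTwist (τ : X ⟶ Spec (.of (AddMonoidAlgebra k (Fin n → ℤ)))) (h : X ⟶ GQ k o)
    (q : W ⟶ X) : q ≫ torusTwist ch τ h = torusTwist ch (q ≫ τ) (q ≫ h) := by
  rw [torusTwist, comp_twist]
  exact twist_congr (torusCoord_comp ch τ q).symm _ _ rfl

theorem torusTwist_toBase (τ : X ⟶ Spec (.of (AddMonoidAlgebra k (Fin n → ℤ)))) (h : X ⟶ GQ k o) :
    torusTwist ch τ h ≫ gitToBase k inc (specialWeight o) = h ≫ gitToBase k inc (specialWeight o) :=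
  twist_toBase _ _ _

/-- The quotient as a scheme over the base field. -/
abbrev overGQ (k : Type u) [Field k] (o : V) : Over (Spec (.of k)) :=
  Over.mk (gitToBase k (inc (V := V)) (specialWeight o))

/-- The counit of the Laurent ring sends each monomial to `1`; below, the comultiplication sending a
monomial `χ` to `χ ⊗ χ` plays the corresponding role for products. These two facts turn the group
laws into identities between twists. -/
theorem torusCoord_one (S : Over (Spec (.of k))) :
    torusCoord ch (toUnit S ≫ MonObj.one (X := stdTorus k n)).left = fun _ => 1 := by
  funext e
  have h : ofSpec ((toUnit S).left ≫ Spec.map (CommRingCat.ofHom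
      (Bialgebra.counitAlgHom k (AddMonoidAlgebra k (Fin n → ℤ)) :
        AddMonoidAlgebra k (Fin n → ℤ) →+* k))) (AddMonoidAlgebra.single (ch e) 1) = 1 := by
    rw [ofSpec_comp_map, RingHom.comp_apply]
    have : (Bialgebra.counitAlgHom k (AddMonoidAlgebra k (Fin n → ℤ)) :
        AddMonoidAlgebra k (Fin n → ℤ) →+* k) (AddMonoidAlgebra.single (ch e) 1) = 1 := by
      change Coalgebra.counit (R := k) (AddMonoidAlgebra.single (ch e) (1 : k)) = 1
      simp
    rw [this, map_one]
  exact h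

theorem ofSpec_comp_pullbackSpecIso {R A B : Type u} [CommRing R] [CommRing A] [CommRing B]
    [Algebra R A] [Algebra R B] (m : X ⟶ Limits.pullback
      (Spec.map (CommRingCat.ofHom (algebraMap R A))) (Spec.map (CommRingCat.ofHom (algebraMap R B))))
    (a : A) (b : B) : ofSpec (m ≫ (pullbackSpecIso R A B).hom) (a ⊗ₜ b) =
        ofSpec (m ≫ Limits.pullback.fst _ _) a * ofSpec (m ≫ Limits.pullback.snd _ _) b := by
  rw [← pullbackSpecIso_hom_fst, ← pullbackSpecIso_hom_snd, ← Category.assoc, ofSpec_comp_map,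
    ← Category.assoc, ofSpec_comp_map, RingHom.comp_apply, RingHom.comp_apply, ← map_mul]
  congr 1
  change _ = (a ⊗ₜ[R] (1 : B)) * ((1 : A) ⊗ₜ[R] b)
  rw [Algebra.TensorProduct.tmul_mul_tmul, one_mul, mul_one]

theorem torusCoord_mul {S : Over (Spec (.of k))} (x : S ⟶ stdTorus k n ⊗ stdTorus k n)  :
    torusCoord ch (x ≫ MonObj.mul (X := stdTorus k n)).left = fun e =>
      torusCoord ch (x ≫ fst _ _).left e * torusCoord ch (x ≫ snd _ _).left e := by
  funext e
  have h : ∀ m : S.left ⟶ Limits.pullback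
      (Spec.map (CommRingCat.ofHom (algebraMap k (AddMonoidAlgebra k (Fin n → ℤ)))))
      (Spec.map (CommRingCat.ofHom (algebraMap k (AddMonoidAlgebra k (Fin n → ℤ))))),
      ofSpec (m ≫ (pullbackSpecIso k _ _).hom ≫ Spec.map (CommRingCat.ofHom
        (Bialgebra.comulAlgHom k (AddMonoidAlgebra k (Fin n → ℤ)) :
          AddMonoidAlgebra k (Fin n → ℤ) →+*
            AddMonoidAlgebra k (Fin n → ℤ) ⊗[k] AddMonoidAlgebra k (Fin n → ℤ)))) (AddMonoidAlgebra.single (ch e) 1) =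
        ofSpec (m ≫ Limits.pullback.fst _ _) (AddMonoidAlgebra.single (ch e) 1) *
          ofSpec (m ≫ Limits.pullback.snd _ _) (AddMonoidAlgebra.single (ch e) 1) := by
    intro m
    rw [← Category.assoc, ofSpec_comp_map, RingHom.comp_apply]
    have : (Bialgebra.comulAlgHom k (AddMonoidAlgebra k (Fin n → ℤ)) :
        AddMonoidAlgebra k (Fin n → ℤ) →+*
          AddMonoidAlgebra k (Fin n → ℤ) ⊗[k] AddMonoidAlgebra k (Fin n → ℤ)) (AddMonoidAlgebra.single (ch e) 1) =
        AddMonoidAlgebra.single (ch e) 1 ⊗ₜ[k] AddMonoidAlgebra.single (ch e) 1 := by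
      change Coalgebra.comul (R := k) (AddMonoidAlgebra.single (ch e) (1 : k)) = _
      simp
    rw [this, ofSpec_comp_pullbackSpecIso]
  exact h x.left

theorem torusTwist_one (S : Over (Spec (.of k))) (h : S.left ⟶ GQ k o) :
    torusTwist ch (toUnit S ≫ MonObj.one (X := stdTorus k n)).left h = h :=
  (twist_congr (torusCoord_one ch S) _ (fun _ => isUnit_one) rfl).trans (twist_one h)

theorem torusTwist_mul {S : Over (Spec (.of k))} (x : S ⟶ stdTorus k n ⊗ stdTorus k n)
    (h : S.left ⟶ GQ k o) :
    torusTwist ch (x ≫ MonObj.mul (X := stdTorus k n)).left h =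
      torusTwist ch (x ≫ fst _ _).left (torusTwist ch (x ≫ snd _ _).left h) :=
  (twist_congr (torusCoord_mul ch x) _ (fun e => (isUnit_torusCoord ch _ e).mul
    (isUnit_torusCoord ch _ e)) rfl).trans (twist_twist _ _ _ _ _).symm

/-- The action of the torus on the quotient. -/
def torusSMul (k : Type u) [Field k] (o : V) : stdTorus k n ⊗ overGQ k o ⟶ overGQ k o :=
  Over.homMk (torusTwist ch (fst (stdTorus k n) (overGQ k o)).left
    (snd (stdTorus k n) (overGQ k o)).left) (by
      refine (torusTwist_toBase ch _ _).trans ?_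
      exact Over.w (snd (stdTorus k n) (overGQ k o)))

theorem comp_torusSMul {S : Over (Spec (.of k))} (x : S ⟶ stdTorus k n ⊗ overGQ k o) :
    (x ≫ torusSMul ch k o).left = torusTwist ch (x ≫ fst _ _).left (x ≫ snd _ _).left := by
  rw [Over.comp_left]
  exact comp_torusTwist ch _ _ _

theorem one_torusSMul (k : Type u) [Field k] (o : V) :
    MonObj.one (X := stdTorus k n) ▷ overGQ k o ≫ torusSMul ch k o =
      (λ_ (overGQ k o)).hom := by
  apply Over.OverMorphism.ext
  refine (comp_torusSMul ch _).trans ?_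
  have h1 : MonObj.one (X := stdTorus k n) ▷ overGQ k o ≫ fst _ _ =
      toUnit _ ≫ MonObj.one (X := stdTorus k n) := by
    rw [whiskerRight_fst]
    congr 1
  rw [h1, whiskerRight_snd]
  exact torusTwist_one ch _ _

theorem mul_torusSMul (k : Type u) [Field k] (o : V) :
    MonObj.mul (X := stdTorus k n) ▷ overGQ k o ≫ torusSMul ch k o =
      (α_ (stdTorus k n) (stdTorus k n) (overGQ k o)).hom ≫
        stdTorus k n ◁ torusSMul ch k o ≫ torusSMul ch k o := by
  apply Over.OverMorphism.ext
  rw [← Category.assoc]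
  refine (comp_torusSMul ch _).trans (.trans ?_ (comp_torusSMul ch _).symm)
  have h1 : ((α_ (stdTorus k n) (stdTorus k n) (overGQ k o)).hom ≫
      stdTorus k n ◁ torusSMul ch k o) ≫ fst _ _ = fst _ _ ≫ fst _ _ := by simp
  have h2 : ((α_ (stdTorus k n) (stdTorus k n) (overGQ k o)).hom ≫
      stdTorus k n ◁ torusSMul ch k o) ≫ snd _ _ =
        lift (fst _ _ ≫ snd _ _) (snd _ _) ≫ torusSMul ch k o := by
    rw [Category.assoc, whiskerLeft_snd, ← Category.assoc]
    congr 1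
    ext <;> simp
  rw [h1, h2, whiskerRight_fst, whiskerRight_snd, comp_torusSMul, lift_fst, lift_snd]
  exact torusTwist_mul ch _ _

/-- The quotient as a scheme with an action of the torus. -/
@[reducible]
def torusModObj (k : Type u) [Field k] (o : V) : ModObj (stdTorus k n) (overGQ k o) where
  smul := torusSMul ch k o
  one_smul := one_torusSMul ch k o
  mul_smul := mul_torusSMul ch k o

theorem exists_constantPoint (k : Type u) [Field k] (o : V) [hT : Nonempty (RTree o)] :
    ∃ m : Spec (.of k) ⟶ (treeLocus k o).toScheme, baseOf m = ofSpec (𝟙 _) ∧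
      coordOf m = fun _ => 1 := by
  refine exists_hom_treeLocus _ _ fun p => ⟨hT.some, ?_⟩
  rw [hT.some.total_eq_one fun _ _ => rfl, Scheme.basicOpen_of_isUnit _ isUnit_one]
  exact TopologicalSpace.Opens.mem_top p

/-- The point of the quotient with all coordinates equal to one. -/
def constantPoint (k : Type u) [Field k] (o : V) [Nonempty (RTree o)] : Spec (.of k) ⟶ GQ k o :=
  (exists_constantPoint k o).choose ≫ treeQuotient k o

theorem constantPoint_toBase (k : Type u) [Field k] (o : V) [Nonempty (RTree o)] :
    constantPoint k o ≫ gitToBase k inc (specialWeight o) = 𝟙 _ := by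
  rw [constantPoint, comp_treeQuotient_toBase, (exists_constantPoint k o).choose_spec.1,
    toSpec_ofSpec]

/-- The structure morphism of the torus. -/
abbrev stdTorusToBase (k : Type u) [Field k] (n : ℕ) :
    Spec (.of (AddMonoidAlgebra k (Fin n → ℤ))) ⟶ Spec (.of k) :=
  Spec.map (CommRingCat.ofHom (algebraMap k _))

/-- The morphism from the torus to the quotient given by the orbit of the constant point. -/
def torusOrbit (k : Type u) [Field k] (o : V) [Nonempty (RTree o)] :
    Spec (.of (AddMonoidAlgebra k (Fin n → ℤ))) ⟶ GQ k o :=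
  torusTwist ch (𝟙 _) (stdTorusToBase k n ≫ constantPoint k o)

theorem torusOrbit_toBase (k : Type u) [Field k] (o : V) [Nonempty (RTree o)] :
    torusOrbit ch k o ≫ gitToBase k inc (specialWeight o) = stdTorusToBase k n := by
  rw [torusOrbit, torusTwist_toBase, Category.assoc, constantPoint_toBase, Category.comp_id]

theorem comp_torusOrbit [Nonempty (RTree o)] (q : X ⟶ Spec (.of (AddMonoidAlgebra k (Fin n → ℤ)))) :
    q ≫ torusOrbit ch k o = torusTwist ch q ((q ≫ stdTorusToBase k n) ≫ constantPoint k o) := by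
  rw [torusOrbit, comp_torusTwist, Category.comp_id, Category.assoc]

theorem RTree.point_congr (T : RTree o) {g g' : k →+* Γ(X, ⊤)} {x x' : Quiver.Total V → Γ(X, ⊤)}
    (hg : g = g') (h : x = x') (hx : ∀ e ∈ T.arrows, IsUnit (x e))
    (hx' : ∀ e ∈ T.arrows, IsUnit (x' e)) : T.point g x hx = T.point g' x' hx' := by
  subst hg h; rfl

/-- The orbit map of the point with all coordinates `1` lands in the chart of `T`, where it is the
standard inclusion of the torus in the affine space with coordinates `z_e`. -/
theorem isOpenImmersion_torusOrbit (T : RTree o) [Nonempty (RTree o)]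
    (ε : {e // e ∉ T.arrows} ≃ Fin n) (h0 : ∀ e ∈ T.arrows, ch e = 0)
    (h1 : ∀ e : {e // e ∉ T.arrows}, ch e = Pi.single (ε e) 1) :
    IsOpenImmersion (torusOrbit ch k o) := by
  obtain ⟨hb, hc⟩ := (exists_constantPoint k o).choose_spec
  have hu : ∀ e ∈ T.arrows, torusCoord ch (𝟙 (Spec (.of (AddMonoidAlgebra k (Fin n → ℤ))))) e = 1 :=
    fun e he => by rw [torusCoord, h0 e he, ← AddMonoidAlgebra.one_def, map_one]
  let x := torusCoord ch (𝟙 (Spec (.of (AddMonoidAlgebra k (Fin n → ℤ)))))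
  let g := (ofSpec (𝟙 (Spec (.of (AddMonoidAlgebra k (Fin n → ℤ)))))).comp (algebraMap k _)
  have hx : ∀ e ∈ T.arrows, IsUnit (x e) := fun e _ => isUnit_torusCoord ch _ e
  have key : torusOrbit ch k o = T.point g x hx := by
    rw [torusOrbit, torusTwist, constantPoint, ← Category.assoc, twist_of_lift, T.comp_treeQuotient _ (fun e _ => by
      rw [coordOf_scale, coordOf_comp, hc, map_one, mul_one]
      exact isUnit_torusCoord ch _ e)]
    refine T.point_congr ?_ (funext fun e => ?_) _ _
    · rw [baseOf_scale, baseOf_comp, hb]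
      refine RingHom.ext fun c => ?_
      change _ = ofSpec (𝟙 _) _
      have h := ofSpec_comp_map (𝟙 _) (algebraMap k (AddMonoidAlgebra k (Fin n → ℤ)))
      rw [← RingHom.comp_apply, ← ofSpec_comp, ← h, Category.comp_id, Category.id_comp]
    · rw [coordOf_scale, coordOf_comp, hc, map_one, mul_one]
  -- The tuple `x` is `1` on the tree, so all path products are `1` and `z_e` is sent to the Laurent
  -- variable of `e`.
  have h2 : (T.evalChart g x hx).comp (T.polyToChart k) =
      (ofSpec (𝟙 _)).comp (polyToLaurent k ε) := by
    refine MvPolynomial.ringHom_ext (fun c => ?_) fun e => ?_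
    · rw [RingHom.comp_apply, RTree.polyToChart, MvPolynomial.coe_eval₂Hom, MvPolynomial.eval₂_C,
        T.evalChart_scalarAway, RingHom.comp_apply, RingHom.comp_apply, polyToLaurent,
        MvPolynomial.coe_eval₂Hom, MvPolynomial.eval₂_C]
    · have h := T.evalChart_coord_mul g x hx e.1
      rw [T.pathProd_eq_one hu, T.pathProd_eq_one hu, mul_one, mul_one] at h
      rw [RingHom.comp_apply, RTree.polyToChart, MvPolynomial.coe_eval₂Hom, MvPolynomial.eval₂_X,
        h, RingHom.comp_apply, polyToLaurent, MvPolynomial.coe_eval₂Hom, MvPolynomial.eval₂_X,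
        ← h1 e]
      rfl
  let E := RingEquiv.ofBijective (T.polyToChart k) ⟨T.polyToChart_injective, T.polyToChart_surjective⟩
  have h3 : T.evalChart g x hx = (ofSpec (𝟙 _)).comp ((polyToLaurent k ε).comp E.symm.toRingHom) := by
    rw [← RingHom.cancel_right T.polyToChart_surjective, h2]
    refine RingHom.ext fun a => ?_
    exact congrArg (fun b => ofSpec (𝟙 _) (polyToLaurent k ε b)) (E.symm_apply_apply a).symm
  have h4 : IsIso (Spec.map (CommRingCat.ofHom E.symm.toRingHom)) :=
    inferInstanceAs (IsIso (Spec.map (E.symm.toCommRingCatIso).hom))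
  have := isOpenImmersion_polyToLaurent (k := k) ε
  rw [key, RTree.point, h3, ← toSpec_comp, toSpec_ofSpec, Category.id_comp, CommRingCat.ofHom_comp,
    Spec.map_comp]
  infer_instance

theorem isToricVariety_gitQuotient (k : Type u) [Field k] (o : V) [hT : Nonempty (RTree o)]
    [Finite (Quiver.Total V)] : IsToricVariety (gitToBase k inc (specialWeight o)) := by
  classical
  have := Fintype.ofFinite {e // e ∉ hT.some.arrows}
  let ε := Fintype.equivFin {e // e ∉ hT.some.arrows}
  let n := Fintype.card {e // e ∉ hT.some.arrows}
  -- Only the arrows outside one tree are scaled; these index the coordinates of its chart, so the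
  -- rank of this torus is the dimension of the affine space.
  let ch : Quiver.Total V → Fin n → ℤ := fun e => if h : e ∈ hT.some.arrows then 0 else
    Pi.single (ε ⟨e, h⟩) 1
  let j : stdTorus k n ⟶ overGQ k o :=
    Over.homMk (torusOrbit ch k o) (torusOrbit_toBase ch k o)
  refine ⟨isIntegral_gitQuotient, isSeparated_gitToBase, locallyOfFiniteType_gitToBase,
    quasiCompact_gitToBase, n, j, torusModObj ch k o, ?_, ?_⟩
  · exact isOpenImmersion_torusOrbit ch hT.some ε (fun e he => dif_pos he) fun e => dif_neg e.2
  · apply Over.OverMorphism.ext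
    refine (comp_torusSMul ch (stdTorus k n ◁ j)).trans ?_
    have h1 : ∀ {S : Over (Spec (.of k))} (x : S ⟶ stdTorus k n), (x ≫ j).left =
        torusTwist ch x.left (S.hom ≫ constantPoint k o) := by
      intro S x
      have e1 : x.left ≫ stdTorusToBase k n = S.hom := Over.w x
      rw [← e1]
      exact comp_torusOrbit ch x.left
    have h2 := torusTwist_mul ch (𝟙 (stdTorus k n ⊗ stdTorus k n))
      ((stdTorus k n ⊗ stdTorus k n).hom ≫ constantPoint k o)
    -- Both sides are the constant point twisted by two torus points, in the composed form on one
    -- side and by their product on the other.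
    rw [Category.id_comp, Category.id_comp, Category.id_comp] at h2
    rw [h1, h2, whiskerLeft_fst, whiskerLeft_snd, h1]

end Toric

/-! ### Graded surjections induce closed immersions of Proj over the base. -/

section Proj

open HomogeneousLocalization

variable {A B σ τ : Type u} [CommRing A] [SetLike σ A] [AddSubgroupClass σ A]
  [CommRing B] [SetLike τ B] [AddSubgroupClass τ B] {𝒜 : ℕ → σ} {ℬ : ℕ → τ} [GradedRing 𝒜]
  [GradedRing ℬ] (f : 𝒜 →+*ᵍ ℬ)

theorem irrelevant_le_map_of_surjective (h : ∀ d, ∀ b ∈ ℬ d, ∃ a ∈ 𝒜 d, f a = b) :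
    HomogeneousIdeal.irrelevant ℬ ≤ (HomogeneousIdeal.irrelevant 𝒜).map f := by
  refine (HomogeneousIdeal.irrelevant_le _).2 fun i hi b hb => ?_
  obtain ⟨a, ha, rfl⟩ := h i b hb
  refine Ideal.mem_map_of_mem _ ?_
  exact HomogeneousIdeal.mem_irrelevant_of_mem 𝒜 hi ha

theorem awayMap_surjective (h : ∀ d, ∀ b ∈ ℬ d, ∃ a ∈ 𝒜 d, f a = b) {i : ℕ} {s : A}
    (hs : s ∈ 𝒜 i) : Function.Surjective (Away.map f s) := by
  intro z
  obtain ⟨n, b, hb, rfl⟩ := z.mk_surjective _ (Graded.map_mem f hs)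
  obtain ⟨a, ha, rfl⟩ := h _ b hb
  exact ⟨.mk _ hs n a ha, Away.map_mk _ _ _ _ _ _⟩

/-- The question is local on the target; over the basic open of a homogeneous `s` it is a morphism
of affine schemes given by a map of degree zero localizations, which inherits surjectivity from the
graded pieces. -/
theorem isClosedImmersion_projMap (h : ∀ d, ∀ b ∈ ℬ d, ∃ a ∈ 𝒜 d, f a = b) :
    IsClosedImmersion (Proj.map f (irrelevant_le_map_of_surjective f h)) := by
  set F := Proj.map f (irrelevant_le_map_of_surjective f h) with hF
  let U : (Proj.affineOpenCover 𝒜).I₀ → (Proj 𝒜).affineOpens := fun s =>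
    ⟨Proj.basicOpen 𝒜 s.2.1, Proj.isAffineOpen_basicOpen 𝒜 s.2.1 s.2.2 s.1.2⟩
  have hU : ⨆ s, (U s : (Proj 𝒜).Opens) = ⊤ := by
    have := (Proj.affineOpenCover 𝒜).openCover.iSup_opensRange
    rw [← this]
    exact iSup_congr fun s => (Proj.opensRange_awayι 𝒜 s.2.1 s.2.2 s.1.2).symm
  refine IsZariskiLocalAtTarget.of_iSup_eq_top (P := @IsClosedImmersion)
    (fun s => (U s).1) hU fun s => ?_
  have a1 : IsAffine (U s).1.toScheme := (U s).2
  have a2 : IsAffine (F ⁻¹ᵁ (U s).1).toScheme :=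
    Proj.isAffineOpen_basicOpen ℬ (f s.2.1) (Graded.map_mem f s.2.2) s.1.2
  refine IsClosedImmersion.of_surjective_of_isAffine _ ?_
  · have h1 : Function.Surjective (F.app (U s)) := by
      have e0 := Proj.awayToSection_comp_appLE f (irrelevant_le_map_of_surjective f h) s.2.2
      have e : Proj.awayToSection 𝒜 s.2.1 ≫ F.app (U s) =
          CommRingCat.ofHom (Away.map f s.2.1) ≫ Proj.awayToSection ℬ (f s.2.1) := by
        rw [← e0, ← Scheme.Hom.appLE_eq_app]
        rfl
      have h2 : Function.Surjective (Proj.awayToSection ℬ (f s.2.1)) :=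
        (ConcreteCategory.bijective_of_isIso
          (Proj.basicOpenIsoAway ℬ (f s.2.1) (Graded.map_mem f s.2.2) s.1.2).hom).2
      intro z
      obtain ⟨y, rfl⟩ := h2 z
      obtain ⟨x, rfl⟩ := awayMap_surjective f h s.2.2 y
      exact ⟨Proj.awayToSection 𝒜 s.2.1 x, ConcreteCategory.congr_hom e x⟩
    have h3 : ∀ W : (Proj 𝒜).Opens, W = U s → Function.Surjective (F.app W) := by
      rintro W rfl
      exact h1
    rw [morphismRestrict_appTop]
    intro z
    obtain ⟨y, hy⟩ := (ConcreteCategory.bijective_of_isIso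
      ((Proj ℬ).presheaf.map (eqToHom (image_morphismRestrict_preimage F (U s).1 ⊤)).op)).2 z
    obtain ⟨x, rfl⟩ := h3 _ (U s).1.ι_image_top y
    exact ⟨x, hy⟩

theorem awayι_projMap_toSpecZero
    (hf : HomogeneousIdeal.irrelevant ℬ ≤ (HomogeneousIdeal.irrelevant 𝒜).map f)
    {R : Type u} [CommRing R] (p : R →+* 𝒜 0) (q : R →+* ℬ 0) (hpq : ∀ r, f (p r).1 = (q r).1)
    {i : ℕ} (hi : 0 < i) (s : A) (hs : s ∈ 𝒜 i) :
    Proj.awayι ℬ (f s) (Graded.map_mem f hs) hi ≫ Proj.map f hf ≫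
      Proj.toSpecZero 𝒜 ≫ Spec.map (CommRingCat.ofHom p) =
      Proj.awayι ℬ (f s) (Graded.map_mem f hs) hi ≫
      Proj.toSpecZero ℬ ≫ Spec.map (CommRingCat.ofHom q) := by
  rw [Proj.awayι_comp_map_assoc f hf hi s hs, Proj.awayι_toSpecZero_assoc,
    Proj.awayι_toSpecZero_assoc, ← Spec.map_comp,
    ← Spec.map_comp, ← Spec.map_comp, ← CommRingCat.ofHom_comp, ← CommRingCat.ofHom_comp,
    ← CommRingCat.ofHom_comp]
  congr 2
  refine RingHom.ext fun r => ?_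
  refine HomogeneousLocalization.val_injective _ ?_
  change Localization.mk (f (p r).1) ⟨f 1, _⟩ = Localization.mk (q r).1 1
  congr 1
  · exact hpq r
  · exact Subtype.ext (map_one f)

theorem projMap_toSpecZero (hf : HomogeneousIdeal.irrelevant ℬ ≤ (HomogeneousIdeal.irrelevant 𝒜).map f)
    {R : Type u} [CommRing R] (p : R →+* 𝒜 0) (q : R →+* ℬ 0) (hpq : ∀ r, f (p r).1 = (q r).1) :
    Proj.map f hf ≫ Proj.toSpecZero 𝒜 ≫ Spec.map (CommRingCat.ofHom p) =
      Proj.toSpecZero ℬ ≫ Spec.map (CommRingCat.ofHom q) := by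
  refine (Proj.mapAffineOpenCover f hf).openCover.hom_ext _ _ fun s => ?_
  exact awayι_projMap_toSpecZero f hf p q hpq s.1.2 s.2.1 s.2.2

end Proj

/-! ### Closed immersions in projective space from generators of degree one. -/

section ProjectiveSpaceMap

attribute [local instance] MvPolynomial.gradedAlgebra

variable {B τ : Type u} [CommRing B] [SetLike τ B] [AddSubgroupClass τ B] {ℬ : ℕ → τ} [GradedRing ℬ]

/-- The graded homomorphism from a polynomial ring given by elements of degree one. -/
def evalGraded {R : Type u} [CommRing R] {n : ℕ} (q : R →+* ℬ 0) (x : Fin (n + 1) → ℬ 1) :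
    MvPolynomial.homogeneousSubmodule (Fin (n + 1)) R →+*ᵍ ℬ where
  __ := MvPolynomial.eval₂Hom ((SetLike.GradeZero.subring ℬ).subtype.comp q) fun i => (x i).1
  map_mem := by
    intro d p hp
    change MvPolynomial.eval₂ _ _ _ ∈ _
    rw [MvPolynomial.eval₂_eq]
    refine sum_mem fun v hv => ?_
    have h1 : ∏ i ∈ v.support, (x i).1 ^ v i ∈ ℬ (∑ i ∈ v.support, v i • 1) :=
      SetLike.prod_mem_graded _ _ _ fun i _ => SetLike.pow_mem_graded _ (x i).2
    have h2 := SetLike.mul_mem_graded (q (p.coeff v)).2 h1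
    have h3 : 0 + ∑ i ∈ v.support, v i • 1 = d := by
      rw [zero_add, ← hp (MvPolynomial.mem_support_iff.1 hv), Finsupp.weight_apply]
      rfl
    rw [h3] at h2
    exact h2

theorem isProjective_of_surjective {R : Type u} [CommRing R] {n : ℕ} (q : R →+* ℬ 0)
    (x : Fin (n + 1) → ℬ 1)
    (h : ∀ d, ∀ b ∈ ℬ d, ∃ a ∈ MvPolynomial.homogeneousSubmodule (Fin (n + 1)) R d,
      evalGraded q x a = b) :
    IsProjective (Proj.toSpecZero ℬ ≫ Spec.map (CommRingCat.ofHom q)) := by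
  refine ⟨n, Proj.map (evalGraded q x) (irrelevant_le_map_of_surjective _ h),
    isClosedImmersion_projMap _ h, ?_⟩
  exact projMap_toSpecZero _ _ _ _ fun r => MvPolynomial.eval₂_C _ _ _

end ProjectiveSpaceMap

/-! ### Projectivity over the affine quotient. -/

section Projective

attribute [local instance] MvPolynomial.gradedAlgebra

variable {V : Type} [Quiver.{0} V] [Fintype V] [DecidableEq V] {k : Type u} [Field k] {o : V}

/-- Dickson's lemma: the minimal exponent vectors of weight `ϑ` form an antichain in `ℕ^{Q_1}`. -/
theorem exists_finite_generators [Finite (Quiver.Total V)] (o : V) :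
    ∃ F : Set (Quiver.Total V →₀ ℕ), F.Finite ∧
      (∀ u ∈ F, Finsupp.weight inc u = specialWeight o) ∧
      ∀ v, Finsupp.weight inc v = specialWeight o → ∃ u ∈ F, u ≤ v := by
  refine ⟨{u | Minimal (fun v => Finsupp.weight inc v = specialWeight o) u}, ?_,
    fun u hu => hu.1, fun v hv => ?_⟩
  · exact WellQuasiOrderedLE.finite_of_isAntichain (setOfPred_minimal_antichain _)
  · obtain ⟨u, hu, h⟩ := exists_minimal_le_of_wellFoundedLT
      (fun v => Finsupp.weight inc v = specialWeight o) v hv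
    exact ⟨u, h, hu⟩

theorem isProjective_gitToAffine [Finite (Quiver.Total V)] (k : Type u) [Field k] (o : V) :
    IsProjective (gitToAffine k inc (specialWeight o)) := by
  classical
  obtain ⟨F, hF, h1, h2⟩ := exists_finite_generators o
  obtain ⟨n, g, hg⟩ := hF.fin_embedding
  have hm : ∀ (v : Quiver.Total V →₀ ℕ) (c : k) (d : ℕ),
      Finsupp.weight inc v = d • specialWeight o →
      (MvPolynomial.monomial v c).IsWeightedHomogeneous inc (d • specialWeight o) :=
    fun v c d h => MvPolynomial.isWeightedHomogeneous_monomial _ _ _ h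
  have hgw : ∀ j, Finsupp.weight inc (g j) = 1 • specialWeight o := fun j => by
    rw [one_smul]
    exact h1 _ (hg ▸ Set.mem_range_self j)
  -- There are `n` generators, but `ℙⁿ` has `n + 1` homogeneous coordinates; the first is sent to
  -- zero, which also covers the case of no generators.
  let x : Fin (n + 1) → SIG k o 1 := Fin.cons 0 fun j =>
    ⟨siMon 1 (MvPolynomial.monomial (g j) 1) (hm _ _ _ (hgw j)), siMon_mem _ _ _⟩
  let q := invariantsToZero k (inc (V := V)) (specialWeight o)
  have key : ∀ (d : ℕ) (v : Quiver.Total V →₀ ℕ) (c : k)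
      (h : Finsupp.weight inc v = d • specialWeight o),
      ∃ a ∈ MvPolynomial.homogeneousSubmodule (Fin (n + 1)) (invariants k (inc (V := V))) d,
        evalGraded q x a = siMon d (MvPolynomial.monomial v c) (hm v c d h) := by
    intro d
    induction d with
    | zero =>
      intro v c h
      refine ⟨.C ⟨MvPolynomial.monomial v c, ?_⟩, MvPolynomial.isHomogeneous_C _ _, ?_⟩
      · have := hm v c 0 h
        rwa [zero_smul] at this
      · exact (MvPolynomial.eval₂_C _ _ _).trans rfl
    | succ d ih =>
      intro v c h
      -- A generator of degree one divides the monomial, and the quotient has degree `d`, so the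
      -- induction hypothesis applies.
      obtain ⟨u', hu', hw'⟩ := exists_le_weight_eq_specialWeight v d h
      obtain ⟨u, hu, huu'⟩ := h2 u' hw'
      rw [← hg] at hu
      obtain ⟨j, rfl⟩ := hu
      have hle : g j ≤ v := huu'.trans hu'
      have hw : Finsupp.weight inc (v - g j) = d • specialWeight o := by
        have := map_add (Finsupp.weight inc) (g j) (v - g j)
        rw [add_tsub_cancel_of_le hle, h, hgw, succ_nsmul', one_smul] at this
        exact (add_left_cancel this).symm
      obtain ⟨a, ha, hae⟩ := ih _ c hw
      refine ⟨.X j.succ * a, ?_, ?_⟩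
      · rw [MvPolynomial.mem_homogeneousSubmodule, add_comm d 1]
        exact (MvPolynomial.isHomogeneous_X (invariants k (inc (V := V))) j.succ).mul ha
      · rw [map_mul, hae]
        have e : evalGraded q x (.X j.succ) =
            siMon 1 (MvPolynomial.monomial (g j) 1) (hm _ _ _ (hgw j)) :=
          MvPolynomial.eval₂_X _ _ _
        have h3 : (MvPolynomial.monomial (g j) (1 : k)) * MvPolynomial.monomial (v - g j) c =
            MvPolynomial.monomial v c := by
          rw [MvPolynomial.monomial_mul, one_mul, add_tsub_cancel_of_le hle]
        rw [e, siMon_mul _ _ (by rw [h3, add_comm]; exact hm v c _ h)]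
        exact siMon_congr (add_comm _ _) h3
  refine isProjective_of_surjective q x fun d b hb => ?_
  let f := (b : Polynomial (MvPolynomial (Quiver.Total V) k)).coeff d
  have hf : f.IsWeightedHomogeneous inc (d • specialWeight o) := b.2 d
  have hv : ∀ v : f.support, Finsupp.weight inc v.1 = d • specialWeight o := fun v =>
    hf (MvPolynomial.mem_support_iff.1 v.2)
  choose a ha hae using fun v : f.support => key d v.1 (f.coeff v.1) (hv v)
  refine ⟨∑ v, a v, Submodule.sum_mem _ fun v _ => ha v, ?_⟩
  rw [map_sum, eq_siMon_of_mem hb]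
  simp only [hae]
  apply Subtype.ext
  rw [AddSubmonoidClass.coe_finsetSum]
  change ∑ v : f.support, Polynomial.monomial d (MvPolynomial.monomial v.1 (f.coeff v.1)) =
    Polynomial.monomial d f
  rw [← map_sum]
  congr 1
  conv_rhs => rw [f.as_sum]
  exact Finset.sum_coe_sort f.support fun v => MvPolynomial.monomial v (f.coeff v)

end Projective

/-! ### Sections and local generators of sheaves of modules. -/

section Modules

variable {X Y : Scheme.{u}} {M N : X.Modules} {U V W : X.Opens}

/-- The restriction of a section of a sheaf of modules. -/
def res (h : V ≤ U) (s : Γ(M, U)) : Γ(M, V) := M.presheaf.map (homOfLE h).op s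

/-- The restriction of a function. -/
def resO (h : V ≤ U) (f : Γ(X, U)) : Γ(X, V) := X.presheaf.map (homOfLE h).op f

theorem res_res (h : V ≤ U) (h' : W ≤ V) (s : Γ(M, U)) : res h' (res h s) = res (h'.trans h) s := by
  rw [res, res, ← ConcreteCategory.comp_apply, ← Functor.map_comp]
  rfl

theorem res_self (h : U ≤ U) (s : Γ(M, U)) : res h s = s := by
  rw [res, show (homOfLE h).op = 𝟙 _ from rfl, CategoryTheory.Functor.map_id]
  rfl

theorem res_smul (h : V ≤ U) (f : Γ(X, U)) (s : Γ(M, U)) : res h (f • s) = resO h f • res h s :=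
  Scheme.Modules.map_smul _ _ _ _

theorem res_add (h : V ≤ U) (s t : Γ(M, U)) : res h (s + t) = res h s + res h t :=
  map_add _ _ _

theorem app_res (ψ : M ⟶ N) (h : V ≤ U) (s : Γ(M, U)) : ψ.app V (res h s) = res h (ψ.app U s) :=
  ConcreteCategory.congr_hom (ψ.mapPresheaf.naturality (homOfLE h).op) s

/-- The homomorphism of sheaves of modules given by compatible linear maps. -/
def mkHom (φ : ∀ U, Γ(M, U) → Γ(N, U)) (hadd : ∀ U s t, φ U (s + t) = φ U s + φ U t)
    (hsmul : ∀ U (f : Γ(X, U)) s, φ U (f • s) = f • φ U s)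
    (hres : ∀ U V (h : V ≤ U) s, φ V (res h s) = res h (φ U s)) : M ⟶ N :=
  ⟨{  app := fun U => ModuleCat.ofHom
        { toFun := φ U.unop
          map_add' := hadd _
          map_smul' := hsmul _ }
      naturality := fun {U V} i => by
        ext s
        exact hres U.unop V.unop i.unop.le s }⟩

theorem section_ext_of_cover {ι : Type*} {s t : Γ(M, U)} (C : ι → X.Opens) (hC : ∀ p ∈ U, ∃ i, p ∈ C i)
    (hle : ∀ i, C i ≤ U)
    (h : ∀ i, res (hle i) s = res (hle i) t) : s = t := by
  let F : TopCat.Sheaf Ab X := ⟨M.presheaf, M.isSheaf⟩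
  exact F.eq_of_locally_eq' C U (fun i => homOfLE (hle i)) (fun p hp => by
    simpa using hC p hp) s t h

theorem existsUnique_glue_of_cover {ι : Type*} (C : ι → X.Opens) (hC : ∀ p ∈ U, ∃ i, p ∈ C i)
    (hle : ∀ i, C i ≤ U) (s : ∀ i, Γ(M, C i))
    (h : ∀ i j, res inf_le_left (s i) = (res inf_le_right (s j) : Γ(M, C i ⊓ C j))) :
    ∃ t : Γ(M, U), ∀ i, res (hle i) t = s i := by
  let F : TopCat.Sheaf Ab X := ⟨M.presheaf, M.isSheaf⟩
  obtain ⟨t, ht, -⟩ := F.existsUnique_gluing' C U (fun i => homOfLE (hle i)) (fun p hp => by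
    simpa using hC p hp) s h
  exact ⟨t, ht⟩

theorem resO_res (h : V ≤ U) (h' : W ≤ V) (f : Γ(X, U)) : resO h' (resO h f) = resO (h'.trans h) f := by
  rw [resO, resO, ← ConcreteCategory.comp_apply, ← Functor.map_comp]
  rfl

theorem resO_self (h : U ≤ U) (f : Γ(X, U)) : resO h f = f := by
  rw [resO, show (homOfLE h).op = 𝟙 _ from rfl, CategoryTheory.Functor.map_id]
  rfl

theorem resO_mul (h : V ≤ U) (f g : Γ(X, U)) : resO h (f * g) = resO h f * resO h g :=
  map_mul _ _ _

theorem resO_one (h : V ≤ U) : resO h (1 : Γ(X, U)) = 1 :=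
  map_one (X.presheaf.map (homOfLE h).op).hom

theorem res_bijective_of_eq (h : V ≤ U) (h' : V = U) :
    Function.Bijective (res h : Γ(M, U) → Γ(M, V)) := by
  subst h'
  exact ⟨fun s t e => by rwa [res_self, res_self] at e, fun s => ⟨s, res_self _ s⟩⟩

theorem resO_bijective_of_eq (h : V ≤ U) (h' : V = U) :
    Function.Bijective (resO h : Γ(X, U) → Γ(X, V)) := by
  subst h'
  exact ⟨fun s t e => by rwa [resO_self, resO_self] at e, fun s => ⟨s, resO_self _ s⟩⟩

theorem hom_app_smul (ψ : M ⟶ N) (f : Γ(X, U)) (s : Γ(M, U)) : ψ.app U (f • s) = f • ψ.app U s :=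
  Scheme.Modules.Hom.app_smul ψ f s

/-- A section is a generator if it is a basis of the sections over each smaller open subset. -/
def IsGen (s : Γ(M, U)) : Prop :=
  ∀ (V : X.Opens) (h : V ≤ U), Function.Bijective fun f : Γ(X, V) => f • (res h s : Γ(M, V))

theorem IsGen.restrict {s : Γ(M, U)} (hs : IsGen s) (h : V ≤ U) : IsGen (res h s) := by
  intro W hW
  simp only [res_res]
  exact hs W _

theorem IsGen.bijective {s : Γ(M, U)} (hs : IsGen s) :
    Function.Bijective fun f : Γ(X, U) => f • s := by
  have := hs U le_rfl
  simpa only [res_self] using this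

theorem IsGen.unit_smul {s : Γ(M, U)} (hs : IsGen s) {f : Γ(X, U)} (hf : IsUnit f) :
    IsGen (f • s) := by
  intro W hW
  have h1 : IsUnit (resO hW f) := hf.map (X.presheaf.map (homOfLE hW).op).hom
  simp only [res_smul, smul_smul]
  exact (hs W hW).comp (Units.mulRight_bijective h1.unit)

theorem IsGen.exists_unit {s t : Γ(M, U)} (hs : IsGen s) (ht : IsGen t) :
    ∃ f : Γ(X, U), IsUnit f ∧ t = f • s := by
  obtain ⟨f, hf⟩ := hs.bijective.2 t
  obtain ⟨g, hg⟩ := ht.bijective.2 s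
  refine ⟨f, IsUnit.of_mul_eq_one g (hs.bijective.1 ?_), hf.symm⟩
  change (f * g) • s = (1 : Γ(X, U)) • s
  rw [mul_comm, mul_smul, one_smul]
  have hf' : f • s = t := hf
  rw [hf']
  exact hg

theorem isGen_map_iso (ψ : M ≅ N) {s : Γ(M, U)} (hs : IsGen s) : IsGen (ψ.hom.app U s) := by
  intro W hW
  have h1 : Function.Bijective (ψ.hom.app W) := by
    refine ⟨Function.LeftInverse.injective (g := ψ.inv.app W) fun x => ?_,
      Function.RightInverse.surjective (g := ψ.inv.app W) fun x => ?_⟩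
    · exact ConcreteCategory.congr_hom (congrArg (fun q => Scheme.Modules.Hom.app q W) ψ.hom_inv_id) x
    · exact ConcreteCategory.congr_hom (congrArg (fun q => Scheme.Modules.Hom.app q W) ψ.inv_hom_id) x
  have h2 : (fun f : Γ(X, W) => f • (res hW (ψ.hom.app U s) : Γ(N, W))) =
      ψ.hom.app W ∘ fun f : Γ(X, W) => f • (res hW s : Γ(M, W)) := by
    funext f
    rw [Function.comp_apply, hom_app_smul, app_res]
  rw [h2]
  exact h1.comp (hs W hW)

/-- A homomorphism which locally maps a generator to a generator is an isomorphism. -/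
theorem isIso_of_isGen (ψ : M ⟶ N) (h : ∀ p : X, ∃ (U : X.Opens) (_ : p ∈ U) (s : Γ(M, U)),
    IsGen s ∧ IsGen (ψ.app U s)) : IsIso ψ := by
  choose U hU s hs hs' using h
  have hinj : ∀ V, Function.Injective (ψ.app V) := by
    intro V m m' e
    refine section_ext_of_cover (fun p : X => V ⊓ U p) (fun p hp => ⟨p, hp, hU p⟩)
      (fun _ => inf_le_left) fun p => ?_
    obtain ⟨c, hc⟩ := (hs p _ inf_le_right).2 (res inf_le_left m : Γ(M, V ⊓ U p))
    obtain ⟨c', hc'⟩ := (hs p _ inf_le_right).2 (res inf_le_left m' : Γ(M, V ⊓ U p))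
    dsimp only at hc hc'
    rw [← hc, ← hc']
    congr 1
    refine (hs' p (V ⊓ U p) inf_le_right).1 ?_
    dsimp only
    rw [← app_res, ← hom_app_smul, ← hom_app_smul, hc, hc', app_res, app_res, e]
  refine Scheme.Modules.Hom.isIso_iff_isIso_app.2 fun V => ?_
  refine (ConcreteCategory.isIso_iff_bijective _).2 ⟨hinj V, fun n => ?_⟩
  have h1 : ∀ p, ∃ m : Γ(M, V ⊓ U p), ψ.app _ m = res inf_le_left n := fun p => by
    obtain ⟨c, hc⟩ := (hs' p _ inf_le_right).2 (res inf_le_left n : Γ(N, V ⊓ U p))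
    refine ⟨c • res inf_le_right (s p), ?_⟩
    rw [hom_app_smul, app_res]
    exact hc
  choose m hm using h1
  obtain ⟨t, ht⟩ := existsUnique_glue_of_cover (U := V) (fun p : X => V ⊓ U p)
    (fun p hp => ⟨p, hp, hU p⟩) (fun _ => inf_le_left) m fun i j => hinj _ (by
      rw [app_res, app_res, hm, hm, res_res, res_res])
  refine ⟨t, section_ext_of_cover (fun p : X => V ⊓ U p) (fun p hp => ⟨p, hp, hU p⟩)
      (fun _ => inf_le_left) fun p => ?_⟩
  rw [← app_res, ht, hm]

end Modules

/-! ### Characterising generators by homomorphisms to sheaves extended from an open subset. -/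

section Extension

variable {X Y : Scheme.{u}} {M N : X.Modules} {U V W : X.Opens}

/-- A sheaf is extended from an open subset if its sections are those over the intersection with
this open subset. -/
def IsExt (U : X.Opens) (N : X.Modules) : Prop :=
  ∀ V : X.Opens, Function.Bijective (res inf_le_left : Γ(N, V) → Γ(N, V ⊓ U))

/-- On `V ⊓ U` a section `m` is a unique multiple `c • s`; its image is the unique section over `V`
that restricts to `c • n`. Uniqueness of both choices gives linearity and compatibility with
restriction. -/
theorem IsGen.exists_hom {s : Γ(M, U)} (hs : IsGen s) (hN : IsExt U N) (n : Γ(N, U)) :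
    ∃ β : M ⟶ N, β.app U s = n := by
  have h1 : ∀ (V : X.Opens) (m : Γ(M, V)), ∃ n' : Γ(N, V), ∃ c : Γ(X, V ⊓ U),
      c • (res inf_le_right s : Γ(M, V ⊓ U)) = res inf_le_left m ∧
        c • (res inf_le_right n : Γ(N, V ⊓ U)) = res inf_le_left n' := fun V m => by
    obtain ⟨c, hc⟩ := (hs (V ⊓ U) inf_le_right).2 (res inf_le_left m)
    obtain ⟨n', hn'⟩ := (hN V).2 (c • (res inf_le_right n : Γ(N, V ⊓ U)))
    exact ⟨n', c, hc, hn'.symm⟩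
  choose φ hφ using h1
  have key : ∀ (V : X.Opens) (m : Γ(M, V)) (n' : Γ(N, V)) (c : Γ(X, V ⊓ U)),
      c • (res inf_le_right s : Γ(M, V ⊓ U)) = res inf_le_left m →
        c • (res inf_le_right n : Γ(N, V ⊓ U)) = res inf_le_left n' → φ V m = n' := by
    intro V m n' c h h'
    obtain ⟨d, hd, hd'⟩ := hφ V m
    refine (hN V).1 ?_
    rw [← h', ← hd', (hs (V ⊓ U) inf_le_right).1 (hd.trans h.symm)]
  refine ⟨mkHom φ ?_ ?_ ?_, ?_⟩
  · intro V m m'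
    obtain ⟨d, hd, hd'⟩ := hφ V m
    obtain ⟨d', hd1, hd1'⟩ := hφ V m'
    refine key _ _ _ (d + d') ?_ ?_
    · rw [add_smul, hd, hd1, res_add]
    · rw [add_smul, hd', hd1', res_add]
  · intro V f m
    obtain ⟨d, hd, hd'⟩ := hφ V m
    refine key _ _ _ (resO inf_le_left f * d) ?_ ?_
    · rw [mul_smul, hd, res_smul]
    · rw [mul_smul, hd', res_smul]
  · intro V W h m
    obtain ⟨d, hd, hd'⟩ := hφ V m
    have hle : W ⊓ U ≤ V ⊓ U := inf_le_inf_right _ h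
    refine key _ _ _ (resO hle d) ?_ ?_
    · have := congrArg (res hle) hd
      rw [res_smul, res_res, res_res] at this
      rw [res_res, this]
    · have := congrArg (res hle) hd'
      rw [res_smul, res_res, res_res] at this
      rw [res_res, this]
  · exact key U s n 1 (by rw [one_smul]) (by rw [one_smul])

theorem IsGen.hom_ext {s : Γ(M, U)} (hs : IsGen s) (hN : IsExt U N) {β β' : M ⟶ N}
    (h : β.app U s = β'.app U s) : β = β' := by
  refine Scheme.Modules.hom_ext _ _ fun V => ?_
  ext m
  refine (hN V).1 ?_
  obtain ⟨c, hc⟩ := (hs (V ⊓ U) inf_le_right).2 (res inf_le_left m)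
  dsimp only at hc
  rw [← app_res, ← app_res, ← hc, hom_app_smul, hom_app_smul, app_res, app_res, h]

/-- The extension of the restriction of a sheaf of modules to an open subset. -/
def extend (U : X.Opens) (M : X.Modules) : X.Modules :=
  (Scheme.Modules.pushforward U.ι).obj (M.restrict U.ι)

/-- Sections of the extension as sections of the sheaf. -/
def ofExtend (V : X.Opens) (s : Γ(extend U M, V)) : Γ(M, U.ι ''ᵁ U.ι ⁻¹ᵁ V) := s

/-- Sections of the sheaf as sections of the extension. -/
def mkExtend (V : X.Opens) (s : Γ(M, U.ι ''ᵁ U.ι ⁻¹ᵁ V)) : Γ(extend U M, V) := s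

theorem ofExtend_res (h : W ≤ V) (s : Γ(extend U M, V)) :
    ofExtend W (res h s) = res (Scheme.Hom.image_mono _ (Scheme.Hom.preimage_mono _ h)) (ofExtend V s) := rfl

theorem ofExtend_smul (f : Γ(X, V)) (s : Γ(extend U M, V)) :
    ofExtend V (f • s) = resO (U.ι.image_preimage_le V) f • ofExtend V s := by
  have : (U.ι.appIso (U.ι ⁻¹ᵁ V)).inv (U.ι.app V f) = resO (U.ι.image_preimage_le V) f :=
    ConcreteCategory.congr_hom (U.ι.app_appIso_inv V) f
  rw [← this]
  rfl

theorem image_preimage_ι (U V : X.Opens) : U.ι ''ᵁ U.ι ⁻¹ᵁ V = U ⊓ V := by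
  rw [Scheme.Hom.image_preimage_eq_opensRange_inf, Scheme.Opens.opensRange_ι]

theorem isExt_extend (U : X.Opens) (M : X.Modules) : IsExt U (extend U M) := by
  intro V
  have h : U.ι ''ᵁ U.ι ⁻¹ᵁ (V ⊓ U) = U.ι ''ᵁ U.ι ⁻¹ᵁ V := by
    rw [image_preimage_ι, image_preimage_ι, inf_comm V, ← inf_assoc, inf_idem]
  have := res_bijective_of_eq (M := M) (Scheme.Hom.image_mono U.ι
    (Scheme.Hom.preimage_mono U.ι (inf_le_left : V ⊓ U ≤ V))) h
  exact this

/-- Sections of the structure sheaf as a module, as functions. -/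
def asFun (s : Γ(unitModule X, V)) : Γ(X, V) := s

/-- Functions as sections of the structure sheaf as a module. -/
def ofFun (s : Γ(X, V)) : Γ(unitModule X, V) := s

theorem asFun_res (h : W ≤ V) (s : Γ(unitModule X, V)) : asFun (res h s) = resO h (asFun s) := rfl

theorem asFun_smul (f : Γ(X, V)) (s : Γ(unitModule X, V)) : asFun (f • s) = f * asFun s := rfl

theorem isGen_ofFun_one : IsGen (ofFun (1 : Γ(X, U))) := by
  intro W hW
  have : (fun f : Γ(X, W) => f • (res hW (ofFun (1 : Γ(X, U))) : Γ(unitModule X, W))) =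
      fun f => ofFun f := by
    funext f
    change asFun _ = f
    rw [asFun_smul, asFun_res]
    exact (congrArg (f * ·) (resO_one hW)).trans (mul_one f)
  rw [this]
  exact Function.bijective_id

/-- The restriction to an open subset. -/
def toExtend (U : X.Opens) (M : X.Modules) : M ⟶ extend U M :=
  (Scheme.Modules.restrictAdjunction U.ι).unit.app M

theorem toExtend_app (s : Γ(M, V)) :
    ofExtend V ((toExtend U M).app V s) = res (U.ι.image_preimage_le V) s := rfl

/-- A section is a generator if homomorphisms to sheaves extended from the open subset are
determined by their value at the section, which may be arbitrary. -/
theorem isGen_of_hom {s : Γ(M, U)}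
    (h1 : ∀ N : X.Modules, IsExt U N → ∀ n : Γ(N, U), ∃ β : M ⟶ N, β.app U s = n)
    (h2 : ∀ N : X.Modules, IsExt U N → ∀ β β' : M ⟶ N, β.app U s = β'.app U s → β = β') :
    IsGen s := by
  -- The homomorphism sending `s` to `1` extracts coefficients with respect to `s`. The homomorphism
  -- `δ` below multiplies coefficients by `s`.
  obtain ⟨β, hβ⟩ := h1 (extend U (unitModule X)) (isExt_extend _ _)
    (mkExtend U (1 : Γ(X, U.ι ''ᵁ U.ι ⁻¹ᵁ U)))
  have hle : ∀ V : X.Opens, U.ι ''ᵁ U.ι ⁻¹ᵁ V ≤ U := fun V => by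
    rw [image_preimage_ι]; exact inf_le_left
  let δ : extend U (unitModule X) ⟶ extend U M := mkHom
    (fun V f => mkExtend V (asFun (ofExtend V f) • (res (hle V) s : Γ(M, U.ι ''ᵁ U.ι ⁻¹ᵁ V))))
    (fun V f g => add_smul (asFun (ofExtend V f)) (asFun (ofExtend V g))
      (res (hle V) s : Γ(M, U.ι ''ᵁ U.ι ⁻¹ᵁ V))) (fun V r f => by
      change asFun (ofExtend V (r • f)) • (res (hle V) s : Γ(M, U.ι ''ᵁ U.ι ⁻¹ᵁ V)) = ofExtend V
        (r • mkExtend V (asFun (ofExtend V f) • (res (hle V) s : Γ(M, U.ι ''ᵁ U.ι ⁻¹ᵁ V))))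
      rw [ofExtend_smul, ofExtend_smul, asFun_smul, mul_smul]
      rfl) (fun V W h f => by
      change asFun (ofExtend W (res h f)) • (res (hle W) s : Γ(M, U.ι ''ᵁ U.ι ⁻¹ᵁ W)) = ofExtend W
        (res h (mkExtend V (asFun (ofExtend V f) • (res (hle V) s : Γ(M, U.ι ''ᵁ U.ι ⁻¹ᵁ V)))))
      rw [ofExtend_res, ofExtend_res, asFun_res]
      refine Eq.trans ?_ (res_smul _ _ _).symm
      rw [res_res])
  have hδ : ∀ (V : X.Opens) (f : Γ(extend U (unitModule X), V)), ofExtend V (δ.app V f) =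
      asFun (ofExtend V f) • (res (hle V) s : Γ(M, U.ι ''ᵁ U.ι ⁻¹ᵁ V)) := fun V f => rfl
  -- Both homomorphisms send `s` to its own restriction, so they agree by uniqueness. Hence each
  -- section is its extracted coefficient times `s`.
  have e1 : β ≫ δ = toExtend U M := h2 _ (isExt_extend U M) _ _ (by
    change δ.app U (β.app U s) = _
    rw [hβ]
    change ofExtend U _ = ofExtend U _
    rw [hδ, toExtend_app]
    exact one_smul _ _)
  have e2 : ∀ (V : X.Opens) (m : Γ(M, V)), res (U.ι.image_preimage_le V) m =
      asFun (ofExtend V (β.app V m)) • (res (hle V) s : Γ(M, U.ι ''ᵁ U.ι ⁻¹ᵁ V)) := fun V m => by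
    rw [← toExtend_app, ← e1]
    rfl
  intro V hV
  have hVe : U.ι ''ᵁ U.ι ⁻¹ᵁ V = V := by rw [image_preimage_ι, inf_eq_right.2 hV]
  constructor
  · intro f g hfg
    have h3 : ∀ f : Γ(X, V), asFun (ofExtend V (β.app V (f • res hV s))) =
        resO (U.ι.image_preimage_le V) f := fun f => by
      rw [hom_app_smul, app_res, hβ, ofExtend_smul, asFun_smul, ofExtend_res, asFun_res]
      exact (congrArg _ (resO_one _)).trans (mul_one _)
    refine (resO_bijective_of_eq (U.ι.image_preimage_le V) hVe).1 ?_
    rw [← h3, ← h3]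
    exact congrArg (fun x => asFun (ofExtend V (β.app V x))) hfg
  · intro m
    obtain ⟨c, hc⟩ := (resO_bijective_of_eq (U.ι.image_preimage_le V) hVe).2
      (asFun (ofExtend V (β.app V m)))
    refine ⟨c, (res_bijective_of_eq (U.ι.image_preimage_le V) hVe).1 ?_⟩
    dsimp only
    rw [res_smul, e2 V m, hc, res_res]

end Extension

/-! ### Pullback of sections and of generators. -/

section Pullback

variable {X Y Z : Scheme.{u}} (f : X ⟶ Y) {M N : Y.Modules} {U V : Y.Opens}

/-- The pullback of a section of a sheaf of modules. -/
def pb (s : Γ(M, U)) : Γ((Scheme.Modules.pullback f).obj M, f ⁻¹ᵁ U) :=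
  ((Scheme.Modules.pullbackPushforwardAdjunction f).unit.app M).app U s

theorem pb_smul (r : Γ(Y, U)) (s : Γ(M, U)) : pb f (r • s) = f.app U r • pb f s :=
  hom_app_smul ((Scheme.Modules.pullbackPushforwardAdjunction f).unit.app M) r s

theorem pb_res (h : V ≤ U) (s : Γ(M, U)) :
    pb f (res h s) = res (f.preimage_mono h) (pb f s) :=
  app_res ((Scheme.Modules.pullbackPushforwardAdjunction f).unit.app M) h s

theorem pullback_map_app_pb (ψ : M ⟶ N) (s : Γ(M, U)) :
    ((Scheme.Modules.pullback f).map ψ).app (f ⁻¹ᵁ U) (pb f s) = pb f (ψ.app U s) :=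
  (ConcreteCategory.congr_hom (congrArg (fun q => Scheme.Modules.Hom.app q U)
    ((Scheme.Modules.pullbackPushforwardAdjunction f).unit.naturality ψ)) s).symm

theorem homEquiv_app {N : X.Modules} (β : (Scheme.Modules.pullback f).obj M ⟶ N) (s : Γ(M, U)) :
    ((Scheme.Modules.pullbackPushforwardAdjunction f).homEquiv M N β).app U s =
      β.app (f ⁻¹ᵁ U) (pb f s) := by
  rw [Adjunction.homEquiv_unit]
  rfl

theorem isExt_pushforward {N : X.Modules} (hN : IsExt (f ⁻¹ᵁ U) N) :
    IsExt U ((Scheme.Modules.pushforward f).obj N) :=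
  fun V => hN (f ⁻¹ᵁ V)

/-- The pullback is accessed through its adjunction with the pushforward, which sends sheaves
extended from `f ⁻¹ᵁ U` to sheaves extended from `U`; so the characterisation of generators by
homomorphisms carries over. -/
theorem isGen_pb {s : Γ(M, U)} (hs : IsGen s) : IsGen (pb f s) := by
  refine isGen_of_hom (fun N hN n => ?_) fun N hN β β' h => ?_
  · obtain ⟨β, hβ⟩ := hs.exists_hom (isExt_pushforward f hN) n
    refine ⟨((Scheme.Modules.pullbackPushforwardAdjunction f).homEquiv M N).symm β, ?_⟩
    rw [← homEquiv_app, Equiv.apply_symm_apply]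
    exact hβ
  · refine ((Scheme.Modules.pullbackPushforwardAdjunction f).homEquiv M N).injective
      (hs.hom_ext (isExt_pushforward f hN) ?_)
    rw [homEquiv_app, homEquiv_app]
    exact h

end Pullback

/-! ### Line bundles as sheaves with local generators. -/

section LineBundle

variable {X Y : Scheme.{u}} {M N : X.Modules} {U V : X.Opens}

theorem isExt_top (M : X.Modules) : IsExt ⊤ M := fun V =>
  res_bijective_of_eq _ (inf_top_eq V)

theorem IsGen.nonempty_iso {s : Γ(M, ⊤)} (hs : IsGen s) : Nonempty (unitModule X ≅ M) := by
  obtain ⟨β, hβ⟩ := (isGen_ofFun_one (X := X) (U := ⊤)).exists_hom (isExt_top M) s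
  have : IsIso β := isIso_of_isGen β fun p => ⟨⊤, trivial, _, isGen_ofFun_one, by rwa [hβ]⟩
  exact ⟨asIso β⟩

theorem IsGen.of_restrict {s : Γ(M.restrict U.ι, ⊤)} (hs : IsGen s) :
    IsGen (M := M) (U := U.ι ''ᵁ ⊤) s := by
  intro V hV
  obtain ⟨V, rfl⟩ : ∃ W, U.ι ''ᵁ W = V := ⟨U.ι ⁻¹ᵁ V, by
    rw [image_preimage_ι]
    exact inf_eq_right.2 (hV.trans (by simp))⟩
  have h1 := (hs V le_top).comp (ConcreteCategory.bijective_of_isIso (U.ι.appIso V).hom)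
  refine (congrArg Function.Bijective (funext fun f => ?_)).mp h1
  have h2 : (U.ι.appIso V).inv ((U.ι.appIso V).hom f) = f :=
    ConcreteCategory.congr_hom (U.ι.appIso V).hom_inv_id f
  exact congrArg (fun g : Γ(X, U.ι ''ᵁ V) => g • (res (M := M) hV s : Γ(M, U.ι ''ᵁ V))) h2

theorem IsLineBundle.exists_isGen (h : IsLineBundle M) (p : X) :
    ∃ (U : X.Opens) (_ : p ∈ U) (s : Γ(M, U)), IsGen s := by
  obtain ⟨U, hp, ⟨ψ⟩⟩ := h p
  let χ := (Scheme.Modules.restrictFunctorIsoPullback U.ι).app M ≪≫ ψ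
  exact ⟨U.ι ''ᵁ ⊤, by simpa using hp, _,
    (isGen_map_iso χ.symm (isGen_ofFun_one (U := ⊤))).of_restrict⟩

theorem isLineBundle_of_isGen (h : ∀ p : X, ∃ (U : X.Opens) (_ : p ∈ U) (s : Γ(M, U)), IsGen s) :
    IsLineBundle M := by
  intro p
  obtain ⟨U, hp, s, hs⟩ := h p
  have h1 : ⊤ ≤ U.ι ⁻¹ᵁ U := by simp
  obtain ⟨e⟩ := ((isGen_pb U.ι hs).restrict h1).nonempty_iso
  exact ⟨U, hp, ⟨e.symm⟩⟩

end LineBundle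

/-! ### Local frames of families and their matrix coefficients. -/

section Frame

variable {V : Type} [Quiver.{0} V] [Fintype V] {X Y : Scheme.{u}}

/-- Generators of the sheaves of a family of representations of dimension vector `(1, ..., 1)`
over an open subset, with the matrix coefficients of the maps of the family. -/
structure Frame (F : V ⥤q X.Modules) (U : X.Opens) where
  /-- the generators -/
  gen (i : V) : Γ(F.obj i, U)
  isGen (i : V) : IsGen (gen i)
  /-- the matrix coefficients -/
  coord (e : Quiver.Total V) : Γ(X, U)
  map_gen (e : Quiver.Total V) : (F.map e.hom).app U (gen e.left) = coord e • gen e.right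

variable {F F' : V ⥤q X.Modules} {U U' : X.Opens}

theorem exists_frame (s : ∀ i, Γ(F.obj i, U)) (hs : ∀ i, IsGen (s i)) :
    ∃ σ : Frame F U, σ.gen = s := by
  have h : ∀ e : Quiver.Total V, ∃ c : Γ(X, U), c • s e.right = (F.map e.hom).app U (s e.left) :=
    fun e => (hs e.right).bijective.2 _
  choose c hc using h
  exact ⟨⟨s, hs, c, fun e => (hc e).symm⟩, rfl⟩

/-- The restriction of a frame. -/
def Frame.restrict (σ : Frame F U) (h : U' ≤ U) : Frame F U' where
  gen i := res h (σ.gen i)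
  isGen i := (σ.isGen i).restrict h
  coord e := resO h (σ.coord e)
  map_gen e := by rw [app_res, σ.map_gen, res_smul]

/-- The pullback of a frame. -/
def Frame.pullback (σ : Frame F U) (f : Y ⟶ X) : Frame (pullbackFamily f F) (f ⁻¹ᵁ U) where
  gen i := pb f (σ.gen i)
  isGen i := isGen_pb f (σ.isGen i)
  coord e := f.app U (σ.coord e)
  map_gen e := (pullback_map_app_pb f _ _).trans (by rw [σ.map_gen, pb_smul]; rfl)

theorem Frame.exists_of_repIso (σ : Frame F U) (h : RepIso F F') :
    ∃ σ' : Frame F' U, σ'.coord = σ.coord := by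
  obtain ⟨ψ, hψ⟩ := h
  refine ⟨⟨fun i => (ψ i).hom.app U (σ.gen i), fun i => isGen_map_iso (ψ i) (σ.isGen i), σ.coord,
    fun e => ?_⟩, rfl⟩
  rw [← hom_app_smul, ← σ.map_gen]
  exact (ConcreteCategory.congr_hom (congrArg (fun q => Scheme.Modules.Hom.app q U)
    (hψ _ _ e.hom)) (σ.gen e.left)).symm

/-- The coefficients of two frames differ by a change of basis. -/
theorem Frame.exists_gauge (σ σ' : Frame F U) : ∃ t : V → Γ(X, U), (∀ i, IsUnit (t i)) ∧
    (∀ i, σ'.gen i = t i • σ.gen i) ∧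
      ∀ e, σ'.coord e * t e.right = σ.coord e * t e.left := by
  choose t ht hσ using fun i => (σ.isGen i).exists_unit (σ'.isGen i)
  refine ⟨t, ht, hσ, fun e => (σ.isGen e.right).bijective.1 ?_⟩
  have h := σ'.map_gen e
  rw [hσ, hσ, hom_app_smul, σ.map_gen, smul_smul, smul_smul] at h
  dsimp only
  rw [← h, mul_comm]

/-- The neighbourhoods carrying generators, one for each of the finitely many vertices, are
intersected. -/
theorem exists_frame_of_isLineBundle (h : ∀ i, IsLineBundle (F.obj i)) (p : X) :
    ∃ (U : X.Opens) (_ : p ∈ U), Nonempty (Frame F U) := by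
  choose U hU s hs using fun i => (h i).exists_isGen p
  let W : X.Opens := ⟨⋂ i, U i, isOpen_iInter_of_finite fun i => (U i).2⟩
  have hW : ∀ i, W ≤ U i := fun i => Set.iInter_subset _ i
  obtain ⟨σ, -⟩ := exists_frame (F := F) (fun i => res (hW i) (s i)) fun i => (hs i).restrict _
  exact ⟨W, Set.mem_iInter.2 hU, ⟨σ⟩⟩

end Frame

/-! ### Stability for the special weight in terms of spanning trees. -/

section Stability

variable {V : Type} [Quiver.{0} V] [Fintype V] [DecidableEq V] {K : Type u} [Field K]

/-- Stability of a representation of dimension vector `(1, ..., 1)` for the special weight means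
that the root generates the representation. -/
theorem isStableRep_iff {o : V} (W : V ⥤q ModuleCat.{u} K) (b : ∀ i, W.obj i)
    (hb : ∀ i, Function.Bijective fun r : K => r • b i) (c : Quiver.Total V → K)
    (hc : ∀ e : Quiver.Total V, (W.map e.hom).hom (b e.left) = c e • b e.right) :
    IsStableRep (specialWeight o).1 W ↔ ∃ T : RTree o, ∀ e ∈ T.arrows, c e ≠ 0 := by
  classical
  have hb0 : ∀ i, b i ≠ 0 := fun i h => by
    have : (fun r : K => r • b i) 1 = (fun r : K => r • b i) 0 := by simp [h]
    exact one_ne_zero ((hb i).1 this)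
  have hmem : ∀ i (N : Submodule K (W.obj i)), N ≠ ⊥ → b i ∈ N := fun i N hN => by
    obtain ⟨x, hx, hx0⟩ := (Submodule.ne_bot_iff N).1 hN
    obtain ⟨r, rfl⟩ := (hb i).2 x
    have hr : r ≠ 0 := fun h => hx0 (by simp [h])
    have := N.smul_mem r⁻¹ hx
    rwa [smul_smul, inv_mul_cancel₀ hr, one_smul] at this
  have htop : ∀ i (N : Submodule K (W.obj i)), b i ∈ N → N = ⊤ := fun i N hN => by
    refine Submodule.eq_top_iff'.2 fun x => ?_
    obtain ⟨r, rfl⟩ := (hb i).2 x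
    exact N.smul_mem r hN
  constructor
  · rintro ⟨-, h⟩
    -- The vertices reached through arrows acting nontrivially support the subrepresentation
    -- generated by the root. Were it proper, stability would make its weight positive; but the
    -- vertices left out have weight `1`, and the weights of all vertices sum to zero.
    let R : V → Prop := fun i => ∃ p : Quiver.Path o i, PathIn {e | c e ≠ 0} p
    let N : ∀ i, Submodule K (W.obj i) := fun i => if R i then ⊤ else ⊥
    have hN : ∀ i, N i ≠ ⊥ ↔ R i := fun i => by
      by_cases hi : R i
      · simp only [N, if_pos hi, hi, iff_true]
        intro e
        exact hb0 i ((Submodule.mem_bot K).1 (e ▸ Submodule.mem_top))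
      · simp only [N, if_neg hi, hi, ne_eq, not_true]
    suffices hR : ∀ i, R i from exists_rTree _ hR
    by_contra hR
    push Not at hR
    obtain ⟨i₀, hi₀⟩ := hR
    have hpos := h N (fun i j e => by
      by_cases hi : R i
      · by_cases he : c ⟨i, j, e⟩ = 0
        · rintro _ ⟨x, -, rfl⟩
          obtain ⟨r, rfl⟩ := (hb i).2 x
          have := hc ⟨i, j, e⟩
          rw [he, zero_smul] at this
          simp only [map_smul]
          rw [this, smul_zero]
          exact zero_mem _
        · obtain ⟨p, hp⟩ := hi
          have : R j := ⟨p.cons e, hp, he⟩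
          simp only [N, if_pos this]
          exact le_top
      · simp only [N, if_neg hi, Submodule.map_bot]
        exact bot_le) ⟨o, (hN o).2 ⟨Quiver.Path.nil, trivial⟩⟩ ⟨i₀, by
          simp only [N, if_neg hi₀]
          intro e
          exact hb0 i₀ ((Submodule.mem_bot K).1 (e ▸ Submodule.mem_top))⟩
    have hsum : ∑ i, (specialWeight o).1 i = 0 := (specialWeight o).2
    rw [← Finset.sum_filter_add_sum_filter_not Finset.univ (fun i => N i ≠ ⊥)] at hsum
    have hnonneg : 0 ≤ ∑ i with ¬ N i ≠ ⊥, (specialWeight o).1 i := by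
      refine Finset.sum_nonneg fun i hi => ?_
      have hi' : i ≠ o := by
        rintro rfl
        exact (Finset.mem_filter.1 hi).2 ((hN i).2 ⟨Quiver.Path.nil, trivial⟩)
      rw [specialWeight_apply_of_ne hi']
      exact zero_le_one
    exact absurd hsum (ne_of_gt (add_pos_of_pos_of_nonneg (by convert hpos) hnonneg))
  · rintro ⟨T, hT⟩
    refine ⟨fun i => (finrank_eq_one_iff_of_nonzero' (b i) (hb0 i)).2 (hb i).2, ?_⟩
    rintro N hN ⟨i₁, hi₁⟩ ⟨i₂, hi₂⟩
    -- A subrepresentation containing the line at the root contains everything reached along the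
    -- tree, hence is not proper. The support of a proper one therefore avoids the root and has only
    -- weights `1`.
    have hbo : N o = ⊥ := by
      by_contra hbo
      have hpath : ∀ {j : V} (p : Quiver.Path o j), PathIn T.arrows p → b j ∈ N j := by
        intro j p hp
        induction p with
        | nil => exact hmem o _ hbo
        | cons p e ih =>
          have h1 := hN _ _ e (Submodule.mem_map_of_mem (ih hp.1))
          have h2 : (W.map e).hom (b _) = c ⟨_, _, e⟩ • b _ := hc ⟨_, _, e⟩
          rw [h2] at h1
          have h3 := (N _).smul_mem (c ⟨_, _, e⟩)⁻¹ h1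
          rwa [smul_smul, inv_mul_cancel₀ (hT _ hp.2), one_smul] at h3
      exact hi₂ (htop _ _ (hpath _ (T.path_mem i₂)))
    refine Finset.sum_pos (fun i hi => ?_) ⟨i₁, by simpa using hi₁⟩
    have hi' : i ≠ o := by
      rintro rfl
      exact (Finset.mem_filter.1 hi).2 hbo
    rw [specialWeight_apply_of_ne hi']
    exact zero_lt_one

end Stability

/-! ### Stability of fibres in terms of a frame. -/

section Fibre

variable {V : Type} [Quiver.{0} V] [Fintype V] [DecidableEq V] {X : Scheme.{u}}
  {F : V ⥤q X.Modules} {U : X.Opens}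

theorem moduleSpecΓ_bijective {R : CommRingCat.{u}} {M : (Spec (.of R)).Modules} {s : Γ(M, ⊤)}
    (hs : IsGen s) : Function.Bijective fun r : R =>
      r • (s : (moduleSpecΓFunctor (R := R)).obj M) := by
  have h1 := hs.bijective.comp ((resO_bijective_of_eq (le_refl ⊤) rfl).comp
    (ConcreteCategory.bijective_of_isIso (Scheme.ΓSpecIso R).inv))
  exact h1

theorem isStableRep_moduleSpecΓ_iff {K : Type u} [Field K] {o : V}
    {F : V ⥤q (Spec (.of (CommRingCat.of K))).Modules} (σ : Frame F ⊤) :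
    IsStableRep (K := K) (specialWeight o).1
        (F ⋙q (moduleSpecΓFunctor (R := CommRingCat.of K)).toPrefunctor) ↔
      ∃ T : RTree o, ∀ e ∈ T.arrows, IsUnit (σ.coord e) := by
  let ι := Scheme.ΓSpecIso (CommRingCat.of K)
  have hι : ∀ z, ι.inv (ι.hom z) = z := fun z => ConcreteCategory.congr_hom ι.hom_inv_id z
  have h0 : ∀ z, ι.hom z ≠ 0 ↔ IsUnit z := fun z => by
    rw [← isUnit_iff_ne_zero]
    refine ⟨fun h => ?_, fun h => h.map ι.hom.hom⟩
    have := h.map ι.inv.hom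
    rwa [show ι.inv.hom (ι.hom z) = z from hι z] at this
  refine (isStableRep_iff (K := K) (o := o) _ (fun i => σ.gen i)
    (fun i => moduleSpecΓ_bijective (R := CommRingCat.of K) (σ.isGen i))
    (fun e => ι.hom (σ.coord e)) fun e => ?_).trans
      (exists_congr fun T => forall₂_congr fun e _ => h0 _)
  refine (σ.map_gen e).trans ?_
  have h1 : resO (le_refl ⊤) (ι.inv (ι.hom (σ.coord e))) = σ.coord e := by rw [resO_self, hι]
  exact congrArg (· • σ.gen e.right) h1.symm

/-- The frame pulls back to bases of the fibre over the residue field, and a coefficient is nonzero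
there exactly when `x` lies in its basic open subset. -/
theorem isStableRep_fibre_iff {o : V} (σ : Frame F U) {x : X} (hx : x ∈ U) :
    IsStableRep (specialWeight o).1 (fibre F x) ↔
      ∃ T : RTree o, ∀ e ∈ T.arrows, x ∈ X.basicOpen (σ.coord e) := by
  let f := X.fromSpecResidueField x
  have hf : ∀ p, f p = x := fun p => Scheme.fromSpecResidueField_apply x p
  have h1 : ⊤ ≤ f ⁻¹ᵁ U := fun p _ => by
    change f p ∈ U
    rwa [hf]
  refine (isStableRep_moduleSpecΓ_iff (K := X.residueField x)
    ((σ.pullback f).restrict h1)).trans ?_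
  refine exists_congr fun T => forall₂_congr fun e _ => ?_
  change IsUnit (resO h1 (f.app U (σ.coord e))) ↔ _
  have h2 : (Spec (X.residueField x)).basicOpen (resO h1 (f.app U (σ.coord e))) =
      ⊤ ⊓ f ⁻¹ᵁ X.basicOpen (σ.coord e) := by
    rw [resO, Scheme.basicOpen_res, Scheme.preimage_basicOpen]
  constructor
  · intro h
    rw [Scheme.basicOpen_of_isUnit _ h] at h2
    obtain ⟨p⟩ : Nonempty (Spec (X.residueField x)) := inferInstance
    have h3 : p ∈ ⊤ ⊓ f ⁻¹ᵁ X.basicOpen (σ.coord e) := h2 ▸ TopologicalSpace.Opens.mem_top p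
    have h4 : f p ∈ X.basicOpen (σ.coord e) := h3.2
    rwa [hf] at h4
  · intro h
    refine isUnit_of_basicOpen_eq (h2.trans (top_le_iff.1 fun p _ => ⟨trivial, ?_⟩))
    change f p ∈ X.basicOpen (σ.coord e)
    rwa [hf]

end Fibre

/-! ### Subsheaves of modules cut out by local conditions. -/

section SubSheaf

variable {X : Scheme.{u}} (M : X.Modules)

/-- Sections are glued in the ambient sheaf `G`; the result lies in the image of `F` because it does
so locally. -/
theorem isSheaf_subpresheaf {F G : TopCat.Presheaf Ab.{u} X} (hG : G.IsSheaf) (j : F ⟶ G)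
    (hj : ∀ U, Function.Injective (j.app U))
    (hloc : ∀ (U : X.Opens) (s : G.obj (.op U)), (∀ p ∈ U, ∃ (V : X.Opens) (h : V ≤ U), p ∈ V ∧
      ∃ t : F.obj (.op V), j.app _ t = G.map (homOfLE h).op s) → ∃ t, j.app _ t = s) :
    F.IsSheaf := by
  rw [TopCat.Presheaf.isSheaf_iff_isSheafUniqueGluing]
  have hnat : ∀ {U V : X.Opens} (h : V ≤ U) (t : F.obj (.op U)),
      j.app _ (F.map (homOfLE h).op t) = G.map (homOfLE h).op (j.app _ t) := fun h t =>
    ConcreteCategory.congr_hom (j.naturality (homOfLE h).op) t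
  intro ι U sf hsf
  obtain ⟨s, hs, hs'⟩ := TopCat.Presheaf.IsSheaf.isSheafUniqueGluing hG U
    (fun i => j.app _ (sf i)) fun i i' => by
      have := congrArg (j.app _) (hsf i i')
      exact (hnat inf_le_left _).symm.trans (this.trans (hnat inf_le_right _))
  obtain ⟨t, rfl⟩ := hloc _ s fun p hp => by
    obtain ⟨i, hi⟩ := TopologicalSpace.Opens.mem_iSup.1 hp
    exact ⟨U i, le_iSup U i, hi, sf i, (hs i).symm⟩
  refine ⟨t, fun i => hj _ ?_, fun t' ht' => hj _ (hs' _ fun i => ?_)⟩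
  · exact (hnat (le_iSup U i) t).trans (hs i)
  · exact (hnat (le_iSup U i) t').symm.trans (congrArg (j.app _) (ht' i))

variable {M}

/-- The subsheaf of a sheaf of modules given by a local condition. -/
def subSheaf (S : ∀ U : X.Opens, Submodule Γ(X, U) Γ(M, U))
    (hres : ∀ (U V : X.Opens) (h : V ≤ U) (s : Γ(M, U)), s ∈ S U → res h s ∈ S V)
    (hloc : ∀ (U : X.Opens) (s : Γ(M, U)),
      (∀ p ∈ U, ∃ (V : X.Opens) (h : V ≤ U), p ∈ V ∧ res h s ∈ S V) → s ∈ S U) :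
    X.Modules :=
  let N : PresheafOfModules.Submodule M.val :=
    { obj := fun U => S U.unop
      map := fun {U V} f s hs => hres U.unop V.unop f.unop.le s hs }
  { val := N.toPresheafOfModules
    isSheaf := isSheaf_subpresheaf M.isSheaf
      ((PresheafOfModules.toPresheaf _).map N.ι) (fun U s t h => Subtype.ext h) fun U s h =>
        ⟨⟨s, hloc U s fun p hp => by
          obtain ⟨V, hV, hpV, t, ht⟩ := h p hp
          refine ⟨V, hV, hpV, ?_⟩
          have h1 : res hV s = t.1 := ht.symm
          rw [h1]
          exact t.2⟩, rfl⟩ }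

end SubSheaf

/-! ### Sheaves of functions of given weight. -/

section WeightSheaf

variable {P P' Y : Scheme.{u}} (φ : P ⟶ Y) (a p : P' ⟶ P) (χ χ' χ'' : Γ(P', ⊤))

/-- The condition that a function `f` satisfies `a^* f = χ p^* f`. -/
def IsWeight (U : P.Opens) (f : Γ(P, U)) : Prop :=
  ∀ (W : Scheme.{u}) (r : W ⟶ P') (h : ∀ x, (r ≫ a) x ∈ U) (h' : ∀ x, (r ≫ p) x ∈ U),
    pull (r ≫ a) U h f = r.appTop χ * pull (r ≫ p) U h' f

variable {a p χ χ' χ''} {U V : P.Opens}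

theorem IsWeight.mul {f g : Γ(P, U)} (hf : IsWeight a p χ U f) (hg : IsWeight a p χ' U g) :
    IsWeight a p (χ * χ') U (f * g) := fun W r h h' => by
  have h1 : r.appTop (χ * χ') = r.appTop χ * r.appTop χ' := map_mul r.appTop.hom _ _
  rw [h1, map_mul, map_mul, hf W r h h', hg W r h h', mul_mul_mul_comm]

theorem IsWeight.add {f g : Γ(P, U)} (hf : IsWeight a p χ U f) (hg : IsWeight a p χ U g) :
    IsWeight a p χ U (f + g) := fun W r h h' => by
  rw [map_add, map_add, hf W r h h', hg W r h h', mul_add]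

theorem isWeight_zero : IsWeight a p χ U 0 := fun W r h h' => by
  rw [map_zero, map_zero, mul_zero]

theorem IsWeight.resO {f : Γ(P, U)} (hf : IsWeight a p χ U f) (hV : V ≤ U) :
    IsWeight a p χ V (resO hV f) := fun W r h h' => by
  rw [MLS.resO, pull_map, pull_map, hf]

theorem isWeight_app (hφ : a ≫ φ = p ≫ φ) (U : Y.Opens) (f : Γ(Y, U)) :
    IsWeight a p 1 (φ ⁻¹ᵁ U) (φ.app U f) := fun W r h h' => by
  have h1 : (r ≫ a) ≫ φ = (r ≫ p) ≫ φ := by rw [Category.assoc, hφ, Category.assoc]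
  have h2 : r.appTop 1 = 1 := map_one r.appTop.hom
  rw [h2, one_mul, pull_app (r ≫ a) φ U h (fun x => h x), pull_app (r ≫ p) φ U h' (fun x => h' x)]
  exact pull_congr h1 _ _ _ f

theorem isWeight_of_locally {φ : P ⟶ Y} (hφ : a ≫ φ = p ≫ φ) (U : Y.Opens) (f : Γ(P, φ ⁻¹ᵁ U))
    (h : ∀ y ∈ U, ∃ (V : Y.Opens) (hV : V ≤ U), y ∈ V ∧
      IsWeight a p χ (φ ⁻¹ᵁ V) (resO (φ.preimage_mono hV) f)) :
    IsWeight a p χ (φ ⁻¹ᵁ U) f := by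
  intro W r h1 h2
  choose! V hV hy hw using h
  refine section_ext fun x _ => ?_
  have hU : φ ((r ≫ a) x) ∈ U := h1 x
  -- Since `a` and `p` agree after `φ`, the preimages of an open subset of `Y` under the two
  -- composites coincide, and the local condition applies to both pullbacks on `O`.
  let O : W.Opens := ((r ≫ a) ≫ φ) ⁻¹ᵁ V (φ ((r ≫ a) x))
  have e : (r ≫ a) ≫ φ = (r ≫ p) ≫ φ := by rw [Category.assoc, hφ, Category.assoc]
  have k1 : ∀ z, ((O.ι ≫ r) ≫ a) z ∈ φ ⁻¹ᵁ V (φ ((r ≫ a) x)) := fun z => ι_mem O z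
  have k2 : ∀ z, ((O.ι ≫ r) ≫ p) z ∈ φ ⁻¹ᵁ V (φ ((r ≫ a) x)) := fun z => by
    have h3 : O.ι z ∈ ((r ≫ p) ≫ φ) ⁻¹ᵁ V (φ ((r ≫ a) x)) := e ▸ ι_mem O z
    exact h3
  have k1' : ∀ z, ((O.ι ≫ r) ≫ a) z ∈ φ ⁻¹ᵁ U := fun z => hV _ hU (k1 z)
  have k2' : ∀ z, ((O.ι ≫ r) ≫ p) z ∈ φ ⁻¹ᵁ U := fun z => hV _ hU (k2 z)
  have key := hw _ hU O.toScheme (O.ι ≫ r) k1 k2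
  rw [resO, pull_map, pull_map] at key
  refine ⟨O, ?_, fun z => trivial, ?_⟩
  · exact hy _ hU
  · have e1 : ∀ g : Γ(W, ⊤), pull O.ι ⊤ (fun z => trivial) g = O.ι.appTop g := fun g => by
      change O.ι.appLE ⊤ ⊤ _ g = _
      rw [show O.ι.appLE ⊤ ⊤ le_rfl = O.ι.appTop from Scheme.Hom.appLE_eq_app _]
    have e2 : O.ι.appTop (r.appTop χ * pull (r ≫ p) (φ ⁻¹ᵁ U) h2 f) =
      O.ι.appTop (r.appTop χ) * O.ι.appTop (pull (r ≫ p) (φ ⁻¹ᵁ U) h2 f) :=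
      map_mul O.ι.appTop.hom _ _
    rw [e1, e1, e2, ← pull_comp O.ι (r ≫ a) _ h1 (fun z => k1' z),
      ← pull_comp O.ι (r ≫ p) _ h2 (fun z => k2' z)]
    refine (pull_congr (Category.assoc _ _ _).symm _ _ k1' f).trans (key.trans ?_)
    congr 1

variable (a p χ)

/-- The sheaf of functions `f` on the preimages of opens with `a^* f = χ p^* f`. -/
def weightSheaf (hφ : a ≫ φ = p ≫ φ) : Y.Modules :=
  subSheaf (M := (Scheme.Modules.pushforward φ).obj (unitModule P))
    (fun U =>
      { carrier := {f | IsWeight a p χ (φ ⁻¹ᵁ U) f}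
        add_mem' := IsWeight.add
        zero_mem' := isWeight_zero
        smul_mem' := fun c f hf => by
          have := (isWeight_app φ hφ U c).mul hf
          rw [one_mul] at this
          exact this })
    (fun U V h s hs => IsWeight.resO hs (φ.preimage_mono h))
    (fun U s h => isWeight_of_locally hφ U s h)

variable {a p χ} {φ} {hφ : a ≫ φ = p ≫ φ} {U V : Y.Opens}

/-- The function underlying a section of the sheaf of functions of given weight. -/
def weightFun (s : Γ(weightSheaf φ a p χ hφ, U)) : Γ(P, φ ⁻¹ᵁ U) := Subtype.val s

theorem isWeight_weightFun (s : Γ(weightSheaf φ a p χ hφ, U)) :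
    IsWeight a p χ (φ ⁻¹ᵁ U) (weightFun s) := Subtype.prop s

/-- The section given by a function of the right weight. -/
def mkWeight (f : Γ(P, φ ⁻¹ᵁ U)) (hf : IsWeight a p χ (φ ⁻¹ᵁ U) f) :
    Γ(weightSheaf φ a p χ hφ, U) := Subtype.mk f hf

theorem weightFun_mk (f : Γ(P, φ ⁻¹ᵁ U)) (hf : IsWeight a p χ (φ ⁻¹ᵁ U) f) :
    weightFun (mkWeight f hf : Γ(weightSheaf φ a p χ hφ, U)) = f := rfl

theorem weightFun_injective {s t : Γ(weightSheaf φ a p χ hφ, U)} (h : weightFun s = weightFun t) :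
    s = t := Subtype.ext h

theorem weightFun_add (s t : Γ(weightSheaf φ a p χ hφ, U)) :
    weightFun (s + t) = weightFun s + weightFun t := rfl

theorem weightFun_smul (c : Γ(Y, U)) (s : Γ(weightSheaf φ a p χ hφ, U)) :
    weightFun (c • s) = φ.app U c * weightFun s := rfl

theorem weightFun_res (h : V ≤ U) (s : Γ(weightSheaf φ a p χ hφ, U)) :
    weightFun (res h s) = resO (φ.preimage_mono h) (weightFun s) := rfl

/-- Multiplication with a function of a given weight. -/
def mulWeight (g : Γ(P, ⊤)) (hg : IsWeight a p χ ⊤ g) (h : χ * χ' = χ'') :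
    weightSheaf φ a p χ' hφ ⟶ weightSheaf φ a p χ'' hφ :=
  mkHom (fun U s => mkWeight (resO le_top g * weightFun s) (by
      subst h
      exact (hg.resO le_top).mul (isWeight_weightFun s)))
    (fun U s t => weightFun_injective (by
      rw [weightFun_mk, weightFun_add, weightFun_add, weightFun_mk, weightFun_mk, mul_add]))
    (fun U f s => weightFun_injective (by
      rw [weightFun_mk, weightFun_smul, weightFun_smul, weightFun_mk, mul_left_comm]))
    (fun U V h s => weightFun_injective (by
      rw [weightFun_mk, weightFun_res, weightFun_res, weightFun_mk, resO_mul, resO_res]))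

end WeightSheaf

/-! ### Invertible functions of a given weight are generators. -/

section WeightGen

variable {P P' Y : Scheme.{u}} {φ : P ⟶ Y} {a p : P' ⟶ P} {χ : Γ(P', ⊤)} {hφ : a ≫ φ = p ≫ φ}
  {U : Y.Opens}

/-- The quotient of a function of weight `χ` by an invertible one of the same weight is invariant,
hence comes from a function on `Y`, which is unique because pulling back functions is injective. -/
theorem isGen_of_isUnit_weightFun
    (hinv : ∀ (U : Y.Opens) (f : Γ(P, φ ⁻¹ᵁ U)), IsWeight a p 1 (φ ⁻¹ᵁ U) f → ∃ g, φ.app U g = f)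
    (hinj : ∀ U : Y.Opens, Function.Injective (φ.app U)) {s : Γ(weightSheaf φ a p χ hφ, U)}
    (hs : IsUnit (weightFun s)) : IsGen s := by
  intro V hV
  set w := weightFun (res hV s) with hw
  have hwu : IsUnit w := hs.map (P.presheaf.map (homOfLE (φ.preimage_mono hV)).op).hom
  constructor
  · intro f g hfg
    have h1 := congrArg weightFun hfg
    dsimp only at h1
    rw [weightFun_smul, weightFun_smul] at h1
    exact hinj V (hwu.mul_right_cancel h1)
  · intro t
    obtain ⟨w', hw'⟩ := hwu.exists_left_inv
    obtain ⟨g, hg⟩ := hinv V (weightFun t * w') fun W r h h' => by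
      have h1 : r.appTop 1 = 1 := map_one r.appTop.hom
      have hu := hwu.map (pull (r ≫ a) _ h)
      have e1 : pull (r ≫ a) _ h w' * pull (r ≫ a) _ h w = 1 := by rw [← map_mul, hw', map_one]
      have e2 : pull (r ≫ p) _ h' w' * pull (r ≫ p) _ h' w = 1 := by rw [← map_mul, hw', map_one]
      have e3 : pull (r ≫ a) _ h w = r.appTop χ * pull (r ≫ p) _ h' w :=
        isWeight_weightFun (res hV s) W r h h'
      have e4 : pull (r ≫ a) _ h (weightFun t) = r.appTop χ * pull (r ≫ p) _ h' (weightFun t) :=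
        isWeight_weightFun t W r h h'
      rw [h1, one_mul, map_mul, map_mul]
      refine hu.mul_right_cancel ?_
      rw [mul_assoc, e1, mul_one, e4, e3]
      linear_combination (-(r.appTop χ * pull (r ≫ p) _ h' (weightFun t))) * e2
    refine ⟨g, weightFun_injective ?_⟩
    dsimp only
    rw [weightFun_smul, hg, ← hw, mul_assoc, hw', mul_one]

end WeightGen

/-! ### The universal family. -/

section Universal

variable {V : Type} [Quiver.{0} V] [Fintype V] [DecidableEq V] {k : Type u} [Field k] {o : V}
  {X : Scheme.{u}}

theorem appTop_charAt {W : Scheme.{u}} (r : W ⟶ X) (t : X ⟶ torus k V) (m : Wt V) :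
    r.appTop (charAt t m) = charAt (r ≫ t) m := by
  rw [charAt, charAt, ofSpec_comp]
  rfl

theorem pull_top {W : Scheme.{u}} (r : W ⟶ X) (h : ∀ p, r p ∈ (⊤ : X.Opens)) (f : Γ(X, ⊤)) :
    pull r ⊤ h f = r.appTop f := by
  change r.appLE ⊤ ⊤ _ f = _
  rw [show r.appLE ⊤ ⊤ le_rfl = r.appTop from Scheme.Hom.appLE_eq_app _]

variable (k o) in
/-- The character of a weight on the torus, as a function on the product. -/
def prodChar (m : Wt V) : Γ(TorusProd k o, ⊤) := charAt (Limits.pullback.fst _ _) m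

theorem prodChar_add (m m' : Wt V) : prodChar k o m * prodChar k o m' = prodChar k o (m + m') :=
  (charAt_add _ _ _).symm

/-- The coordinate functions. -/
abbrev coordFun (k : Type u) [Field k] (o : V) (e : Quiver.Total V) :
    Γ((treeLocus k o).toScheme, ⊤) := coordOf (𝟙 _) e

theorem appTop_coordFun (m : X ⟶ (treeLocus k o).toScheme) (e : Quiver.Total V) :
    m.appTop (coordFun k o e) = coordOf m e := by
  rw [← coordOf_comp, Category.comp_id]

theorem isWeight_coordFun (e : Quiver.Total V) :
    IsWeight (treeAction k o) (Limits.pullback.snd _ _) (prodChar k o (inc e)) ⊤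
      (coordFun k o e) := fun W r h h' => by
  rw [pull_top, pull_top, appTop_coordFun, appTop_coordFun, coordOf_comp_treeAction, prodChar,
    appTop_charAt]

/-- The weights of the arrows along the path telescope to `χ_i - χ_o`; these products serve as
sections of the universal line bundles. -/
theorem isWeight_pathProd {i : V} (q : Quiver.Path o i) :
    IsWeight (treeAction k o) (Limits.pullback.snd _ _) (prodChar k o (chi o i)) ⊤
      (pathProd (coordFun k o) q) := by
  induction q with
  | nil =>
    intro W r h h'
    rw [chi_self, prodChar, appTop_charAt, pathProd_nil, map_one, map_one, charAt,
      ← AddMonoidAlgebra.one_def, map_one, mul_one]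
  | @cons j l q e ih =>
    have := ih.mul (isWeight_coordFun (k := k) (o := o) ⟨j, l, e⟩)
    rw [prodChar_add, add_comm, inc_add_chi o] at this
    exact this

variable (k o) in
/-- The universal family of representations on the GIT quotient. -/
def universalFamily : V ⥤q (GQ k o).Modules where
  obj i := weightSheaf (treeQuotient k o) (treeAction k o) (Limits.pullback.snd _ _)
    (prodChar k o (chi o i)) comp_treeAction_treeQuotient
  map {i j} e := mulWeight (coordFun k o ⟨i, j, e⟩) (isWeight_coordFun _)
    ((prodChar_add _ _).trans (congrArg _ (inc_add_chi o ⟨i, j, e⟩)))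

theorem isGen_universalFamily {i : V} {U : (GQ k o).Opens} {s : Γ((universalFamily k o).obj i, U)}
    (hs : IsUnit (weightFun (hφ := comp_treeAction_treeQuotient) s)) : IsGen s :=
  isGen_of_isUnit_weightFun (fun U f hf => exists_app_eq_of_invariant U f fun W r h h' => by
    have h1 : r.appTop 1 = 1 := map_one r.appTop.hom
    have := hf W r h h'
    rwa [h1, one_mul] at this) treeQuotient_app_injective hs

variable (k o) in
/-- The section of the universal family given by the product along a path. -/
def pathSection {i : V} (q : Quiver.Path o i) (U : (GQ k o).Opens) :
    Γ((universalFamily k o).obj i, U) :=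
  mkWeight (hφ := comp_treeAction_treeQuotient) (resO le_top (pathProd (coordFun k o) q)) ((isWeight_pathProd q).resO le_top)

theorem isGen_pathSection_nil (U : (GQ k o).Opens) :
    IsGen (pathSection k o (Quiver.Path.nil : Quiver.Path o o) U) := by
  refine isGen_universalFamily ?_
  rw [pathSection, weightFun_mk, pathProd_nil, resO_one]
  exact isUnit_one

/-- The preimage of the chart is where the product of all path products is invertible, so each path
product is invertible there. -/
theorem RTree.isGen_pathSection (T : RTree o) (i : V) :
    IsGen (pathSection k o (T.path i) (T.chart k)) := by
  refine isGen_universalFamily ?_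
  rw [pathSection, weightFun_mk]
  have h1 := T.comp_treeQuotient_preimage_chart (k := k) (𝟙 _)
  rw [Category.id_comp] at h1
  refine isUnit_of_basicOpen_eq ?_
  rw [resO, Scheme.basicOpen_res, inf_eq_left, h1]
  rw [← T.totalErase_mul _ i, Scheme.basicOpen_mul]
  exact inf_le_right

/-- In the frame of path products, the coefficient of an arrow is `z_e`. It is computed by pulling
back along the section of the chart, on which all path products equal `1`. -/
theorem RTree.exists_frame_chart (T : RTree o) : ∃ σ : Frame (universalFamily k o) (T.chart k),
    σ.gen o = pathSection k o .nil (T.chart k) ∧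
      ∀ e, pull (T.chart k).ι _ (ι_mem _) (σ.coord e) = coordOf (T.sec k) e := by
  obtain ⟨σ, hσ⟩ := exists_frame (F := universalFamily k o)
    (fun i => pathSection k o (T.path i) (T.chart k)) T.isGen_pathSection
  have hσ' : ∀ i, σ.gen i = pathSection k o (T.path i) (T.chart k) := fun i => by rw [hσ]
  refine ⟨σ, by rw [hσ', T.path_root], fun e => ?_⟩
  have h1 := congrArg (weightFun (hφ := comp_treeAction_treeQuotient)) (σ.map_gen e)
  rw [hσ', hσ'] at h1
  have h2 : resO le_top (coordFun k o e) * resO le_top (pathProd (coordFun k o) (T.path e.left)) =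
      (treeQuotient k o).app _ (σ.coord e) *
        resO le_top (pathProd (coordFun k o) (T.path e.right)) := h1
  have hm : ∀ p, T.sec k p ∈ treeQuotient k o ⁻¹ᵁ T.chart k := fun p => by
    have : (T.sec k ≫ treeQuotient k o) p ∈ T.chart k := by
      rw [T.sec_comp]
      exact ι_mem _ p
    exact this
  have h3 := congrArg (pull (T.sec k) _ hm) h2
  have h4 : ∀ f : Γ((treeLocus k o).toScheme, ⊤), pull (T.sec k) _ hm (resO le_top f) =
      (T.sec k).appTop f := fun f => by
    rw [resO, pull_map, pull_top]
  have h5 : ∀ i, (T.sec k).appTop (pathProd (coordFun k o) (T.path i)) = 1 := fun i => by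
    refine (map_pathProd (T.sec k).appTop.hom _ _).trans (T.pathProd_eq_one (fun e he => ?_) i)
    exact (appTop_coordFun _ _).trans (T.coordOf_sec he)
  rw [map_mul, map_mul, h4, h4, h4, h5, h5, mul_one, mul_one, appTop_coordFun,
    pull_app _ _ _ hm (fun p => hm p)] at h3
  rw [h3]
  exact pull_congr T.sec_comp.symm _ _ _ _

theorem isUnit_of_pull_ι {U : X.Opens} {f : Γ(X, U)} (h : IsUnit (pull U.ι U (ι_mem _) f)) :
    IsUnit f := by
  obtain ⟨g, hg⟩ := h.exists_right_inv
  obtain ⟨g, rfl⟩ := (pull_ι_bijective U).2 g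
  rw [← map_mul, ← map_one (pull U.ι U (ι_mem _))] at hg
  exact IsUnit.of_mul_eq_one _ ((pull_ι_bijective U).1 hg)

theorem isStableFamily_universalFamily (k : Type u) [Field k] (o : V) :
    IsStableFamily (specialWeight o).1 o (universalFamily k o) where
  lineBundle i := isLineBundle_of_isGen fun p => by
    obtain ⟨T, hT⟩ := exists_mem_chart p
    exact ⟨_, hT, _, T.isGen_pathSection i⟩
  normalised := by
    obtain ⟨e⟩ := (isGen_pathSection_nil (k := k) (o := o) ⊤).nonempty_iso
    exact ⟨e.symm⟩
  stable x := by
    obtain ⟨T, hT⟩ := exists_mem_chart x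
    obtain ⟨σ, -, hσ⟩ := T.exists_frame_chart (k := k)
    refine (isStableRep_fibre_iff σ hT).2 ⟨T, fun e he => ?_⟩
    rw [Scheme.basicOpen_of_isUnit]
    · exact hT
    · refine isUnit_of_pull_ι ?_
      rw [hσ, T.coordOf_sec he]
      exact isUnit_one

end Universal

/-! ### Homomorphisms and isomorphisms given on local generators. -/

section LocalGenerators

variable {X : Scheme.{u}} {M N : X.Modules} {ι : Type*} (C : ι → X.Opens)

theorem hom_ext_of_isGen (hC : ∀ p, ∃ i, p ∈ C i) {s : ∀ i, Γ(M, C i)} (hs : ∀ i, IsGen (s i))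
    {β β' : M ⟶ N} (h : ∀ i, β.app (C i) (s i) = β'.app (C i) (s i)) : β = β' := by
  refine Scheme.Modules.hom_ext _ _ fun U => ?_
  ext m
  refine section_ext_of_cover (fun i => U ⊓ C i) (fun p hp => (hC p).imp fun i hi => ⟨hp, hi⟩)
    (fun _ => inf_le_left) fun i => ?_
  obtain ⟨c, hc⟩ := (hs i (U ⊓ C i) inf_le_right).2 (res inf_le_left m)
  dsimp only at hc
  rw [← app_res, ← app_res, ← hc, hom_app_smul, hom_app_smul, app_res, app_res, h]

/-- Line bundles with the same transition functions are isomorphic: the image of a section is glued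
from its coefficients with respect to the `s i`, placed in front of the `n i`. -/
theorem exists_iso_of_isGen (hC : ∀ p, ∃ i, p ∈ C i) {s : ∀ i, Γ(M, C i)} (hs : ∀ i, IsGen (s i))
    {n : ∀ i, Γ(N, C i)} (hn : ∀ i, IsGen (n i))
    (h : ∀ i j (c : Γ(X, C i ⊓ C j)), (res inf_le_right (s j) : Γ(M, C i ⊓ C j)) =
      c • res inf_le_left (s i) → (res inf_le_right (n j) : Γ(N, C i ⊓ C j)) =
      c • res inf_le_left (n i)) : ∃ ψ : M ≅ N, ∀ i, ψ.hom.app (C i) (s i) = n i := by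
  have hcov : ∀ U : X.Opens, ∀ p ∈ U, ∃ i, p ∈ U ⊓ C i := fun U p hp =>
    (hC p).imp fun i hi => ⟨hp, hi⟩
  have h1 : ∀ (U : X.Opens) (m : Γ(M, U)), ∃ n' : Γ(N, U), ∀ i, ∃ c : Γ(X, U ⊓ C i),
      c • (res inf_le_right (s i) : Γ(M, U ⊓ C i)) = res inf_le_left m ∧
        c • (res inf_le_right (n i) : Γ(N, U ⊓ C i)) = res inf_le_left n' := fun U m => by
    choose c hc using fun i => (hs i (U ⊓ C i) inf_le_right).2 (res inf_le_left m)
    dsimp only at hc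
    obtain ⟨t, ht⟩ := existsUnique_glue_of_cover (fun i => U ⊓ C i) (hcov U)
      (fun _ => inf_le_left) (fun i => c i • (res inf_le_right (n i) : Γ(N, U ⊓ C i)))
      fun i j => by
        obtain ⟨d, -, hd⟩ := ((hs i).restrict (inf_le_left : C i ⊓ C j ≤ C i)).exists_unit
          ((hs j).restrict inf_le_right)
        have hd' := h i j d hd
        have hle : (U ⊓ C i) ⊓ (U ⊓ C j) ≤ C i ⊓ C j := inf_le_inf inf_le_right inf_le_right
        have e1 := congrArg (res hle) hd
        have e2 := congrArg (res hle) hd'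
        rw [res_smul, res_res, res_res] at e1 e2
        rw [res_smul, res_smul, res_res, res_res, e2, smul_smul]
        congr 1
        refine (hs i ((U ⊓ C i) ⊓ (U ⊓ C j)) (inf_le_left.trans inf_le_right)).1 ?_
        dsimp only
        have f1 := congrArg (res (inf_le_left : (U ⊓ C i) ⊓ (U ⊓ C j) ≤ U ⊓ C i)) (hc i)
        have f2 := congrArg (res (inf_le_right : (U ⊓ C i) ⊓ (U ⊓ C j) ≤ U ⊓ C j)) (hc j)
        rw [res_smul, res_res, res_res] at f1 f2
        rw [f1, mul_smul, ← e1, f2]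
    exact ⟨t, fun i => ⟨c i, hc i, (ht i).symm⟩⟩
  choose φ hφ using h1
  have key : ∀ (U : X.Opens) (m : Γ(M, U)) (n' : Γ(N, U)), (∀ i, ∃ c : Γ(X, U ⊓ C i),
      c • (res inf_le_right (s i) : Γ(M, U ⊓ C i)) = res inf_le_left m ∧
        c • (res inf_le_right (n i) : Γ(N, U ⊓ C i)) = res inf_le_left n') → φ U m = n' := by
    intro U m n' h'
    refine section_ext_of_cover (fun i => U ⊓ C i) (hcov U) (fun _ => inf_le_left) fun i => ?_
    obtain ⟨c, hc, hc'⟩ := h' i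
    obtain ⟨d, hd, hd'⟩ := hφ U m i
    rw [← hc', ← hd', (hs i (U ⊓ C i) inf_le_right).1 (hd.trans hc.symm)]
  let β : M ⟶ N := mkHom φ
    (fun U m m' => key _ _ _ fun i => by
      obtain ⟨d, hd, hd'⟩ := hφ U m i
      obtain ⟨d', hd1, hd1'⟩ := hφ U m' i
      exact ⟨d + d', by rw [add_smul, hd, hd1, res_add], by rw [add_smul, hd', hd1', res_add]⟩)
    (fun U f m => key _ _ _ fun i => by
      obtain ⟨d, hd, hd'⟩ := hφ U m i
      exact ⟨resO inf_le_left f * d, by rw [mul_smul, hd, res_smul],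
        by rw [mul_smul, hd', res_smul]⟩)
    (fun U W hW m => key _ _ _ fun i => by
      obtain ⟨d, hd, hd'⟩ := hφ U m i
      have hle : W ⊓ C i ≤ U ⊓ C i := inf_le_inf_right _ hW
      have e1 := congrArg (res hle) hd
      have e2 := congrArg (res hle) hd'
      rw [res_smul, res_res, res_res] at e1 e2
      exact ⟨resO hle d, by rw [e1, res_res], by rw [e2, res_res]⟩)
  have hβ : ∀ i, β.app (C i) (s i) = n i := fun i => key _ _ _ fun j => by
    obtain ⟨d, -, hd⟩ := ((hs j).restrict (inf_le_left : C j ⊓ C i ≤ C j)).exists_unit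
      ((hs i).restrict inf_le_right)
    have hd' := h j i d hd
    have hle : C i ⊓ C j ≤ C j ⊓ C i := le_inf inf_le_right inf_le_left
    have e1 := congrArg (res hle) hd
    have e2 := congrArg (res hle) hd'
    rw [res_smul, res_res, res_res] at e1 e2
    exact ⟨resO hle d, e1.symm, e2.symm⟩
  have : IsIso β := isIso_of_isGen β fun p => by
    obtain ⟨i, hi⟩ := hC p
    exact ⟨C i, hi, s i, hs i, by rw [hβ]; exact hn i⟩
  exact ⟨asIso β, hβ⟩

end LocalGenerators

/-! ### Isomorphisms of families with matching frames. -/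

section FrameIso

variable {V : Type} [Quiver.{0} V] [Fintype V] [DecidableEq V] {X : Scheme.{u}} {o : V}
  {F F' : V ⥤q X.Modules}

/-- A gauge transformation is determined by its value at the root: it propagates along the tree,
whose coefficients are units. -/
theorem RTree.eq_of_gauge (T : RTree o) {A : Type*} [CommRing A] {c c' : Quiver.Total V → A}
    {t t' : V → A} (hc' : ∀ e ∈ T.arrows, IsUnit (c' e))
    (h : ∀ e, c' e * t e.right = c e * t e.left) (h' : ∀ e, c' e * t' e.right = c e * t' e.left)
    (ho : t o = t' o) (i : V) : t i = t' i := by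
  have h1 := pathProd_gauge (fun e => (h e).symm) (T.path i)
  have h2 := pathProd_gauge (fun e => (h' e).symm) (T.path i)
  rw [ho, h2] at h1
  exact (T.isUnit_pathProd hc' i).mul_left_cancel h1.symm

/-- Two families with frames with the same coefficients are isomorphic. -/
theorem repIso_of_frames (s : Γ(F.obj o, ⊤)) (s' : Γ(F'.obj o, ⊤))
    (h : ∀ p : X, ∃ (U : X.Opens) (_ : p ∈ U) (σ : Frame F U) (σ' : Frame F' U),
      σ.coord = σ'.coord ∧ σ.gen o = res le_top s ∧ σ'.gen o = res le_top s' ∧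
        ∃ T : RTree o, ∀ e ∈ T.arrows, IsUnit (σ.coord e)) : RepIso F F' := by
  choose C hC σ σ' hcoord ho ho' T hT using h
  have key : ∀ i, ∃ ψ : F.obj i ≅ F'.obj i, ∀ p, ψ.hom.app (C p) ((σ p).gen i) = (σ' p).gen i := by
    refine fun i => exists_iso_of_isGen C (fun p => ⟨p, hC p⟩) (fun p => (σ p).isGen i)
      (fun p => (σ' p).isGen i) fun p q c hc => ?_
    have hl : C p ⊓ C q ≤ C p := inf_le_left
    have hr : C p ⊓ C q ≤ C q := inf_le_right
    obtain ⟨t, -, ht, ht'⟩ := ((σ p).restrict hl).exists_gauge ((σ q).restrict hr)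
    obtain ⟨t', -, hu, hu'⟩ := ((σ' p).restrict hl).exists_gauge ((σ' q).restrict hr)
    -- At the root both frames restrict the same global generator, so the change of frame is trivial
    -- there. As the coefficients of the two families agree, the changes of frame `t` and `t'` then
    -- agree at every vertex.
    have hto : t o = 1 := (((σ p).restrict hl).isGen o).bijective.1 (by
      dsimp only
      rw [← ht, one_smul]
      change res hr ((σ q).gen o) = res hl ((σ p).gen o)
      rw [ho, ho, res_res, res_res])
    have hto' : t' o = 1 := (((σ' p).restrict hl).isGen o).bijective.1 (by
      dsimp only
      rw [← hu, one_smul]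
      change res hr ((σ' q).gen o) = res hl ((σ' p).gen o)
      rw [ho', ho', res_res, res_res])
    have e1 : ((σ' q).restrict hr).coord = ((σ q).restrict hr).coord := by
      funext e
      change resO hr ((σ' q).coord e) = resO hr ((σ q).coord e)
      rw [hcoord]
    have e2 : ((σ' p).restrict hl).coord = ((σ p).restrict hl).coord := by
      funext e
      change resO hl ((σ' p).coord e) = resO hl ((σ p).coord e)
      rw [hcoord]
    rw [e1, e2] at hu'
    have htt := (T q).eq_of_gauge (fun e he => (hT q e he).map (X.presheaf.map (homOfLE hr).op).hom)
      ht' hu' (hto.trans hto'.symm) i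
    have hct : c = t i := (((σ p).restrict hl).isGen i).bijective.1 (hc.symm.trans (ht i))
    rw [hct, htt]
    exact hu i
  choose ψ hψ using key
  refine ⟨ψ, fun i j e => hom_ext_of_isGen C (fun p => ⟨p, hC p⟩) (fun p => (σ p).isGen i)
    fun p => ?_⟩
  change (ψ j).hom.app (C p) ((F.map e).app (C p) ((σ p).gen i)) =
    (F'.map e).app (C p) ((ψ i).hom.app (C p) ((σ p).gen i))
  have h1 : (F.map e).app (C p) ((σ p).gen i) = (σ p).coord ⟨i, j, e⟩ • (σ p).gen j :=
    (σ p).map_gen ⟨i, j, e⟩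
  have h2 : (F'.map e).app (C p) ((σ' p).gen i) = (σ' p).coord ⟨i, j, e⟩ • (σ' p).gen j :=
    (σ' p).map_gen ⟨i, j, e⟩
  rw [hψ, h1, h2, hom_app_smul, hψ, hcoord]

/-- The frame with rescaled generators. -/
def Frame.rescale {U : X.Opens} (σ : Frame F U) (t : V → Γ(X, U)) (ht : ∀ i, IsUnit (t i))
    (c : Quiver.Total V → Γ(X, U)) (h : ∀ e, c e * t e.right = σ.coord e * t e.left) :
    Frame F U where
  gen i := t i • σ.gen i
  isGen i := (σ.isGen i).unit_smul (ht i)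
  coord := c
  map_gen e := by rw [hom_app_smul, σ.map_gen, smul_smul, smul_smul, h, mul_comm]

end FrameIso

/-! ### The quotient as a fine moduli space. -/

section Moduli

variable {V : Type} [Quiver.{0} V] [Fintype V] [DecidableEq V] {k : Type u} [Field k] {o : V}
  {X W : Scheme.{u}} {F : V ⥤q X.Modules}

/-- The points given by two frames of a family have the same image in the quotient. -/
theorem comp_treeQuotient_eq_of_frames {U U' : X.Opens} (σ : Frame F U) (σ' : Frame F U')
    (q : W ⟶ X) (h : ∀ p, q p ∈ U) (h' : ∀ p, q p ∈ U') {m m' : W ⟶ (treeLocus k o).toScheme}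
    (hb : baseOf m = baseOf m') (hm : ∀ e, coordOf m e = pull q U h (σ.coord e))
    (hm' : ∀ e, coordOf m' e = pull q U' h' (σ'.coord e)) :
    m ≫ treeQuotient k o = m' ≫ treeQuotient k o := by
  have hl : U ⊓ U' ≤ U := inf_le_left
  have hr : U ⊓ U' ≤ U' := inf_le_right
  have hi : ∀ p, q p ∈ U ⊓ U' := fun p => ⟨h p, h' p⟩
  obtain ⟨t, ht, -, ht'⟩ := (σ'.restrict hr).exists_gauge (σ.restrict hl)
  refine comp_treeQuotient_eq_of_gauge hb (t := fun i => pull q _ hi (t i))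
    (fun i => (ht i).map _) fun e => ?_
  have h1 := congrArg (pull q _ hi) (ht' e)
  rw [map_mul, map_mul] at h1
  have e1 : pull q _ hi ((σ.restrict hl).coord e) = pull q U h (σ.coord e) := pull_map _ _ _ _
  have e2 : pull q _ hi ((σ'.restrict hr).coord e) = pull q U' h' (σ'.coord e) := pull_map _ _ _ _
  rw [e1, e2] at h1
  rw [hm, hm']
  exact h1.symm

/-- A point with coordinates `1` on the tree has its chart coordinates as coordinates, and `m'` has
the same chart coordinates. -/
theorem RTree.coordOf_mul_pathProd (T : RTree o) {m m' : X ⟶ (treeLocus k o).toScheme}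
    (h : m ≫ treeQuotient k o = m' ≫ treeQuotient k o) (hm : ∀ e ∈ T.arrows, coordOf m e = 1) :
    (∀ e ∈ T.arrows, IsUnit (coordOf m' e)) ∧ ∀ e, coordOf m e * pathProd (coordOf m')
      (T.path e.right) = coordOf m' e * pathProd (coordOf m') (T.path e.left) := by
  have hmu : ∀ e ∈ T.arrows, IsUnit (coordOf m e) := fun e he => by
    rw [hm e he]
    exact isUnit_one
  have hm' : ∀ e ∈ T.arrows, IsUnit (coordOf m' e) := by
    rw [← T.isUnit_total_iff]
    apply isUnit_of_basicOpen_eq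
    rw [← T.comp_treeQuotient_preimage_chart, ← h, T.comp_treeQuotient_preimage_chart]
    exact Scheme.basicOpen_of_isUnit _ (T.isUnit_total_iff.2 hmu)
  refine ⟨hm', fun e => ?_⟩
  rw [T.comp_treeQuotient _ hmu, T.comp_treeQuotient _ hm', T.point_eq_iff] at h
  have e1 := T.evalChart_coord_mul (baseOf m) _ hmu e
  have e2 := T.evalChart_coord_mul (baseOf m') _ hm' e
  rw [T.pathProd_eq_one hm, T.pathProd_eq_one hm, mul_one, mul_one, h] at e1
  rw [← e1, e2]

/-- The point of the section over a chart which is given by a morphism to the quotient. -/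
theorem RTree.exists_point_of_chart (T : RTree o) {h : X ⟶ GQ k o} (q : W ⟶ X)
    (hq : ∀ p, q p ∈ h ⁻¹ᵁ T.chart k) : ∃ m : W ⟶ (treeLocus k o).toScheme,
      m ≫ treeQuotient k o = q ≫ h ∧ (∀ e ∈ T.arrows, coordOf m e = 1) ∧
        ∀ c : Quiver.Total V → Γ(GQ k o, T.chart k),
          (∀ e, pull (T.chart k).ι _ (ι_mem _) (c e) = coordOf (T.sec k) e) →
          ∀ e, coordOf m e = pull q _ hq (h.app _ (c e)) := by
  let j : W ⟶ (T.chart k).toScheme := IsOpenImmersion.lift (T.chart k).ι (q ≫ h) (by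
    rw [Scheme.Opens.range_ι]
    rintro _ ⟨p, rfl⟩
    exact hq p)
  have hj : j ≫ (T.chart k).ι = q ≫ h := IsOpenImmersion.lift_fac _ _ _
  refine ⟨j ≫ T.sec k, by rw [Category.assoc, T.sec_comp, hj], fun e he => ?_, fun c hc e => ?_⟩
  · rw [coordOf_comp, T.coordOf_sec he, map_one]
  · have h1 : ∀ p, (q ≫ h) p ∈ T.chart k := fun p => hq p
    have h2 : ∀ p, (j ≫ (T.chart k).ι) p ∈ T.chart k := fun p => ι_mem _ (j p)
    rw [coordOf_comp, ← hc, ← pull_comp _ _ _ _ h2, pull_app _ _ _ hq h1]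
    exact pull_congr hj _ _ _ _

theorem baseOf_eq_of_comp {m : W ⟶ (treeLocus k o).toScheme} {q : W ⟶ X} {h : X ⟶ GQ k o}
    {g : X ⟶ Spec (.of k)} (hm : m ≫ treeQuotient k o = q ≫ h)
    (hg : h ≫ gitToBase k inc (specialWeight o) = g) : baseOf m = ofSpec (q ≫ g) := by
  rw [← ofSpec_toSpec (baseOf m), ← comp_treeQuotient_toBase, hm, Category.assoc, hg]

/-- Two morphisms along which the pullbacks of the universal family are isomorphic are equal. -/
theorem hom_ext_of_repIso {g : X ⟶ Spec (.of k)} {h h' : X ⟶ GQ k o}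
    (hg : h ≫ gitToBase k inc (specialWeight o) = g)
    (hg' : h' ≫ gitToBase k inc (specialWeight o) = g)
    (hF : RepIso (pullbackFamily h (universalFamily k o)) F)
    (hF' : RepIso (pullbackFamily h' (universalFamily k o)) F) : h = h' := by
  refine hom_ext_opens fun p => ?_
  obtain ⟨T, hT⟩ := exists_mem_chart (h p)
  obtain ⟨T', hT'⟩ := exists_mem_chart (h' p)
  refine ⟨h ⁻¹ᵁ T.chart k ⊓ h' ⁻¹ᵁ T'.chart k, ⟨hT, hT'⟩, ?_⟩
  set O : X.Opens := h ⁻¹ᵁ T.chart k ⊓ h' ⁻¹ᵁ T'.chart k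
  have hO : ∀ p, O.ι p ∈ h ⁻¹ᵁ T.chart k := fun p => (ι_mem O p).1
  have hO' : ∀ p, O.ι p ∈ h' ⁻¹ᵁ T'.chart k := fun p => (ι_mem O p).2
  obtain ⟨m, hm, -, hmc⟩ := T.exists_point_of_chart O.ι hO
  obtain ⟨m', hm', -, hmc'⟩ := T'.exists_point_of_chart O.ι hO'
  obtain ⟨τ, -, hτ⟩ := T.exists_frame_chart (k := k)
  obtain ⟨τ', -, hτ'⟩ := T'.exists_frame_chart (k := k)
  -- Frames of the universal family over the charts are transported to frames of the same family
  -- `F`. They differ by a gauge transformation, so the points they define have the same image.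
  obtain ⟨σ, hσ⟩ := (τ.pullback h).exists_of_repIso hF
  obtain ⟨σ', hσ'⟩ := (τ'.pullback h').exists_of_repIso hF'
  rw [← hm, ← hm']
  refine comp_treeQuotient_eq_of_frames σ σ' O.ι hO hO' ?_ (fun e => ?_) fun e => ?_
  · rw [baseOf_eq_of_comp hm hg, baseOf_eq_of_comp hm' hg']
  · rw [hσ]
    exact hmc _ hτ e
  · rw [hσ']
    exact hmc' _ hτ' e

/-- The point of the complement of the locus of the tree ideal given by a frame. -/
theorem Frame.exists_point {U : X.Opens} (σ : Frame F U)
    (hF : ∀ x, IsStableRep (specialWeight o).1 (fibre F x)) (g : X ⟶ Spec (.of k)) :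
    ∃ m : U.toScheme ⟶ (treeLocus k o).toScheme, baseOf m = ofSpec (U.ι ≫ g) ∧
      ∀ e, coordOf m e = pull U.ι U (ι_mem U) (σ.coord e) := by
  obtain ⟨m, h1, h2⟩ := exists_hom_treeLocus (o := o) (ofSpec (U.ι ≫ g))
    (fun e => pull U.ι U (ι_mem U) (σ.coord e)) fun p => by
      obtain ⟨T, hT⟩ := (isStableRep_fibre_iff σ (ι_mem U p)).1 (hF (U.ι p))
      refine ⟨T, (T.mem_basicOpen_total_iff _ p).2 fun e he => ?_⟩
      have h3 : U.toScheme.basicOpen (pull U.ι U (ι_mem U) (σ.coord e)) =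
          ⊤ ⊓ U.ι ⁻¹ᵁ X.basicOpen (σ.coord e) := Scheme.basicOpen_appLE _ _ _ _ _
      rw [h3]
      exact ⟨trivial, hT e he⟩
  exact ⟨m, h1, fun e => congrFun h2 e⟩

/-- In an arbitrary local frame the generator at the root is replaced by the restriction of the
global one. -/
theorem exists_normal_frame (hF : ∀ i, IsLineBundle (F.obj i)) {s : Γ(F.obj o, ⊤)} (hs : IsGen s)
    (p : X) : ∃ (U : X.Opens) (_ : p ∈ U) (σ : Frame F U), σ.gen o = res le_top s := by
  obtain ⟨U, hp, ⟨σ⟩⟩ := exists_frame_of_isLineBundle hF p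
  obtain ⟨σ', hσ'⟩ := exists_frame (F := F) (Function.update σ.gen o (res le_top s)) fun i => by
    by_cases hi : i = o
    · subst hi
      rw [Function.update_self]
      exact hs.restrict _
    · rw [Function.update_of_ne hi]
      exact σ.isGen i
  exact ⟨U, hp, σ', by rw [hσ', Function.update_self]⟩

/-- The coefficients of a local frame are the coordinates of a point which lies in the tree locus by
stability; on overlaps the points are gauge equivalent, so their images glue. The isomorphism with
the pullback is then obtained by matching local frames. -/
theorem exists_hom_of_isStableFamily (hF : IsStableFamily (specialWeight o).1 o F)
    (g : X ⟶ Spec (.of k)) : ∃ h : X ⟶ GQ k o, h ≫ gitToBase k inc (specialWeight o) = g ∧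
      RepIso (pullbackFamily h (universalFamily k o)) F := by
  obtain ⟨ψ⟩ := hF.normalised
  let s' : Γ(F.obj o, ⊤) := ψ.symm.hom.app ⊤ (ofFun 1)
  have hs' : IsGen s' := isGen_map_iso ψ.symm isGen_ofFun_one
  choose U hU σ hσ using exists_normal_frame hF.lineBundle hs'
  choose m hmb hmc using fun p => (σ p).exists_point (o := o) hF.stable g
  have hma : ∀ (p : X) (Z : Scheme.{u}) (a : Z ⟶ (U p).toScheme) (q : Z ⟶ X)
      (hq : ∀ z, q z ∈ U p), a ≫ (U p).ι = q → baseOf (a ≫ m p) = ofSpec (q ≫ g) ∧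
      ∀ e, coordOf (a ≫ m p) e = pull q (U p) hq ((σ p).coord e) := by
    rintro p Z a q hq rfl
    refine ⟨?_, fun e => ?_⟩
    · rw [baseOf_comp, hmb, Category.assoc, ofSpec_comp a]
    · rw [coordOf_comp, hmc, ← pull_comp]
  obtain ⟨h, hh⟩ := exists_glue_opens U (fun x => ⟨x, hU x⟩)
    (fun p => m p ≫ treeQuotient k o) fun p p' Z a b hab => by
      have h1 : ∀ z, (a ≫ (U p).ι) z ∈ U p := fun z => ι_mem _ (a z)
      have h2 : ∀ z, (a ≫ (U p).ι) z ∈ U p' := fun z => by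
        rw [hab]
        exact ι_mem _ (b z)
      obtain ⟨e1, e2⟩ := hma p Z a _ h1 rfl
      obtain ⟨e3, e4⟩ := hma p' Z b _ h2 hab.symm
      rw [← Category.assoc, ← Category.assoc]
      exact comp_treeQuotient_eq_of_frames (σ p) (σ p') _ h1 h2 (e1.trans e3.symm) e2 e4
  refine ⟨h, hom_ext_opens fun p => ⟨U p, hU p, ?_⟩, ?_⟩
  · rw [← Category.assoc, hh, comp_treeQuotient_toBase, hmb, toSpec_ofSpec]
  · refine repIso_of_frames (o := o) (pb h (pathSection k o .nil ⊤)) s' fun p => ?_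
    obtain ⟨T, hT⟩ := exists_mem_chart (h p)
    obtain ⟨τ, hτo, hτ⟩ := T.exists_frame_chart (k := k)
    let O : X.Opens := U p ⊓ h ⁻¹ᵁ T.chart k
    have hl : O ≤ U p := inf_le_left
    have hr : O ≤ h ⁻¹ᵁ T.chart k := inf_le_right
    let σ₁ := (τ.pullback h).restrict hr
    let σ₂ := (σ p).restrict hl
    obtain ⟨m₁, hm₁, hm₁T, hm₁c⟩ := T.exists_point_of_chart (h := h) O.ι fun z => hr (ι_mem O z)
    obtain ⟨-, hm₂c⟩ := hma p _ (X.homOfLE hl) O.ι (fun z => hl (ι_mem O z)) (X.homOfLE_ι hl)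
    set m₂ := X.homOfLE hl ≫ m p
    have hm₂ : m₂ ≫ treeQuotient k o = O.ι ≫ h := by
      rw [Category.assoc, ← hh, ← Category.assoc, X.homOfLE_ι]
    have hc₁ : ∀ e, pull O.ι O (ι_mem O) (σ₁.coord e) = coordOf m₁ e := fun e =>
      (pull_map _ _ _ _).trans (hm₁c _ hτ e).symm
    have hc₂ : ∀ e, pull O.ι O (ι_mem O) (σ₂.coord e) = coordOf m₂ e := fun e =>
      (pull_map _ _ _ _).trans (hm₂c e).symm
    obtain ⟨hu, hg⟩ := T.coordOf_mul_pathProd (hm₁.trans hm₂.symm) hm₁T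
    have hP : ∀ i, pull O.ι O (ι_mem O) (pathProd σ₂.coord (T.path i)) =
        pathProd (coordOf m₂) (T.path i) := fun i => by
      rw [map_pathProd]
      simp only [hc₂]
    -- Multiplying the generator at `i` by the product of the coefficients along the tree path to
    -- `i` turns the coefficients into chart coordinates, which are those of the pulled back
    -- universal frame. The factor at the root is `1`, so the normalisation there is kept.
    let σ₃ := σ₂.rescale (fun i => pathProd σ₂.coord (T.path i))
      (T.isUnit_pathProd fun e he => isUnit_of_pull_ι (by rw [hc₂]; exact hu e he)) σ₁.coord
      fun e => (pull_ι_bijective O).1 (by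
        rw [map_mul, map_mul, hP, hP, hc₁, hc₂]
        exact hg e)
    refine ⟨O, ⟨hU p, hT⟩, σ₁, σ₃, rfl, ?_, ?_, T, fun e he => isUnit_of_pull_ι ?_⟩
    · change res hr (pb h (τ.gen o)) = _
      rw [hτo]
      have h1 : pathSection k o (.nil : Quiver.Path o o) (T.chart k) =
        res le_top (pathSection k o .nil ⊤) := rfl
      rw [h1, pb_res, res_res]
      rfl
    · change pathProd σ₂.coord (T.path o) • res hl ((σ p).gen o) = _
      rw [T.pathProd_root, one_smul, hσ, res_res]
    · rw [hc₁, hm₁T e he]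
      exact isUnit_one

theorem isFineModuliSpace_gitQuotient (k : Type u) [Field k] (o : V) :
    IsFineModuliSpace (specialWeight o).1 o (gitToBase k inc (specialWeight o)) := by
  refine ⟨universalFamily k o, isStableFamily_universalFamily k o, fun X g F hF => ?_⟩
  obtain ⟨h, hg, hh⟩ := exists_hom_of_isStableFamily hF g
  exact ⟨h, ⟨hg, hh⟩, fun h' hh' => hom_ext_of_repIso hh'.1 hg hh'.2 hh⟩

end Moduli

end MLS

end

theorem proposition3p2 {k : Type u} [Field k] [IsAlgClosed k] [CharZero k]
    (r a : ℕ) (ha : 0 < a) (har : a < r) (hra : Nat.Coprime a r)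
    (m : ℕ) (hm : 0 < m) (E : Fin (m + 1) → MLS.Pic r a)
    (hE0 : E 0 = 0) (hEinj : Function.Injective E) (hEeff : ∀ i, MLS.IsEffective (E i)) :
    MLS.IsFineModuliSpace (V := MLS.QuiverOfSections E)
        (MLS.specialWeight (MLS.QuiverOfSections.root E)).1 (MLS.QuiverOfSections.root E)
        (MLS.linearSeriesToBase k E) ∧
      Smooth (MLS.linearSeriesToBase k E) ∧
      MLS.IsToricVariety (MLS.linearSeriesToBase k E) ∧
      MLS.IsProjective (MLS.linearSeriesToAffine k E) ∧
      ∃ (act : Limits.pullback (MLS.torusToBase k (MLS.QuiverOfSections E))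
            ((MLS.treeLocus k (MLS.QuiverOfSections.root E)).ι ≫
              MLS.repSpaceToBase k (MLS.QuiverOfSections E)) ⟶
          (MLS.treeLocus k (MLS.QuiverOfSections.root E)).toScheme)
        (φ : (MLS.treeLocus k (MLS.QuiverOfSections.root E)).toScheme ⟶ MLS.linearSeries k E),
        act ≫ (MLS.treeLocus k (MLS.QuiverOfSections.root E)).ι =
            MLS.restrictedAction k (MLS.treeLocus k (MLS.QuiverOfSections.root E)) ∧
          MLS.IsGeometricQuotient act (Limits.pullback.snd _ _) φ ∧
          φ ≫ MLS.linearSeriesToAffine k E =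
            (MLS.treeLocus k (MLS.QuiverOfSections.root E)).ι ≫ MLS.toAffineQuotient k MLS.inc := by
  have : Fact (a < r) := ⟨har⟩
  have : Finite (Quiver.Total (MLS.QuiverOfSections E)) := MLS.finite_total
  have hT : Nonempty (MLS.RTree (MLS.QuiverOfSections.root E)) := by
    -- Since `E 0 = 0`, an effective divisor of class `E i` is a section of `E i - E 0`, and so
    -- gives a path from the root to `i`.
    obtain ⟨T, -⟩ := MLS.exists_rTree (o := MLS.QuiverOfSections.root E) Set.univ fun i => by
      obtain ⟨D, hD⟩ := hEeff i
      obtain ⟨p⟩ := MLS.QuiverOfSections.nonempty_path_of_divisorClass har hEinj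
        (MLS.QuiverOfSections.root E) i D
        (hD.trans ((sub_zero (E i)).symm.trans (congrArg (E i - ·) hE0.symm)))
      exact ⟨p, MLS.pathIn_univ p⟩
    exact ⟨T⟩
  refine ⟨MLS.isFineModuliSpace_gitQuotient k _, MLS.smooth_gitToBase,
    MLS.isToricVariety_gitQuotient k _, MLS.isProjective_gitToAffine k _,
    MLS.treeAction k _, MLS.treeQuotient k _, MLS.treeAction_ι,
    MLS.isGeometricQuotient_treeQuotient k _, ?_⟩
  have h := MLS.comp_treeQuotient_toAffine
    (𝟙 (MLS.treeLocus k (MLS.QuiverOfSections.root E)).toScheme)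
  rwa [Category.id_comp, Category.id_comp] at h
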